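/- **Setting.** Let $d\ge1$, $n\ge 2$ and $\lambda,C_0,\Lambda_0>0$. Points of $\mathbb R^{d\times n}$ are $y=(y_1,\dots,y_n)$ with $y_i\in\mathbb R^d$; "periodic" means $1$-periodic in each $y_i$, and $L^p$ is taken over the torus $\mathbb T^{d\times n}\simeq[0,1]^{d\times n}$. Put $\mathbf D_n=(\nabla_{y_1},\dots,\nabla_{y_n})$. For a tensor-valued function, $|T|$ is the sum of the absolute values of the entries and $\|T\|_{L^p}$ is the sum of the $L^p$ norms of the entries. Given scales $\varepsilon_1>\varepsilon_2>\dots>\varepsilon_n>0$, let $\delta_i=\varepsilon_i/\varepsilon_1$ and $\widehat\nabla_n=\sum_{i=1}^n\delta_i^{-1}\nabla_{y_i}$ (an $\mathbb R^d$-valued operator). For $\kappa\ge1$ write $s\simeq_\kappa t$ if $\kappa^{-1}t\le s\le\kappa t$. For a matrix $A(y)$, *ellipticity* means $\xi\cdot A\xi\ge\lambda|\xi|^2$ and $|A\xi|\le\lambda^{-1}|\xi|$ for all $\xi\in\mathbb R^d$ (Euclidean norms). A weak solution of $-\widehat\nabla_n\cdot A\widehat\nabla_n\mathcal X+\tau^2\mathcal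 X=\widehat\nabla_n\cdot(Av)$ is a periodic $\mathcal X\in L^2$ having a weak directional gradient $\widehat\nabla_n\mathcal X\in L^2$ such that $\int A\widehat\nabla_n\mathcal X\cdot\widehat\nabla_n\varphi+\tau^2\mathcal X\varphi=-\int Av\cdot\widehat\nabla_n\varphi$ for all smooth periodic $\varphi$. For positive $c_2,\dots,c_n$ and $c$ consider the conditions $$\varepsilon_j\le\frac{c_j\,\varepsilon_{j-1}}{1+\log(\varepsilon_1/\varepsilon_{j-1})}\quad(2\le j\le n),\qquad\qquad(1)$$ $$\tau>0,\qquad \tau^2\simeq_\kappa\max_{2\le j\le n}e^{-c\,\varepsilon_{j-1}/\varepsilon_j}.\qquad\qquad(2)$$ **(I) No parameter.** There is a constant $C_*>0$ depending only on $d,\lambda,C_0$, and for every $\kappa\ge1$ there are positive constants $c$, $c_j$ $(2\le j\le n)$ and $C$ depending only on $d,n,\lambda,C_0,\Lambda_0$ and $\kappa$, such that the following holds whenever (1) and (2) hold. Let $A=A(y)$ be smooth, periodic and elliptic with $\|\mathbf D_n^\ell A\|_{L^\infty}\le C_0\Lambda_0^\ell\ell!$ for all $\ell\ge0$, and let $v\in\mathbb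 R^d$ be a unit vector. Then $$-\widehat\nabla_n\cdot A\widehat\nabla_n\mathcal X+\tau^2\mathcal X=\widehat\nabla_n\cdot(Av)$$ has a weak solution $\mathcal X$ that is bounded and smooth; it is the unique weak solution (up to equality almost everywhere), and with $\Lambda=C_*\Lambda_0$ $$\|\mathcal X\|_{L^\infty}\le C,\qquad \|\mathbf D_n^\ell\widehat\nabla_n\mathcal X\|_{L^2}+\tau\|\mathbf D_n^\ell\mathcal X\|_{L^2}\le C_*\Lambda^\ell\,\ell!\quad\text{for all }\ell\ge0.$$ **(II) With a parameter.** For every $\kappa\ge1$ there are positive constants $c,c_j,C,C_*,C_\sharp,\Lambda_\sharp$ (possibly different from those in (I)) depending only on $d,n,\lambda,C_0,\Lambda_0$ and $\kappa$, such that the following holds whenever (1) and (2) hold. Let $N\ge 0$, $L_0\in\mathbb R$, and let $A=A(x,y)$, $x\in\mathbb R^N$, be periodic in $y$ and elliptic for each $x$, smooth in $y$, differentiable in $x$ with $\nabla_xA$ smooth in $y$, and $$\sup_{x,y}|\mathbf D_n^\ell A(x,y)|\le C_0\Lambda_0^\ell\ell!,\qquad \sup_{x,y}|\mathbf D_n^\ell\nabla_xA(x,y)|\le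 L_0\Lambda_0^\ell\ell!\qquad\text{for all }\ell\ge0.$$ Let $v\in\mathbb R^d$ be a unit vector. Then there is $\mathcal X=\mathcal X(x,y)$ such that for each $x$ the function $\mathcal X(x,\cdot)$ is smooth, has mean zero, and is the unique weak solution of $$-\widehat\nabla_n\cdot A(x,\cdot)\widehat\nabla_n\mathcal X+\tau^2\mathcal X=\widehat\nabla_n\cdot(A(x,\cdot)v).$$ Moreover $\mathcal X$ is differentiable in $x$, $\nabla_x\mathcal X$ is smooth in $y$, and with $\Lambda=C_*\Lambda_0$ $$\sup_x\|\mathcal X(x,\cdot)\|_{L^\infty}\le C,\qquad \sup_x\|\nabla_x\mathcal X(x,\cdot)\|_{L^\infty}\le C L_0,$$ $$\sup_x\|\mathbf D_n^\ell\widehat\nabla_n\mathcal X(x,\cdot)\|_{L^2}\le C_*\Lambda^\ell\ell!,\qquad \sup_x\|\mathbf D_n^\ell\widehat\nabla_n\nabla_x\mathcal X(x,\cdot)\|_{L^2}\le L_0C_\sharp\Lambda_\sharp^\ell\,\ell!\qquad\text{for all }\ell\ge0.$$ The constants do not depend on $L_0$ or $N$. -/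

import Mathlib

open MeasureTheory
open scoped ENNReal ContDiff Matrix

noncomputable section

namespace Multiscale

/-- The space `ℝ^{d × n}` of points `y = (y₁, …, yₙ)` with `yᵢ ∈ ℝ^d`. The entry `y i` with
`i : Fin n` is the variable `y_{i+1}` when one counts from one. -/
abbrev Pt (n d : ℕ) : Type := Fin n → Fin d → ℝ

/-- The unit coordinate vector of the variable `y_i^a`, where `p = (i, a)`. -/
def unitVec {n d : ℕ} (p : Fin n × Fin d) : Pt n d := Pi.single p.1 (Pi.single p.2 1)

/-- `f` is `1`-periodic in each `yᵢ ∈ ℝ^d`. -/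
def IsPeriodic {n d : ℕ} {β : Type*} (f : Pt n d → β) : Prop :=
  ∀ (y : Pt n d) (z : Fin n → Fin d → ℤ), f (fun i a => y i a + (z i a : ℝ)) = f y

/-- Lebesgue measure on the periodicity cell `[0,1]^{d × n}`, which represents the torus. -/
def cell (n d : ℕ) : Measure (Pt n d) := volume.restrict (Set.Icc 0 1)

/-- The entry with index `J` of the order `l` tensor `D_n^l f`, where
`D_n = (∇_1, …, ∇_n)` is the full gradient in all `d n` variables. -/
def partialD {n d l : ℕ} (J : Fin l → Fin n × Fin d) (f : Pt n d → ℝ) (y : Pt n d) : ℝ :=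
  iteratedFDeriv ℝ l f y (fun k => unitVec (J k))

/-- `‖D_n^l f‖_{L^p}` on the torus: the norm of a tensor-valued function is
the sum of the norms of its entries. -/
def normD {n d : ℕ} (p : ℝ≥0∞) (l : ℕ) (f : Pt n d → ℝ) : ℝ≥0∞ :=
  ∑ J : Fin l → Fin n × Fin d, eLpNorm (partialD J f) p (cell n d)

/-- The ratios `δ_i = ε_i / ε_1`. Scales are indexed from one: `ε 1, …, ε n`. -/
def ratio {n : ℕ} (ε : ℕ → ℝ) (i : Fin n) : ℝ := ε (i + 1) / ε 1

/-- The directional gradient `∇̂_n = ∑ i, δ_i⁻¹ ∇_i`, an `ℝ^d`-valued operator. -/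
def hatGrad {n d : ℕ} (δ : Fin n → ℝ) (f : Pt n d → ℝ) (y : Pt n d) (a : Fin d) : ℝ :=
  ∑ i : Fin n, (δ i)⁻¹ * fderiv ℝ f y (unitVec (i, a))

/-- Smooth periodic test functions, i.e. smooth functions on the torus. -/
def IsTest {n d : ℕ} (φ : Pt n d → ℝ) : Prop := ContDiff ℝ ∞ φ ∧ IsPeriodic φ

/-- `g` is the weak directional gradient `∇̂_n u` on the torus. -/
def IsWeakHatGrad {n d : ℕ} (δ : Fin n → ℝ) (u : Pt n d → ℝ) (g : Pt n d → Fin d → ℝ) : Prop :=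
  ∀ φ : Pt n d → ℝ, IsTest φ → ∀ a : Fin d,
    ∫ y, u y * hatGrad δ φ y a ∂(cell n d) = - ∫ y, g y a * φ y ∂(cell n d)

/-- `u` is a weak solution on the torus of `-∇̂_n · A ∇̂_n u + τ² u = ∇̂_n · F`: it lies in
`L²`, has a weak directional gradient in `L²`, and satisfies the equation tested against every
smooth periodic function. -/
def IsWeakSolution {n d : ℕ} (δ : Fin n → ℝ) (τ : ℝ) (A : Pt n d → Matrix (Fin d) (Fin d) ℝ)
    (F : Pt n d → Fin d → ℝ) (u : Pt n d → ℝ) : Prop :=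
  IsPeriodic u ∧ MemLp u 2 (cell n d) ∧
  ∃ g : Pt n d → Fin d → ℝ,
    IsPeriodic g ∧ (∀ a, MemLp (fun y => g y a) 2 (cell n d)) ∧ IsWeakHatGrad δ u g ∧
    ∀ φ : Pt n d → ℝ, IsTest φ →
      ∫ y, ((A y *ᵥ g y) ⬝ᵥ hatGrad δ φ y + τ ^ 2 * u y * φ y) ∂(cell n d)
        = - ∫ y, F y ⬝ᵥ hatGrad δ φ y ∂(cell n d)

/-- Ellipticity and boundedness: `ξ · A ξ ≥ lam |ξ|²` and `|A ξ| ≤ lam⁻¹ |ξ|`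
(Euclidean norms). -/
def IsElliptic {n d : ℕ} (lam : ℝ) (A : Pt n d → Matrix (Fin d) (Fin d) ℝ) : Prop :=
  ∀ (y : Pt n d) (ξ : Fin d → ℝ),
    lam * (ξ ⬝ᵥ ξ) ≤ ξ ⬝ᵥ (A y *ᵥ ξ) ∧
    √((A y *ᵥ ξ) ⬝ᵥ (A y *ᵥ ξ)) ≤ lam⁻¹ * √(ξ ⬝ᵥ ξ)

/-- All entries of `A` are smooth. -/
def IsSmoothMat {n d : ℕ} (A : Pt n d → Matrix (Fin d) (Fin d) ℝ) : Prop :=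
  ∀ a b, ContDiff ℝ ∞ (fun y => A y a b)

/-- Quantitative analyticity `‖D_n^l A‖_{L^∞} ≤ C₀ Λ₀^l l!` for all `l ≥ 0`. -/
def IsAnalyticMat {n d : ℕ} (C0 Lam0 : ℝ) (A : Pt n d → Matrix (Fin d) (Fin d) ℝ) : Prop :=
  IsSmoothMat A ∧
  ∀ l : ℕ, ∑ a, ∑ b, normD ∞ l (fun y => A y a b)
    ≤ ENNReal.ofReal (C0 * Lam0 ^ l * (l.factorial : ℝ))

/-- `ε_1 > ε_2 > … > ε_n > 0`. -/
def IsScales (n : ℕ) (ε : ℕ → ℝ) : Prop :=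
  (∀ i ∈ Finset.Icc 1 n, 0 < ε i) ∧ ∀ j ∈ Finset.Icc 2 n, ε j < ε (j - 1)

/-- The scale-separation condition `ε_j ≤ c_j ε_{j-1} / (1 + log (ε_1 / ε_{j-1}))` for
`2 ≤ j ≤ n`. -/
def ScaleSeparated (n : ℕ) (cs : ℕ → ℝ) (ε : ℕ → ℝ) : Prop :=
  ∀ j ∈ Finset.Icc 2 n, ε j ≤ cs j * ε (j - 1) / (1 + Real.log (ε 1 / ε (j - 1)))

/-- `max_{2 ≤ j ≤ n} exp (-c ε_{j-1} / ε_j)`. -/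
def maxRate (n : ℕ) (hn : 2 ≤ n) (c : ℝ) (ε : ℕ → ℝ) : ℝ :=
  (Finset.Icc 2 n).sup' (Finset.nonempty_Icc.2 hn) (fun j => Real.exp (-(c * ε (j - 1) / ε j)))

/-- `s ≃ t` with comparison constant `κ`. -/
def Comparable (κ s t : ℝ) : Prop := κ⁻¹ * t ≤ s ∧ s ≤ κ * t

/-- The derivative `∂_{x_k} f (x, y)` in the parameter `x ∈ ℝ^N`. -/
def paramD {N : ℕ} {β : Type*} (k : Fin N) (f : (Fin N → ℝ) → β → ℝ) (x : Fin N → ℝ) (y : β) : ℝ :=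
  fderiv ℝ (fun x' => f x' y) x (Pi.single k 1)

/-- Bounds on a family `A (x, y)`: for each `x` it is smooth in `y`, it is differentiable in `x`
with `∇_x A` smooth in `y`, and for all `l ≥ 0`, pointwise in `(x, y)`,
`|D_n^l A| ≤ C₀ Λ₀^l l!` and `|D_n^l ∇_x A| ≤ L₀ Λ₀^l l!`, where the size of a tensor is the sum
of the absolute values of its entries. -/
def IsAnalyticFamily {n d N : ℕ} (C0 Lam0 L0 : ℝ)
    (A : (Fin N → ℝ) → Pt n d → Matrix (Fin d) (Fin d) ℝ) : Prop :=
  (∀ x, IsSmoothMat (A x)) ∧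
  (∀ y a b, Differentiable ℝ (fun x => A x y a b)) ∧
  (∀ x k a b, ContDiff ℝ ∞ (fun y => paramD k (fun x' y' => A x' y' a b) x y)) ∧
  (∀ (l : ℕ) x y, ∑ a, ∑ b, ∑ J : Fin l → Fin n × Fin d,
    |partialD J (fun y' => A x y' a b) y| ≤ C0 * Lam0 ^ l * (l.factorial : ℝ)) ∧
  (∀ (l : ℕ) x y, ∑ k, ∑ a, ∑ b, ∑ J : Fin l → Fin n × Fin d,
    |partialD J (fun y' => paramD k (fun x' y'' => A x' y'' a b) x y') y|
      ≤ L0 * Lam0 ^ l * (l.factorial : ℝ))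

end Multiscale

end

/-!
The whole argument takes place in the algebra of smooth periodic functions and rests on one
energy estimate. Testing the equation with the solution gives `‖∇̂ X‖ + τ ‖X‖ ≤ K ‖F‖` in `L²`,
with `K` depending on `d` and the ellipticity only. Because `∇̂` has constant coefficients it
commutes with `D_n`, so a derivative of `X` solves the same equation up to the commutator with
`A`, which involves `∇̂ X` at lower orders only (`WeakEq.energy_le`). The resulting binomial
recursion propagates bounds of the form `K Λ^l l!` (`growth_of_recursion`), with a ratio of the
radii of analyticity of `X` and `A` that depends only on `d`, the ellipticity and the constant in
the bound on `A`.

The operator is degenerate, since `∇̂` sees `d` of the `d n` directions. The equation is solved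
by replacing `∇̂` with difference quotients. This gives a bounded perturbation of `τ²`, solvable
by a Neumann series of smooth functions (`exists_neumann`). The energy estimate holds for every
family of operators commuting with `D_n`, hence uniformly in the step, and a limit of the
solutions is a smooth solution (`exists_strong_solution`). Uniqueness among weak solutions
follows by testing with the smooth solution of the adjoint problem (`isWeakSolution_unique`).

For the sup bound, Sobolev's inequality turns the energy bounds into sup bounds of analytic type:
bounded constants for `∇̂ X`, a constant of size `1 / τ` for `X`. Average `X` successively over
`y_n`, `y_{n-1}`, and so on. Once `y_{k+1}, …, y_n` are averaged out, `δ_k⁻¹ ∇_k` is `∇̂` minus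
the derivatives with larger scales, so that the sup norms `m_l` of the derivatives of the
oscillation in `y_k` satisfy `m_l ≤ g_l + r m_{l+1}` with `r = ε_k / ε_{k-1}` and `g_l`
controlled by `∇̂ X` (`DN_nrmS_osc_le`). Iterating about `1 / (e Λ r)` times multiplies the bad
constant `1 / τ` by `exp (-1 / (e Λ r))` (`iterate_bound`), and the lower bound for `τ` is
exactly what makes the product bounded. The mean of `X` is zero, so these oscillations add up to
`X`.

Differentiating in the parameter, `∂_x X` solves the equation with flux `∂_x A (v + ∇̂ X)` and
has the same type of bounds; the constants do not see the number of parameters, because the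
bounds on the `∂_{x_k} A` can be distributed over `k` (`exists_split_growth`). That the solution
of the differentiated equation is the derivative is again the energy estimate: the normalized
first order remainder solves an equation whose flux tends to zero pointwise with bounded
derivatives, therefore in every Sobolev norm (`BddSmooth.tendsto_DN_nrm2`,
`hasFDerivAt_of_weakEq`).
-/

open MeasureTheory
open scoped ENNReal ContDiff Matrix

noncomputable section

namespace Multiscale

variable {n d : ℕ}

/-! ### Integration over the periodicity cell -/

/-- The coordinate basis of `ℝ^{d × n}`; its integer span is the period lattice. -/
def cellBasis (n d : ℕ) : Module.Basis (Σ _ : Fin n, Fin d) ℝ (Pt n d) :=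
  Pi.basis fun _ => Pi.basisFun ℝ (Fin d)

lemma cellBasis_repr (y : Pt n d) (p : Σ _ : Fin n, Fin d) :
    (cellBasis n d).repr y p = y p.1 p.2 := by
  simp [cellBasis, Pi.basis_repr]

lemma IsPeriodic.vadd_lattice {β : Type*} {f : Pt n d → β} (hf : IsPeriodic f)
    (g : (Submodule.span ℤ (Set.range (cellBasis n d))).toAddSubgroup) (y : Pt n d) :
    f (g +ᵥ y) = f y := by
  have h := ((cellBasis n d).mem_span_iff_repr_mem ℤ (g : Pt n d)).1 g.2
  choose z hz using h
  have : g +ᵥ y = fun i a => y i a + ((z ⟨i, a⟩ : ℤ) : ℝ) := by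
    funext i a
    have h1 := hz ⟨i, a⟩
    rw [cellBasis_repr] at h1
    have h2 : ((z ⟨i, a⟩ : ℤ) : ℝ) = (g : Pt n d) i a := by simpa using h1
    rw [h2, AddSubgroup.vadd_def]
    simp [add_comm]
  rw [this]
  exact hf y fun i a => z ⟨i, a⟩

lemma fundamentalDomain_eq : ZSpan.fundamentalDomain (cellBasis n d)
    = Set.pi Set.univ fun _ : Fin n => Set.pi Set.univ fun _ : Fin d => Set.Ico (0 : ℝ) 1 := by
  ext y
  simp only [ZSpan.mem_fundamentalDomain, cellBasis_repr, Set.mem_pi, Set.mem_univ, true_imp_iff]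
  exact ⟨fun h i a => h ⟨i, a⟩, fun h p => h p.1 p.2⟩

lemma Icc_eq_pi : (Set.Icc 0 1 : Set (Pt n d))
    = Set.pi Set.univ fun _ : Fin n => Set.pi Set.univ fun _ : Fin d => Set.Icc (0 : ℝ) 1 := by
  ext y
  simp only [Set.mem_Icc, Set.mem_pi, Set.mem_univ, true_imp_iff, Pi.le_def]
  exact ⟨fun h i a => ⟨h.1 i a, h.2 i a⟩, fun h => ⟨fun i a => (h i a).1, fun i a => (h i a).2⟩⟩

lemma volume_Icc : volume (Set.Icc 0 1 : Set (Pt n d)) = 1 := by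
  rw [Icc_eq_pi, volume_pi_pi]
  refine Finset.prod_eq_one fun i _ => ?_
  rw [volume_pi_pi]
  simp

lemma volume_fundamentalDomain : volume (ZSpan.fundamentalDomain (cellBasis n d)) = 1 := by
  rw [fundamentalDomain_eq, volume_pi_pi]
  refine Finset.prod_eq_one fun i _ => ?_
  rw [volume_pi_pi]
  simp

lemma fundamentalDomain_ae_eq :
    ZSpan.fundamentalDomain (cellBasis n d) =ᵐ[volume] (Set.Icc 0 1 : Set (Pt n d)) := by
  refine ae_eq_of_subset_of_measure_ge ?_ ?_ ?_ ?_
  · rw [fundamentalDomain_eq, Icc_eq_pi]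
    exact Set.pi_mono fun i _ => Set.pi_mono fun a _ => Set.Ico_subset_Icc_self
  · rw [volume_Icc, volume_fundamentalDomain]
  · exact (ZSpan.fundamentalDomain_measurableSet _).nullMeasurableSet
  · rw [volume_Icc]; simp

lemma cell_eq : cell n d = volume.restrict (ZSpan.fundamentalDomain (cellBasis n d)) :=
  (Measure.restrict_congr_set fundamentalDomain_ae_eq).symm

instance : IsProbabilityMeasure (cell n d) :=
  ⟨by rw [cell, Measure.restrict_apply_univ, volume_Icc]⟩

open scoped Pointwise in
lemma integral_cell_add {f : Pt n d → ℝ} (hf : IsPeriodic f) (h : Pt n d) :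
    ∫ y, f (y + h) ∂(cell n d) = ∫ y, f y ∂(cell n d) := by
  rw [cell_eq]
  have h1 := ZSpan.isAddFundamentalDomain' (cellBasis n d) volume
  have h2 := h1.vadd_of_comm h
  have : Countable (Submodule.span ℤ (Set.range (cellBasis n d))).toAddSubgroup :=
    inferInstanceAs (Countable (Submodule.span ℤ (Set.range (cellBasis n d))))
  rw [h1.setIntegral_eq h2 (fun g y => hf.vadd_lattice g y)]
  have h3 : (h +ᵥ ZSpan.fundamentalDomain (cellBasis n d)) =
    (fun y => y + h) '' ZSpan.fundamentalDomain (cellBasis n d) := by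
    rw [← Set.image_vadd]
    exact congrArg (· '' _) (funext fun y => add_comm h y)
  rw [h3, (measurePreserving_add_right volume h).setIntegral_image_emb
    (measurableEmbedding_addRight h)]

/-! ### Smooth periodic functions -/

/-- The algebra of smooth functions on the torus, as a subalgebra of all functions. -/
def torusAlg (n d : ℕ) : Subalgebra ℝ (Pt n d → ℝ) where
  carrier := {f | IsTest f}
  mul_mem' {f g} hf hg := ⟨hf.1.mul hg.1, fun y z => by
    simp only [Pi.mul_apply, hf.2 y z, hg.2 y z]⟩
  add_mem' {f g} hf hg := ⟨hf.1.add hg.1, fun y z => by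
    simp only [Pi.add_apply, hf.2 y z, hg.2 y z]⟩
  algebraMap_mem' r := ⟨contDiff_const, fun _ _ => rfl⟩

/-- The type of smooth functions on the torus; `f.1` is the periodic function on `ℝ^{d × n}`. -/
abbrev TorusFun (n d : ℕ) : Type := torusAlg n d

lemma TorusFun.contDiff (f : TorusFun n d) : ContDiff ℝ ∞ f.1 := f.2.1
lemma TorusFun.periodic (f : TorusFun n d) : IsPeriodic f.1 := f.2.2
lemma TorusFun.isTest (f : TorusFun n d) : IsTest f.1 := f.2
lemma TorusFun.continuous (f : TorusFun n d) : Continuous f.1 := f.contDiff.continuous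
lemma TorusFun.differentiable (f : TorusFun n d) : Differentiable ℝ f.1 :=
  f.contDiff.differentiable (by simp)

@[simp] lemma TorusFun.add_val (f g : TorusFun n d) (y) : (f + g).1 y = f.1 y + g.1 y := rfl
@[simp] lemma TorusFun.sub_val (f g : TorusFun n d) (y) : (f - g).1 y = f.1 y - g.1 y := rfl
@[simp] lemma TorusFun.mul_val (f g : TorusFun n d) (y) : (f * g).1 y = f.1 y * g.1 y := rfl
@[simp] lemma TorusFun.smul_val (c : ℝ) (f : TorusFun n d) (y) : (c • f).1 y = c * f.1 y := rfl
@[simp] lemma TorusFun.one_val (y) : (1 : TorusFun n d).1 y = 1 := rfl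
@[simp] lemma TorusFun.sum_val {α : Type*} (s : Finset α) (f : α → TorusFun n d) (y) :
    (∑ i ∈ s, f i).1 y = ∑ i ∈ s, (f i).1 y := by
  classical
  induction s using Finset.induction_on with
  | empty => simp
  | insert i s hi ih => rw [Finset.sum_insert hi, Finset.sum_insert hi, TorusFun.add_val, ih]

lemma TorusFun.ext {f g : TorusFun n d} (h : ∀ y, f.1 y = g.1 y) : f = g :=
  Subtype.ext (funext h)

lemma IsPeriodic.fderiv {f : Pt n d → ℝ} (hf : IsPeriodic f) : IsPeriodic (fderiv ℝ f) := by
  intro y z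
  have h : (fun x => f (x + fun i a => (z i a : ℝ))) = f := funext fun x => hf x z
  have := congrFun (congrArg (_root_.fderiv ℝ) h) y
  rw [fderiv_comp_add_right] at this
  exact this

/-- The directional derivative along the constant vector `b`. -/
def dir (b : Pt n d) : TorusFun n d →ₗ[ℝ] TorusFun n d where
  toFun f := ⟨fun y => fderiv ℝ f.1 y b,
    (f.contDiff.fderiv_right (m := ∞) (by simp)).clm_apply contDiff_const, fun y z => by
      simp only [f.periodic.fderiv y z]⟩
  map_add' f g := TorusFun.ext fun y => by
    change fderiv ℝ (f.1 + g.1) y b = _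
    rw [fderiv_add (f.differentiable y) (g.differentiable y)]; rfl
  map_smul' c f := TorusFun.ext fun y => by
    change fderiv ℝ (c • f.1) y b = _
    rw [fderiv_const_smul (f.differentiable y)]; rfl

lemma dir_val (b : Pt n d) (f : TorusFun n d) (y) : (dir b f).1 y = fderiv ℝ f.1 y b := rfl

/-- The partial derivative `∂_p`. -/
abbrev pd (p : Fin n × Fin d) : TorusFun n d →ₗ[ℝ] TorusFun n d := dir (unitVec p)

lemma dir_mul (b : Pt n d) (f g : TorusFun n d) : dir b (f * g) = dir b f * g + f * dir b g := by
  refine TorusFun.ext fun y => ?_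
  change fderiv ℝ (f.1 * g.1) y b = _
  rw [fderiv_mul (f.differentiable y) (g.differentiable y)]
  simp [dir_val]; ring

lemma dir_one (b : Pt n d) : dir b (1 : TorusFun n d) = 0 := by
  refine TorusFun.ext fun y => ?_
  change fderiv ℝ (fun _ => (1 : ℝ)) y b = _
  simp

lemma dir_comm (b c : Pt n d) (f : TorusFun n d) : dir b (dir c f) = dir c (dir b f) := by
  refine TorusFun.ext fun y => ?_
  have hs : IsSymmSndFDerivAt ℝ f.1 y :=
    f.contDiff.contDiffAt.isSymmSndFDerivAt
      (by simpa using (WithTop.coe_le_coe.2 (le_top : (2 : ℕ∞) ≤ ⊤)))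
  have hd : DifferentiableAt ℝ (fderiv ℝ f.1) y :=
    (f.contDiff.fderiv_right (m := ∞) (by simp)).differentiable (by simp) y
  have key : ∀ v w : Pt n d, fderiv ℝ (fun x => fderiv ℝ f.1 x v) y w
      = fderiv ℝ (fderiv ℝ f.1) y w v := fun v w => by
    rw [fderiv_clm_apply hd (differentiableAt_const v)]; simp
  change fderiv ℝ (fun x => fderiv ℝ f.1 x c) y b = fderiv ℝ (fun x => fderiv ℝ f.1 x b) y c
  rw [key, key]; exact hs b c

lemma eq_sum_unitVec (b : Pt n d) : b = ∑ p : Fin n × Fin d, b p.1 p.2 • unitVec p := by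
  funext i a
  rw [Finset.sum_apply, Finset.sum_apply, Fintype.sum_prod_type]
  simp [unitVec, Pi.single_apply, Finset.sum_ite_eq, ite_apply]

lemma dir_add (b c : Pt n d) (f : TorusFun n d) : dir (b + c) f = dir b f + dir c f :=
  TorusFun.ext fun y => by simp [dir_val]

lemma dir_smul (r : ℝ) (b : Pt n d) (f : TorusFun n d) : dir (r • b) f = r • dir b f :=
  TorusFun.ext fun y => by simp [dir_val]

lemma dir_eq_sum (b : Pt n d) (f : TorusFun n d) :
    dir b f = ∑ p : Fin n × Fin d, b p.1 p.2 • pd p f := by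
  refine TorusFun.ext fun y => ?_
  conv_lhs => rw [dir_val, eq_sum_unitVec b]
  simp [dir_val]

/-- Translation by `h`. -/
def tr (h : Pt n d) : TorusFun n d →ₗ[ℝ] TorusFun n d where
  toFun f := ⟨fun y => f.1 (y + h), f.contDiff.comp (contDiff_id.add contDiff_const), fun y z => by
    have := f.periodic (y + h) z
    refine Eq.trans ?_ this
    refine congrArg f.1 ?_
    funext i a; simp [add_right_comm]⟩
  map_add' f g := rfl
  map_smul' c f := rfl

@[simp] lemma tr_val (h : Pt n d) (f : TorusFun n d) (y) : (tr h f).1 y = f.1 (y + h) := rfl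

lemma dir_tr (b h : Pt n d) (f : TorusFun n d) : dir b (tr h f) = tr h (dir b f) := by
  refine TorusFun.ext fun y => ?_
  change fderiv ℝ (fun x => f.1 (x + h)) y b = _
  rw [fderiv_comp_add_right]; rfl

lemma tr_mul (h : Pt n d) (f g : TorusFun n d) : tr h (f * g) = tr h f * tr h g := rfl

/-! ### The integral and the `L²`, `L¹` and sup seminorms -/

lemma IsPeriodic.exists_bound {F : Type*} [SeminormedAddCommGroup F] {f : Pt n d → F}
    (hf : IsPeriodic f) (hc : Continuous f) : ∃ C, ∀ y, ‖f y‖ ≤ C := by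
  obtain ⟨C, hC⟩ := (isCompact_Icc (a := (0 : Pt n d)) (b := 1)).exists_bound_of_continuousOn
    hc.continuousOn
  refine ⟨C, fun y => ?_⟩
  have h := hf y fun i a => -⌊y i a⌋
  rw [← h]
  refine hC _ ⟨fun i a => ?_, fun i a => ?_⟩
  · simp only [Pi.zero_apply, Int.cast_neg]; linarith [Int.floor_le (y i a)]
  · simp only [Pi.one_apply, Int.cast_neg]; linarith [Int.lt_floor_add_one (y i a)]

lemma TorusFun.exists_bound (f : TorusFun n d) : ∃ C, ∀ y, |f.1 y| ≤ C :=
  f.periodic.exists_bound f.continuous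

lemma TorusFun.memLp (f : TorusFun n d) (p : ℝ≥0∞) : MemLp f.1 p (cell n d) := by
  obtain ⟨C, hC⟩ := f.exists_bound
  exact MemLp.of_bound f.continuous.aestronglyMeasurable C (.of_forall hC)

lemma TorusFun.integrable (f : TorusFun n d) : Integrable f.1 (cell n d) :=
  memLp_one_iff_integrable.1 (f.memLp 1)

/-- The integral over the torus. -/
def tint : TorusFun n d →ₗ[ℝ] ℝ where
  toFun f := ∫ y, f.1 y ∂(cell n d)
  map_add' f g := integral_add f.integrable g.integrable
  map_smul' c _ := integral_const_mul c _

lemma tint_def (f : TorusFun n d) : tint f = ∫ y, f.1 y ∂(cell n d) := rfl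

lemma tint_tr (h : Pt n d) (f : TorusFun n d) : tint (tr h f) = tint f :=
  integral_cell_add f.periodic h

lemma tint_nonneg {f : TorusFun n d} (hf : ∀ y, 0 ≤ f.1 y) : 0 ≤ tint f :=
  integral_nonneg hf

lemma tint_mono {f g : TorusFun n d} (h : ∀ y, f.1 y ≤ g.1 y) : tint f ≤ tint g :=
  integral_mono f.integrable g.integrable h

/-- The class of a smooth periodic function in `L²`. -/
def toL2 : TorusFun n d →ₗ[ℝ] Lp ℝ 2 (cell n d) where
  toFun (f : TorusFun n d) := MemLp.toLp f.1 (f.memLp 2)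
  map_add' _ _ := rfl
  map_smul' _ _ := rfl

/-- The `L²` norm. -/
def nrm2 : Seminorm ℝ (TorusFun n d) := (normSeminorm ℝ (Lp ℝ 2 (cell n d))).comp toL2

lemma nrm2_eq (f : TorusFun n d) : nrm2 f = (eLpNorm f.1 2 (cell n d)).toReal :=
  Lp.norm_toLp f.1 (f.memLp 2)

/-- The inner product of `L²` in terms of the product of functions. -/
lemma inner_toL2 (f g : TorusFun n d) : inner ℝ (toL2 f) (toL2 g) = tint (f * g) := by
  rw [L2.inner_def, tint_def]
  refine integral_congr_ae ?_
  filter_upwards [(f.memLp 2).coeFn_toLp, (g.memLp 2).coeFn_toLp] with y h1 h2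
  change inner ℝ (MemLp.toLp f.1 (f.memLp 2) y) (MemLp.toLp g.1 (g.memLp 2) y) = _
  rw [h1, h2]; simp [mul_comm]

lemma nrm2_sq (f : TorusFun n d) : nrm2 f ^ 2 = tint (f * f) := by
  rw [← inner_toL2, real_inner_self_eq_norm_sq]; rfl

lemma abs_tint_mul_le (f g : TorusFun n d) : |tint (f * g)| ≤ nrm2 f * nrm2 g := by
  rw [← inner_toL2]; exact abs_real_inner_le_norm _ _

lemma tint_mul_le (f g : TorusFun n d) : tint (f * g) ≤ nrm2 f * nrm2 g :=
  (le_abs_self _).trans (abs_tint_mul_le f g)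

lemma nrm2_tr (h : Pt n d) (f : TorusFun n d) : nrm2 (tr h f) = nrm2 f := by
  have : nrm2 (tr h f) ^ 2 = nrm2 f ^ 2 := by rw [nrm2_sq, nrm2_sq, ← tr_mul, tint_tr]
  exact (pow_left_inj₀ (apply_nonneg _ _) (apply_nonneg _ _) two_ne_zero).1 this

/-- The bounded continuous function underlying a smooth periodic function. -/
def toBCF : TorusFun n d →ₗ[ℝ] BoundedContinuousFunction (Pt n d) ℝ where
  toFun f := BoundedContinuousFunction.ofNormedAddCommGroup f.1 f.continuous
    f.exists_bound.choose f.exists_bound.choose_spec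
  map_add' _ _ := rfl
  map_smul' _ _ := rfl

/-- The sup norm. -/
def nrmS : Seminorm ℝ (TorusFun n d) :=
  (normSeminorm ℝ (BoundedContinuousFunction (Pt n d) ℝ)).comp toBCF

lemma abs_le_nrmS (f : TorusFun n d) (y) : |f.1 y| ≤ nrmS f := (toBCF f).norm_coe_le_norm y

lemma nrmS_le {f : TorusFun n d} {C : ℝ} (h : ∀ y, |f.1 y| ≤ C) : nrmS f ≤ C :=
  ((toBCF f).norm_le ((abs_nonneg _).trans (h 0))).2 h

lemma nrmS_mul (f g : TorusFun n d) : nrmS (f * g) ≤ nrmS f * nrmS g :=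
  nrmS_le fun y => by
    rw [TorusFun.mul_val, abs_mul]
    exact mul_le_mul (abs_le_nrmS f y) (abs_le_nrmS g y) (abs_nonneg _) (apply_nonneg _ _)

/-- The `L¹` norm. -/
def nrm1 : Seminorm ℝ (TorusFun n d) :=
  Seminorm.of (fun f => ∫ y, |f.1 y| ∂(cell n d))
    (fun f g => by
      rw [← integral_add f.integrable.abs g.integrable.abs]
      exact integral_mono (f + g).integrable.abs (f.integrable.abs.add g.integrable.abs)
        fun y => abs_add_le _ _)
    (fun c f => by
      rw [← integral_const_mul]
      exact integral_congr_ae (.of_forall fun y => by simp [abs_mul]))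

lemma nrm1_def (f : TorusFun n d) : nrm1 f = ∫ y, |f.1 y| ∂(cell n d) := rfl

lemma nrm2_le_nrmS (f : TorusFun n d) : nrm2 f ≤ nrmS f := by
  refine (abs_le_of_sq_le_sq' ?_ (apply_nonneg _ _)).2
  rw [nrm2_sq]
  have : tint (f * f) ≤ tint ((nrmS f ^ 2) • (1 : TorusFun n d)) := tint_mono fun y => by
    simp only [TorusFun.mul_val, TorusFun.smul_val, TorusFun.one_val, mul_one]
    rw [← sq, ← sq_abs]
    exact pow_le_pow_left₀ (abs_nonneg _) (abs_le_nrmS f y) 2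
  refine this.trans (le_of_eq ?_)
  rw [map_smul]; simp [tint_def]

lemma nrm1_le_nrm2 (f : TorusFun n d) : nrm1 f ≤ nrm2 f := by
  have h := eLpNorm_le_eLpNorm_of_exponent_le (μ := cell n d) (p := 1) (q := 2) (by norm_num)
    (f.memLp 1).1
  rw [nrm2_eq, nrm1_def]
  have h2 := ENNReal.toReal_mono (f.memLp 2).2.ne h
  refine le_trans (le_of_eq ?_) h2
  rw [eLpNorm_one_eq_lintegral_enorm, ← integral_norm_eq_lintegral_enorm (f.memLp 1).1]
  rfl

lemma nrm2_mul (f g : TorusFun n d) : nrm2 (f * g) ≤ nrmS f * nrm2 g := by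
  refine (abs_le_of_sq_le_sq' ?_ (mul_nonneg (apply_nonneg _ _) (apply_nonneg _ _))).2
  rw [mul_pow, nrm2_sq, nrm2_sq]
  have : tint (f * g * (f * g)) ≤ tint ((nrmS f ^ 2) • (g * g)) := tint_mono fun y => by
    simp only [TorusFun.mul_val, TorusFun.smul_val]
    rw [← sq, ← sq, mul_pow, ← sq_abs (f.1 y)]
    exact mul_le_mul_of_nonneg_right
      (pow_le_pow_left₀ (abs_nonneg _) (abs_le_nrmS f y) 2) (sq_nonneg _)
  refine this.trans (le_of_eq ?_)
  rw [map_smul]; rfl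

/-! ### Seminorms of the full tensor of derivatives -/

/-- `∑_J ρ (D^J f)` over all `J : Fin l → Fin n × Fin d`, for a seminorm `ρ`. -/
def DN (ρ : Seminorm ℝ (TorusFun n d)) : ℕ → Seminorm ℝ (TorusFun n d)
  | 0 => ρ
  | l + 1 => ∑ p, (DN ρ l).comp (pd p)

@[simp] lemma DN_zero (ρ : Seminorm ℝ (TorusFun n d)) : DN ρ 0 = ρ := rfl

lemma DN_succ (ρ : Seminorm ℝ (TorusFun n d)) (l : ℕ) (f : TorusFun n d) :
    DN ρ (l + 1) f = ∑ p, DN ρ l (pd p f) := by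
  have : DN ρ (l + 1) = ∑ p, (DN ρ l).comp (pd p) := rfl
  rw [this]
  classical
  induction (Finset.univ : Finset (Fin n × Fin d)) using Finset.induction_on with
  | empty => rfl
  | insert p s hp ih =>
    rw [Finset.sum_insert hp, Finset.sum_insert hp, add_apply, ih]; rfl

lemma DN_nonneg (ρ : Seminorm ℝ (TorusFun n d)) (l : ℕ) (f : TorusFun n d) : 0 ≤ DN ρ l f :=
  apply_nonneg _ _

lemma DN_smul (ρ : Seminorm ℝ (TorusFun n d)) (l : ℕ) (c : ℝ) (f : TorusFun n d) :
    DN ρ l (c • f) = |c| * DN ρ l f := by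
  rw [map_smul_eq_mul, Real.norm_eq_abs]

lemma seminorm_sum_le {α : Type*} (ρ : Seminorm ℝ (TorusFun n d)) (s : Finset α)
    (f : α → TorusFun n d) : ρ (∑ i ∈ s, f i) ≤ ∑ i ∈ s, ρ (f i) :=
  Finset.le_sum_of_subadditive ρ (map_zero ρ).le (map_add_le_add ρ) s f

lemma DN_add_index (ρ : Seminorm ℝ (TorusFun n d)) (l k : ℕ) (f : TorusFun n d) :
    DN (DN ρ k) l f = DN ρ (l + k) f := by
  induction l generalizing f with
  | zero => simp
  | succ l ih =>
    rw [DN_succ, Nat.add_right_comm, DN_succ]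
    exact Finset.sum_congr rfl fun p _ => ih _

lemma DN_pd_le (ρ : Seminorm ℝ (TorusFun n d)) (l : ℕ) (p : Fin n × Fin d) (f : TorusFun n d) :
    DN ρ l (pd p f) ≤ DN ρ (l + 1) f := by
  rw [DN_succ]
  exact Finset.single_le_sum (f := fun p => DN ρ l (pd p f)) (fun _ _ => DN_nonneg _ _ _)
    (Finset.mem_univ p)

/-- A bound for an operator which commutes with derivatives lifts to all orders. -/
lemma DN_comm_le {ρ σ : Seminorm ℝ (TorusFun n d)} {T : TorusFun n d → TorusFun n d} {c : ℝ}
    (hT : ∀ p f, pd p (T f) = T (pd p f)) (h : ∀ f, ρ (T f) ≤ c * σ f) (l : ℕ)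
    (f : TorusFun n d) : DN ρ l (T f) ≤ c * DN σ l f := by
  induction l generalizing f with
  | zero => exact h f
  | succ l ih =>
    rw [DN_succ, DN_succ, Finset.mul_sum]
    exact Finset.sum_le_sum fun p _ => by rw [hT]; exact ih _

lemma DN_mono {ρ σ : Seminorm ℝ (TorusFun n d)} (h : ∀ f, ρ f ≤ σ f) (l : ℕ)
    (f : TorusFun n d) : DN ρ l f ≤ DN σ l f := by
  simpa using DN_comm_le (T := id) (c := 1) (fun _ _ => rfl) (fun f => by simpa using h f) l f

lemma abs_apply_le_norm (b : Pt n d) (p : Fin n × Fin d) : |b p.1 p.2| ≤ ‖b‖ :=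
  (norm_le_pi_norm (b p.1) p.2).trans (norm_le_pi_norm b p.1)

/-- Here and below `‖b‖` is the sup norm of the coordinates. -/
lemma seminorm_dir_le (ρ : Seminorm ℝ (TorusFun n d)) (b : Pt n d) (f : TorusFun n d) :
    ρ (dir b f) ≤ ‖b‖ * DN ρ 1 f := by
  rw [dir_eq_sum, DN_succ, Finset.mul_sum]
  refine (seminorm_sum_le _ _ _).trans (Finset.sum_le_sum fun p _ => ?_)
  rw [map_smul_eq_mul, Real.norm_eq_abs]
  exact mul_le_mul_of_nonneg_right (abs_apply_le_norm b p) (apply_nonneg _ _)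

lemma DN_dir_le (ρ : Seminorm ℝ (TorusFun n d)) (b : Pt n d) (l : ℕ) (f : TorusFun n d) :
    DN ρ l (dir b f) ≤ ‖b‖ * DN ρ (l + 1) f := by
  refine (seminorm_dir_le (DN ρ l) b f).trans (le_of_eq ?_)
  rw [DN_add_index, add_comm]

/-- The binomial convolution `∑_{i + j = l} (l choose i) a_i b_j`. -/
def bconv (l : ℕ) (a b : ℕ → ℝ) : ℝ :=
  ∑ ij ∈ Finset.HasAntidiagonal.antidiagonal l, (l.choose ij.1 : ℝ) * (a ij.1 * b ij.2)

lemma bconv_succ (l : ℕ) (a b : ℕ → ℝ) :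
    bconv (l + 1) a b = bconv l a (fun j => b (j + 1)) + bconv l (fun i => a (i + 1)) b := by
  rw [bconv, Finset.sum_antidiagonal_choose_succ_mul (fun i j => a i * b j)]
  refine congrArg₂ _ rfl (Finset.sum_congr rfl fun ij h => ?_)
  rw [Finset.HasAntidiagonal.mem_antidiagonal] at h
  rw [Nat.choose_symm_of_eq_add h.symm]

lemma bconv_mono {l : ℕ} {a a' b b' : ℕ → ℝ} (ha : ∀ i, a i ≤ a' i) (hb : ∀ i ≤ l, b i ≤ b' i)
    (ha' : ∀ i, 0 ≤ a' i) (hb0 : ∀ i, 0 ≤ b i) : bconv l a b ≤ bconv l a' b' :=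
  Finset.sum_le_sum fun ij h => mul_le_mul_of_nonneg_left
    (mul_le_mul (ha _) (hb _ (by rw [Finset.HasAntidiagonal.mem_antidiagonal] at h; omega))
      (hb0 _) (ha' _)) (Nat.cast_nonneg _)

lemma bconv_sum_left {α : Type*} (s : Finset α) (l : ℕ) (a : α → ℕ → ℝ) (b : ℕ → ℝ) :
    ∑ x ∈ s, bconv l (a x) b = bconv l (fun i => ∑ x ∈ s, a x i) b := by
  simp only [bconv]
  rw [Finset.sum_comm]
  simp only [Finset.sum_mul, Finset.mul_sum]

lemma bconv_sum_right {α : Type*} (s : Finset α) (l : ℕ) (a : ℕ → ℝ) (b : α → ℕ → ℝ) :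
    ∑ x ∈ s, bconv l a (b x) = bconv l a (fun i => ∑ x ∈ s, b x i) := by
  simp only [bconv]
  rw [Finset.sum_comm]
  simp only [Finset.mul_sum]

/-- Leibniz' rule for the derivative seminorms. -/
lemma DN_mul_le {ρ σ τ : Seminorm ℝ (TorusFun n d)} (h : ∀ f g, ρ (f * g) ≤ σ f * τ g) (l : ℕ)
    (f g : TorusFun n d) :
    DN ρ l (f * g) ≤ bconv l (fun i => DN σ i f) (fun j => DN τ j g) := by
  induction l generalizing f g with
  | zero => simpa [bconv] using h f g
  | succ l ih =>
    rw [DN_succ, bconv_succ]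
    have : ∀ p : Fin n × Fin d, DN ρ l (pd p (f * g)) ≤
        bconv l (fun i => DN σ i f) (fun j => DN τ j (pd p g))
          + bconv l (fun i => DN σ i (pd p f)) (fun j => DN τ j g) := fun p => by
      rw [dir_mul, add_comm]
      exact (map_add_le_add _ _ _).trans (add_le_add (ih _ _) (ih _ _))
    refine (Finset.sum_le_sum fun p _ => this p).trans (le_of_eq ?_)
    rw [Finset.sum_add_distrib, bconv_sum_right, bconv_sum_left]
    simp only [DN_succ]

/-! ### Averages along a segment -/

/-- The average of `f` over the segment from `y` to `y + b`. -/
def segAvg (b : Pt n d) (f : Pt n d → ℝ) (y : Pt n d) : ℝ := ∫ t in (0 : ℝ)..1, f (y + t • b)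

lemma segAvg_continuous (b : Pt n d) {f : Pt n d → ℝ} (hf : Continuous f) :
    Continuous (segAvg b f) :=
  intervalIntegral.continuous_parametric_intervalIntegral_of_continuous'
    (f := fun y t => f (y + t • b)) (by fun_prop) 0 1

lemma segAvg_periodic (b : Pt n d) {f : Pt n d → ℝ} (hf : IsPeriodic f) :
    IsPeriodic (segAvg b f) := fun y z => by
  refine intervalIntegral.integral_congr fun t _ => ?_
  refine Eq.trans (congrArg f ?_) (hf (y + t • b) z)
  funext i a; simp [add_right_comm]

lemma segAvg_mono (b : Pt n d) {f g : Pt n d → ℝ} (hf : Continuous f) (hg : Continuous g)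
    (h : ∀ y, f y ≤ g y) (y : Pt n d) : segAvg b f y ≤ segAvg b g y :=
  intervalIntegral.integral_mono_on zero_le_one
    (Continuous.intervalIntegrable (by fun_prop) _ _)
    (Continuous.intervalIntegrable (by fun_prop) _ _) fun t _ => h _

lemma segAvg_add (b : Pt n d) {f g : Pt n d → ℝ} (hf : Continuous f) (hg : Continuous g)
    (y : Pt n d) : segAvg b (fun x => f x + g x) y = segAvg b f y + segAvg b g y :=
  intervalIntegral.integral_add (Continuous.intervalIntegrable (by fun_prop) _ _)
    (Continuous.intervalIntegrable (by fun_prop) _ _)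

lemma integral_segAvg (b : Pt n d) {f : Pt n d → ℝ} (hf : Continuous f) (hp : IsPeriodic f) :
    ∫ y, segAvg b f y ∂(cell n d) = ∫ y, f y ∂(cell n d) := by
  obtain ⟨C, hC⟩ := hp.exists_bound hf
  simp only [segAvg, intervalIntegral.integral_of_le zero_le_one]
  rw [integral_integral_swap]
  · simp only [integral_cell_add hp]
    simp
  · refine Integrable.of_bound (C := C) ?_ (.of_forall fun x => hC _)
    exact Continuous.aestronglyMeasurable (by fun_prop)

/-- The average over a period in a coordinate direction no longer depends on that coordinate. -/
lemma segAvg_unitVec_add {f : Pt n d → ℝ} (hp : IsPeriodic f) (p : Fin n × Fin d) (s : ℝ)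
    (y : Pt n d) : segAvg (unitVec p) f (y + s • unitVec p) = segAvg (unitVec p) f y := by
  have hper : Function.Periodic (fun t : ℝ => f (y + t • unitVec p)) 1 := fun t => by
    refine Eq.trans (congrArg f ?_) (hp (y + t • unitVec p) (Pi.single p.1 (Pi.single p.2 1)))
    funext i a
    by_cases h1 : i = p.1
    · subst h1
      by_cases h2 : a = p.2
      · subst h2; simp [unitVec]; ring
      · simp [unitVec, h2]
    · simp [unitVec, h1]
  have h := hper.intervalIntegral_add_eq s 0
  rw [zero_add] at h
  have h' := intervalIntegral.integral_comp_add_right (a := 0) (b := 1)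
    (fun t => f (y + t • unitVec p)) s
  rw [zero_add, add_comm 1 s, h] at h'
  refine Eq.trans (intervalIntegral.integral_congr fun t _ => congrArg f ?_) h'
  simp only [add_smul]; abel

/-- Average over a list of coordinate directions. -/
def listAvg : List (Fin n × Fin d) → (Pt n d → ℝ) → Pt n d → ℝ
  | [], f => f
  | p :: ps, f => segAvg (unitVec p) (listAvg ps f)

lemma listAvg_continuous (ps : List (Fin n × Fin d)) {f : Pt n d → ℝ} (hf : Continuous f) :
    Continuous (listAvg ps f) := by
  induction ps with
  | nil => exact hf
  | cons p ps ih => exact segAvg_continuous _ ih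

lemma listAvg_periodic (ps : List (Fin n × Fin d)) {f : Pt n d → ℝ} (hf : IsPeriodic f) :
    IsPeriodic (listAvg ps f) := by
  induction ps with
  | nil => exact hf
  | cons p ps ih => exact segAvg_periodic _ ih

lemma listAvg_add (ps : List (Fin n × Fin d)) {f g : Pt n d → ℝ} (hf : Continuous f)
    (hg : Continuous g) (y : Pt n d) :
    listAvg ps (fun x => f x + g x) y = listAvg ps f y + listAvg ps g y := by
  induction ps generalizing y with
  | nil => rfl
  | cons p ps ih =>
    rw [listAvg, funext ih]
    exact segAvg_add _ (listAvg_continuous _ hf) (listAvg_continuous _ hg) y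

lemma integral_listAvg (ps : List (Fin n × Fin d)) {f : Pt n d → ℝ} (hf : Continuous f)
    (hp : IsPeriodic f) : ∫ y, listAvg ps f y ∂(cell n d) = ∫ y, f y ∂(cell n d) := by
  induction ps with
  | nil => rfl
  | cons p ps ih =>
    rw [← ih]; exact integral_segAvg _ (listAvg_continuous _ hf) (listAvg_periodic _ hp)

lemma listAvg_add_unitVec {ps : List (Fin n × Fin d)} {p : Fin n × Fin d} (h : p ∈ ps)
    {f : Pt n d → ℝ} (hp : IsPeriodic f) (s : ℝ) (y : Pt n d) :
    listAvg ps f (y + s • unitVec p) = listAvg ps f y := by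
  induction ps generalizing y with
  | nil => simp at h
  | cons q ps ih =>
    by_cases hq : p = q
    · subst hq; exact segAvg_unitVec_add (listAvg_periodic _ hp) p s y
    · refine intervalIntegral.integral_congr fun t _ => ?_
      refine (congrArg (listAvg ps f) (add_right_comm _ _ _)).trans ?_
      exact ih (by simpa [hq] using h) _

lemma eq_of_forall_add_unitVec {f : Pt n d → ℝ}
    (h : ∀ p (s : ℝ) y, f (y + s • unitVec p) = f y) (y : Pt n d) : f y = f 0 := by
  have : ∀ s : Finset (Fin n × Fin d), f (∑ p ∈ s, y p.1 p.2 • unitVec p) = f 0 := fun s => by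
    classical
    induction s using Finset.induction_on with
    | empty => simp
    | insert p s hp ih => rw [Finset.sum_insert hp, add_comm, h, ih]
  rw [← this Finset.univ, ← eq_sum_unitVec]

/-- Averaging over all coordinates gives the integral over the torus. -/
lemma listAvg_univ {f : Pt n d → ℝ} (hf : Continuous f) (hp : IsPeriodic f) (y : Pt n d) :
    listAvg Finset.univ.toList f y = ∫ x, f x ∂(cell n d) := by
  have h : ∀ y, listAvg Finset.univ.toList f y = listAvg Finset.univ.toList f 0 :=
    eq_of_forall_add_unitVec fun p s y => listAvg_add_unitVec (by simp) hp s y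
  rw [← integral_listAvg Finset.univ.toList hf hp]
  simp only [h]; simp

lemma TorusFun.hasDerivAt_line (f : TorusFun n d) (y b : Pt n d) (t : ℝ) :
    HasDerivAt (fun s : ℝ => f.1 (y + s • b)) ((dir b f).1 (y + t • b)) t := by
  have h1 : HasDerivAt (fun s : ℝ => y + s • b) b t := by
    simpa using ((hasDerivAt_id t).smul_const b).const_add y
  exact (f.differentiable (y + t • b)).hasFDerivAt.comp_hasDerivAt t h1

/-- Fundamental theorem of calculus along a segment. -/
lemma segAvg_dir (b : Pt n d) (f : TorusFun n d) (y : Pt n d) :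
    segAvg b (dir b f).1 y = f.1 (y + b) - f.1 y := by
  rw [segAvg, intervalIntegral.integral_eq_sub_of_hasDerivAt
    (fun t _ => f.hasDerivAt_line y b t)]
  · simp
  · have := (dir b f).continuous
    exact Continuous.intervalIntegrable (by fun_prop) _ _

lemma tint_dir (b : Pt n d) (f : TorusFun n d) : tint (dir b f) = 0 := by
  rw [tint_def, ← integral_segAvg b (dir b f).continuous (dir b f).periodic]
  simp only [segAvg_dir]
  have := tint_tr b f
  rw [← sub_eq_zero, ← map_sub] at this
  exact this

/-- Integration by parts on the torus. -/
lemma tint_dir_mul (b : Pt n d) (f g : TorusFun n d) :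
    tint (dir b f * g) = - tint (f * dir b g) := by
  have := tint_dir b (f * g)
  rw [dir_mul, map_add] at this
  linarith

/-! ### The Sobolev inequality -/

/-- `∑_S |∂_S f|` over the sublists `S` of a list of coordinates. -/
def mixedSum : List (Fin n × Fin d) → TorusFun n d → Pt n d → ℝ
  | [], f, y => |f.1 y|
  | p :: ps, f, y => mixedSum ps f y + mixedSum ps (pd p f) y

lemma mixedSum_continuous (ps : List (Fin n × Fin d)) (f : TorusFun n d) :
    Continuous (mixedSum ps f) := by
  induction ps generalizing f with
  | nil => exact f.continuous.abs
  | cons p ps ih => exact (ih f).add (ih (pd p f))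

lemma mixedSum_periodic (ps : List (Fin n × Fin d)) (f : TorusFun n d) :
    IsPeriodic (mixedSum ps f) := by
  induction ps generalizing f with
  | nil => intro y z; simp only [mixedSum, f.periodic y z]
  | cons p ps ih => intro y z; simp only [mixedSum, ih f y z, ih (pd p f) y z]

/-- A function is bounded by its average along a segment plus its variation. -/
lemma abs_le_segAvg (b : Pt n d) (f : TorusFun n d) (y : Pt n d) :
    |f.1 y| ≤ segAvg b (fun x => |f.1 x|) y + segAvg b (fun x => |(dir b f).1 x|) y := by
  have hc := f.continuous
  have hd := (dir b f).continuous
  have hsub : ∀ t ∈ Set.Icc (0 : ℝ) 1, |f.1 y| ≤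
      |f.1 (y + t • b)| + ∫ s in (0 : ℝ)..1, |(dir b f).1 (y + s • b)| := fun t ht => by
    have h1 : f.1 (y + t • b) - f.1 y = ∫ s in (0 : ℝ)..t, (dir b f).1 (y + s • b) := by
      rw [intervalIntegral.integral_eq_sub_of_hasDerivAt (fun s _ => f.hasDerivAt_line y b s)]
      · simp
      · exact Continuous.intervalIntegrable (by fun_prop) _ _
    have h2 : |∫ s in (0 : ℝ)..t, (dir b f).1 (y + s • b)|
        ≤ ∫ s in (0 : ℝ)..t, |(dir b f).1 (y + s • b)| :=
      intervalIntegral.abs_integral_le_integral_abs ht.1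
    have h3 : ∫ s in (0 : ℝ)..t, |(dir b f).1 (y + s • b)|
        ≤ ∫ s in (0 : ℝ)..1, |(dir b f).1 (y + s • b)| :=
      intervalIntegral.integral_mono_interval le_rfl ht.1 ht.2 (.of_forall fun s => abs_nonneg _)
        (Continuous.intervalIntegrable (by fun_prop) _ _)
    have h4 := abs_sub_abs_le_abs_sub (f.1 y) (f.1 (y + t • b))
    rw [abs_sub_comm, h1] at h4
    linarith
  have h := intervalIntegral.integral_mono_on (a := 0) (b := 1) zero_le_one
    (f := fun _ => |f.1 y|) (g := fun t => |f.1 (y + t • b)|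
      + ∫ s in (0 : ℝ)..1, |(dir b f).1 (y + s • b)|)
    (Continuous.intervalIntegrable (μ := volume) (by fun_prop) _ _)
    (Continuous.intervalIntegrable (μ := volume) (by fun_prop) _ _) hsub
  rw [intervalIntegral.integral_add (Continuous.intervalIntegrable (by fun_prop) _ _)
    (Continuous.intervalIntegrable (by fun_prop) _ _)] at h
  simpa [segAvg] using h

/-- The one-dimensional bound, iterated over a list of coordinates. -/
lemma abs_le_listAvg (ps : List (Fin n × Fin d)) (f : TorusFun n d) (y : Pt n d) :
    |f.1 y| ≤ listAvg ps (mixedSum ps f) y := by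
  induction ps generalizing f y with
  | nil => exact le_rfl
  | cons p ps ih =>
    refine (abs_le_segAvg (unitVec p) f y).trans ?_
    have h1 := mixedSum_continuous ps f
    have h2 := mixedSum_continuous ps (pd p f)
    have : listAvg (p :: ps) (mixedSum (p :: ps) f) y
        = segAvg (unitVec p) (listAvg ps (mixedSum ps f)) y
          + segAvg (unitVec p) (listAvg ps (mixedSum ps (pd p f))) y := by
      rw [← segAvg_add _ (listAvg_continuous _ h1) (listAvg_continuous _ h2)]
      exact congrArg (fun F => segAvg (unitVec p) F y) (funext fun x => listAvg_add ps h1 h2 x)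
    rw [this]
    exact add_le_add
      (segAvg_mono _ f.continuous.abs (listAvg_continuous _ h1) (ih f) y)
      (segAvg_mono _ (pd p f).continuous.abs (listAvg_continuous _ h2) (ih (pd p f)) y)

lemma integral_mixedSum_le (ps : List (Fin n × Fin d)) (f : TorusFun n d) :
    ∫ y, mixedSum ps f y ∂(cell n d)
      ≤ 2 ^ ps.length * ∑ j ∈ Finset.range (ps.length + 1), DN nrm1 j f := by
  induction ps generalizing f with
  | nil => simp [mixedSum, nrm1_def]
  | cons p ps ih =>
    have hi : ∀ g : TorusFun n d, Integrable (mixedSum ps g) (cell n d) := fun g => by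
      obtain ⟨C, hC⟩ := (mixedSum_periodic ps g).exists_bound (mixedSum_continuous ps g)
      exact Integrable.of_bound (mixedSum_continuous ps g).aestronglyMeasurable C (.of_forall hC)
    have h1 : ∑ j ∈ Finset.range (ps.length + 1), DN nrm1 j f
        ≤ ∑ j ∈ Finset.range (ps.length + 2), DN nrm1 j f :=
      Finset.sum_le_sum_of_subset_of_nonneg (Finset.range_mono (by omega))
        fun _ _ _ => DN_nonneg _ _ _
    have h2 : ∑ j ∈ Finset.range (ps.length + 1), DN nrm1 j (pd p f)
        ≤ ∑ j ∈ Finset.range (ps.length + 2), DN nrm1 j f := by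
      rw [Finset.sum_range_succ' _ (ps.length + 1)]
      exact (Finset.sum_le_sum fun j _ => DN_pd_le _ j p f).trans
        (le_add_of_nonneg_right (DN_nonneg _ _ _))
    simp only [mixedSum, List.length_cons]
    rw [integral_add (hi f) (hi (pd p f)), pow_succ]
    have h3 := mul_le_mul_of_nonneg_left h1 (by positivity : (0 : ℝ) ≤ 2 ^ ps.length)
    have h4 := mul_le_mul_of_nonneg_left h2 (by positivity : (0 : ℝ) ≤ 2 ^ ps.length)
    have h5 := ih f
    have h6 := ih (pd p f)
    rw [show ps.length + 1 + 1 = ps.length + 2 from rfl]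
    linarith

/-- Sobolev's inequality: `n d` derivatives in `L¹` control the sup norm. -/
lemma nrmS_le_sum_DN_nrm1 (f : TorusFun n d) :
    nrmS f ≤ 2 ^ (n * d) * ∑ j ∈ Finset.range (n * d + 1), DN nrm1 j f := by
  have hlen : (Finset.univ : Finset (Fin n × Fin d)).toList.length = n * d := by simp
  refine nrmS_le fun y => ?_
  refine (abs_le_listAvg Finset.univ.toList f y).trans ?_
  rw [listAvg_univ (mixedSum_continuous _ f) (mixedSum_periodic _ f)]
  have := integral_mixedSum_le Finset.univ.toList f
  rwa [hlen] at this

lemma DN_nrmS_le_sum_DN_nrm1 (l : ℕ) (f : TorusFun n d) :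
    DN nrmS l f ≤ 2 ^ (n * d) * ∑ j ∈ Finset.range (n * d + 1), DN nrm1 (l + j) f := by
  induction l generalizing f with
  | zero => simpa using nrmS_le_sum_DN_nrm1 f
  | succ l ih =>
    rw [DN_succ]
    refine (Finset.sum_le_sum fun p _ => ih (pd p f)).trans (le_of_eq ?_)
    rw [← Finset.mul_sum, Finset.sum_comm]
    simp only [Nat.add_right_comm l 1, DN_succ]

lemma DN_nrmS_le_sum_DN_nrm2 (l : ℕ) (f : TorusFun n d) :
    DN nrmS l f ≤ 2 ^ (n * d) * ∑ j ∈ Finset.range (n * d + 1), DN nrm2 (l + j) f :=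
  (DN_nrmS_le_sum_DN_nrm1 l f).trans (mul_le_mul_of_nonneg_left
    (Finset.sum_le_sum fun _ _ => DN_mono nrm1_le_nrm2 _ _) (by positivity))

/-! ### Energy estimates -/

/-- Coercivity of a matrix of smooth periodic functions. -/
def Coercive (lam : ℝ) (A : Fin d → Fin d → TorusFun n d) : Prop :=
  ∀ y (ξ : Fin d → ℝ), lam * ∑ a, ξ a ^ 2 ≤ ∑ a, ξ a * ∑ b, (A a b).1 y * ξ b

/-- A family of linear operators on smooth periodic functions, in the role of a gradient. -/
abbrev GradOp (n d : ℕ) : Type := Fin d → TorusFun n d →ₗ[ℝ] TorusFun n d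

/-- The operators commute with all partial derivatives. -/
def GradOp.CommPd (G : GradOp n d) : Prop := ∀ p a f, pd p (G a f) = G a (pd p f)

/-- The equation `G* (A G u + F) + τ² u = f`, tested against smooth periodic functions. -/
def WeakEq (G : GradOp n d) (τ : ℝ) (A : Fin d → Fin d → TorusFun n d) (F : Fin d → TorusFun n d)
    (f u : TorusFun n d) : Prop :=
  ∀ φ, ∑ a, tint ((∑ b, A a b * G b u + F a) * G a φ) + τ ^ 2 * tint (u * φ) = tint (f * φ)

/-- Differentiating the equation moves the commutator with `A` into the flux `F`. -/
lemma WeakEq.pd {G : GradOp n d} (hG : G.CommPd) {τ : ℝ} {A : Fin d → Fin d → TorusFun n d}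
    {F : Fin d → TorusFun n d} {f u : TorusFun n d} (h : WeakEq G τ A F f u) (p : Fin n × Fin d) :
    WeakEq G τ A (fun a => Multiscale.pd p (F a) + ∑ b, Multiscale.pd p (A a b) * G b u)
      (Multiscale.pd p f) (Multiscale.pd p u) := by
  intro φ
  have h1 := h (Multiscale.pd p φ)
  have h2 : ∀ a, tint ((∑ b, A a b * G b u + F a) * G a (Multiscale.pd p φ)) =
      - tint ((∑ b, A a b * G b (Multiscale.pd p u) +
        (Multiscale.pd p (F a) + ∑ b, Multiscale.pd p (A a b) * G b u)) * G a φ) := fun a => by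
    rw [← hG, ← neg_eq_iff_eq_neg, ← tint_dir_mul, map_add, map_sum]
    congr 2
    rw [add_comm (Multiscale.pd p (F a)), ← add_assoc, ← Finset.sum_add_distrib]
    congr 1
    exact Finset.sum_congr rfl fun b _ => by rw [dir_mul, hG, add_comm]
  simp only [h2] at h1
  rw [Finset.sum_neg_distrib] at h1
  rw [tint_dir_mul, tint_dir_mul]
  linarith

/-- The energy at order `l`: `∑_a ‖D^l G_a u‖ + τ ‖D^l u‖` in `L²`. -/
def energy (G : GradOp n d) (τ : ℝ) (l : ℕ) (u : TorusFun n d) : ℝ :=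
  ∑ a, DN nrm2 l (G a u) + τ * DN nrm2 l u

/-- The constant of the energy estimate. -/
def energyConst (d : ℕ) (lam : ℝ) : ℝ := (d + 1) / min lam 1

lemma energyConst_pos (d : ℕ) {lam : ℝ} (h : 0 < lam) : 0 < energyConst d lam :=
  div_pos (by positivity) (lt_min h one_pos)

/-- The basic energy estimate, from testing the equation with `u`. -/
lemma WeakEq.energy_zero_le {G : GradOp n d} {τ lam : ℝ} (hlam : 0 < lam) (hτ : 0 < τ)
    {A : Fin d → Fin d → TorusFun n d} (hA : Coercive lam A)
    {F : Fin d → TorusFun n d} {f u : TorusFun n d} (h : WeakEq G τ A F f u) :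
    energy G τ 0 u ≤ energyConst d lam * (∑ a, nrm2 (F a) + nrm2 f / τ) := by
  have hm : 0 < min lam 1 := lt_min hlam one_pos
  set x : Fin d → ℝ := fun a => nrm2 (G a u) with hx
  set y : ℝ := τ * nrm2 u with hy
  set P : ℝ := ∑ a, nrm2 (F a) + nrm2 f / τ with hP
  have hx0 : ∀ a, 0 ≤ x a := fun a => apply_nonneg _ _
  have hy0 : 0 ≤ y := mul_nonneg hτ.le (apply_nonneg _ _)
  have hF0 : ∀ a, 0 ≤ nrm2 (F a) := fun a => apply_nonneg _ _
  have hf0 : 0 ≤ nrm2 f / τ := div_nonneg (apply_nonneg _ _) hτ.le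
  have hS0 : 0 ≤ ∑ a, x a := Finset.sum_nonneg fun a _ => hx0 a
  -- coercivity, integrated
  have h1 : lam * ∑ a, x a ^ 2 ≤ ∑ a, tint ((∑ b, A a b * G b u) * G a u) := by
    have e1 : lam * ∑ a, x a ^ 2 = tint (lam • ∑ a, G a u * G a u) := by
      rw [map_smul, map_sum]; simp only [hx, nrm2_sq]; rfl
    rw [e1, ← map_sum]
    refine tint_mono fun z => ?_
    have := hA z fun a => (G a u).1 z
    simp only [TorusFun.smul_val, TorusFun.sum_val, TorusFun.mul_val]
    refine le_trans (le_of_eq ?_) (this.trans (le_of_eq ?_))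
    · simp only [sq]
    · exact Finset.sum_congr rfl fun a _ => mul_comm _ _
  have h2 := h u
  have h3 : ∀ a, tint ((∑ b, A a b * G b u + F a) * G a u)
      = tint ((∑ b, A a b * G b u) * G a u) + tint (F a * G a u) := fun a => by
    rw [add_mul, map_add]
  simp only [h3, Finset.sum_add_distrib] at h2
  rw [← nrm2_sq] at h2
  have h4 : -∑ a, tint (F a * G a u) ≤ ∑ a, nrm2 (F a) * x a := by
    rw [← Finset.sum_neg_distrib]
    exact Finset.sum_le_sum fun a _ => (neg_le_abs _).trans (abs_tint_mul_le _ _)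
  have h5 : tint (f * u) ≤ nrm2 f / τ * y := by
    refine (tint_mul_le f u).trans (le_of_eq ?_)
    rw [hy]; field_simp
  have h6 : ∑ a, nrm2 (F a) * x a ≤ (∑ a, nrm2 (F a)) * ∑ a, x a := by
    rw [Finset.sum_mul]
    exact Finset.sum_le_sum fun a _ => mul_le_mul_of_nonneg_left
      (Finset.single_le_sum (fun a _ => hx0 a) (Finset.mem_univ a)) (hF0 a)
  have h7 : lam * ∑ a, x a ^ 2 + y ^ 2 ≤ P * (∑ a, x a + y) := by
    have : y ^ 2 = τ ^ 2 * nrm2 u ^ 2 := by rw [hy]; ring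
    have hFs : 0 ≤ ∑ a, nrm2 (F a) := Finset.sum_nonneg fun a _ => hF0 a
    rw [hP]
    nlinarith [mul_nonneg hFs hy0, mul_nonneg hf0 hS0]
  have h8 : (∑ a, x a + y) ^ 2 ≤ (d + 1) * (∑ a, x a ^ 2 + y ^ 2) := by
    have := sq_sum_le_card_mul_sum_sq (s := (Finset.univ : Finset (Option (Fin d))))
      (f := fun o => o.elim y x)
    simp only [Fintype.sum_option, Option.elim_none, Option.elim_some, Finset.card_univ,
      Fintype.card_option, Fintype.card_fin] at this
    push_cast at this
    rw [add_comm, add_comm (∑ a, x a ^ 2)]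
    exact this
  have h9 : min lam 1 * (∑ a, x a ^ 2 + y ^ 2) ≤ lam * ∑ a, x a ^ 2 + y ^ 2 := by
    have hs : 0 ≤ ∑ a, x a ^ 2 := Finset.sum_nonneg fun a _ => sq_nonneg _
    nlinarith [mul_le_mul_of_nonneg_right (min_le_left lam 1) hs,
      mul_le_mul_of_nonneg_right (min_le_right lam 1) (sq_nonneg y)]
  change ∑ a, x a + y ≤ energyConst d lam * P
  have hS : 0 ≤ ∑ a, x a + y := add_nonneg hS0 hy0
  rw [energyConst, div_mul_eq_mul_div, le_div_iff₀ hm]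
  rcases hS.eq_or_lt with h0 | h0
  · rw [← h0, zero_mul]
    exact mul_nonneg (by positivity) (add_nonneg (Finset.sum_nonneg fun a _ => hF0 a) hf0)
  · refine le_of_mul_le_mul_right ?_ h0
    have hd : (0 : ℝ) ≤ d + 1 := by positivity
    nlinarith [mul_le_mul_of_nonneg_left h8 hm.le,
      mul_le_mul_of_nonneg_left (h9.trans h7) hd]

/-- The seminorm `∑_{a,b} ∑_J sup |D^J A_{ab}|` of a matrix. -/
def matS (A : Fin d → Fin d → TorusFun n d) (i : ℕ) : ℝ := ∑ a, ∑ b, DN nrmS i (A a b)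

lemma matS_nonneg (A : Fin d → Fin d → TorusFun n d) (i : ℕ) : 0 ≤ matS A i :=
  Finset.sum_nonneg fun _ _ => Finset.sum_nonneg fun _ _ => DN_nonneg _ _ _

/-- As `matS`, with the order zero term removed; this is what commutators with `A` see. -/
def matS' (A : Fin d → Fin d → TorusFun n d) (i : ℕ) : ℝ := if i = 0 then 0 else matS A i

lemma matS'_nonneg (A : Fin d → Fin d → TorusFun n d) (i : ℕ) : 0 ≤ matS' A i := by
  rw [matS']; split_ifs
  exacts [le_rfl, matS_nonneg A i]

lemma sum_DN_mul_le (A : Fin d → Fin d → TorusFun n d) (g : Fin d → TorusFun n d) (l : ℕ) :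
    ∑ a, DN nrm2 l (∑ b, A a b * g b)
      ≤ bconv l (matS A) (fun j => ∑ b, DN nrm2 j (g b)) := by
  have h : ∀ a, DN nrm2 l (∑ b, A a b * g b) ≤
      bconv l (fun i => ∑ b, DN nrmS i (A a b)) (fun j => ∑ b, DN nrm2 j (g b)) := fun a => by
    refine (seminorm_sum_le _ _ _).trans ?_
    rw [← bconv_sum_left]
    refine Finset.sum_le_sum fun b _ => (DN_mul_le nrm2_mul l _ _).trans ?_
    exact bconv_mono (fun _ => le_rfl)
      (fun j _ => Finset.single_le_sum (f := fun b => DN nrm2 j (g b))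
        (fun _ _ => DN_nonneg _ _ _) (Finset.mem_univ b))
      (fun _ => DN_nonneg _ _ _) (fun _ => DN_nonneg _ _ _)
  refine (Finset.sum_le_sum fun a _ => h a).trans (le_of_eq ?_)
  rw [bconv_sum_left]; rfl

/-- The energy estimate for derivatives of all orders. The commutators with `A` only involve
derivatives of `G u` of lower order, because `matS' A 0 = 0`. -/
lemma WeakEq.energy_le {G : GradOp n d} (hG : G.CommPd) {τ lam : ℝ} (hlam : 0 < lam) (hτ : 0 < τ)
    {A : Fin d → Fin d → TorusFun n d} (hA : Coercive lam A)
    {F : Fin d → TorusFun n d} {f u : TorusFun n d} (h : WeakEq G τ A F f u) (l : ℕ) :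
    energy G τ l u ≤ energyConst d lam * (∑ a, DN nrm2 l (F a) + DN nrm2 l f / τ
      + bconv l (matS' A) (fun j => ∑ b, DN nrm2 j (G b u))) := by
  induction l generalizing F f u with
  | zero => simpa [bconv, matS'] using h.energy_zero_le hlam hτ hA
  | succ l ih =>
    have e1 : energy G τ (l + 1) u = ∑ p, energy G τ l (Multiscale.pd p u) := by
      simp only [energy, DN_succ, Finset.sum_add_distrib, Finset.mul_sum]
      rw [Finset.sum_comm]
      simp only [hG _ _ u]
    have e2 : ∀ p, ∑ a, DN nrm2 l (Multiscale.pd p (F a) + ∑ b, Multiscale.pd p (A a b) * G b u)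
        ≤ ∑ a, DN nrm2 l (Multiscale.pd p (F a))
          + bconv l (matS fun a b => Multiscale.pd p (A a b))
            (fun j => ∑ b, DN nrm2 j (G b u)) := fun p => by
      refine (Finset.sum_le_sum fun a _ => map_add_le_add _ _ _).trans ?_
      rw [Finset.sum_add_distrib]
      exact add_le_add_right (sum_DN_mul_le _ _ l) _
    have e3 : ∀ p, energy G τ l (Multiscale.pd p u) ≤ energyConst d lam *
        (∑ a, DN nrm2 l (Multiscale.pd p (F a)) + DN nrm2 l (Multiscale.pd p f) / τ
          + (bconv l (matS' A) (fun j => ∑ b, DN nrm2 j (G b (Multiscale.pd p u)))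
            + bconv l (matS fun a b => Multiscale.pd p (A a b))
              (fun j => ∑ b, DN nrm2 j (G b u)))) := fun p => by
      refine (ih (h.pd hG p)).trans (mul_le_mul_of_nonneg_left ?_ (energyConst_pos d hlam).le)
      linarith [e2 p]
    rw [e1]
    refine (Finset.sum_le_sum fun p _ => e3 p).trans (le_of_eq ?_)
    rw [← Finset.mul_sum]
    congr 1
    rw [Finset.sum_add_distrib, Finset.sum_add_distrib, Finset.sum_add_distrib, bconv_sum_right,
      bconv_sum_left, bconv_succ, ← Finset.sum_div, ← DN_succ, Finset.sum_comm]
    simp only [← DN_succ]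
    congr 2
    · congr 1
      funext j
      rw [Finset.sum_comm]
      simp only [DN_succ, hG _ _ u]
    · congr 1
      funext i
      simp only [matS, matS']
      rw [if_neg (Nat.succ_ne_zero i), Finset.sum_comm]
      refine Finset.sum_congr rfl fun a _ => ?_
      rw [Finset.sum_comm]
      simp only [DN_succ]

lemma bconv_mono_right {l : ℕ} {a b b' : ℕ → ℝ} (ha : ∀ i, 0 ≤ a i) (hb : ∀ i, b i ≤ b' i) :
    bconv l a b ≤ bconv l a b' :=
  Finset.sum_le_sum fun _ _ => mul_le_mul_of_nonneg_left
    (mul_le_mul_of_nonneg_left (hb _) (ha _)) (Nat.cast_nonneg _)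

lemma sum_DN_le_energy (G : GradOp n d) {τ : ℝ} (hτ : 0 < τ) (l : ℕ) (u : TorusFun n d) :
    ∑ b, DN nrm2 l (G b u) ≤ energy G τ l u :=
  le_add_of_nonneg_right (mul_nonneg hτ.le (DN_nonneg _ _ _))

lemma DN_le_energy (G : GradOp n d) (τ : ℝ) (l : ℕ) (u : TorusFun n d) :
    τ * DN nrm2 l u ≤ energy G τ l u :=
  le_add_of_nonneg_left (Finset.sum_nonneg fun _ _ => DN_nonneg _ _ _)

lemma energy_nonneg (G : GradOp n d) {τ : ℝ} (hτ : 0 < τ) (l : ℕ) (u : TorusFun n d) :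
    0 ≤ energy G τ l u :=
  (mul_nonneg hτ.le (DN_nonneg _ _ _)).trans (DN_le_energy G τ l u)

/-- The energy estimate as a recursion for the energies alone. -/
lemma WeakEq.energy_rec {G : GradOp n d} (hG : G.CommPd) {τ lam : ℝ} (hlam : 0 < lam)
    (hτ : 0 < τ) {A : Fin d → Fin d → TorusFun n d} (hA : Coercive lam A)
    {F : Fin d → TorusFun n d} {f u : TorusFun n d} (h : WeakEq G τ A F f u) (l : ℕ) :
    energy G τ l u ≤ energyConst d lam * ((∑ a, DN nrm2 l (F a) + DN nrm2 l f / τ)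
      + bconv l (matS' A) (fun j => energy G τ j u)) :=
  (h.energy_le hG hlam hτ hA l).trans (mul_le_mul_of_nonneg_left (add_le_add_right
    (bconv_mono_right (matS'_nonneg A) fun j => sum_DN_le_energy G hτ j u) _)
    (energyConst_pos d hlam).le)

/-! ### Scalar recursions -/

lemma sum_half_pow_le (l : ℕ) :
    ∑ ij ∈ Finset.HasAntidiagonal.antidiagonal l, (1 / 2 : ℝ) ^ ij.1 ≤ 2 := by
  rw [Finset.Nat.sum_antidiagonal_eq_sum_range_succ_mk]
  exact sum_geometric_two_le _

lemma choose_mul_factorials {l : ℕ} {ij : ℕ × ℕ}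
    (h : ij ∈ Finset.HasAntidiagonal.antidiagonal l) :
    (l.choose ij.1 : ℝ) * (ij.1.factorial * ij.2.factorial) = l.factorial := by
  rw [Finset.HasAntidiagonal.mem_antidiagonal] at h
  subst h
  have := Nat.add_choose_mul_factorial_mul_factorial ij.1 ij.2
  rw [← Nat.choose_symm_add] at this
  rw [← mul_assoc]; exact_mod_cast this

/-- Analytic growth is propagated by the recursion of the energy estimate. -/
lemma growth_of_recursion {E M : ℕ → ℝ} {K K1 C0 Lam0 Lam : ℝ} (hK : 0 < K) (hK1 : 0 ≤ K1)
    (hLam0 : 0 ≤ Lam0) (hE : ∀ l, 0 ≤ E l) (hM0 : M 0 = 0)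
    (hM : ∀ i, M i ≤ C0 * Lam0 ^ i * i.factorial) (h1 : 2 * Lam0 ≤ Lam)
    (h2 : 8 * K * C0 * Lam0 ≤ Lam) (hLam : 0 < Lam)
    (hrec : ∀ l, E l ≤ K * (K1 * Lam ^ l * l.factorial + bconv l M E)) (l : ℕ) :
    E l ≤ 2 * K * K1 * Lam ^ l * l.factorial := by
  induction l using Nat.strong_induction_on with
  | _ l ih =>
    have hMi : ∀ i, M i ≤ 1 / (4 * K) * ((1 / 2) ^ i * Lam ^ i * i.factorial) := fun i => by
      rcases i with _ | i
      · rw [hM0]; positivity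
      · refine (hM _).trans ?_
        have e1 : Lam0 ^ i ≤ (1 / 2 * Lam) ^ i := pow_le_pow_left₀ hLam0 (by linarith) i
        have e2 : C0 * Lam0 ≤ 1 / (4 * K) * (1 / 2 * Lam) := by
          rw [div_mul_eq_mul_div, le_div_iff₀ (by positivity)]; linarith
        have e3 : C0 * Lam0 ^ (i + 1) ≤ 1 / (4 * K) * (1 / 2 * Lam) ^ (i + 1) := by
          rw [pow_succ', pow_succ', ← mul_assoc, ← mul_assoc]
          exact mul_le_mul e2 e1 (pow_nonneg hLam0 i) (by positivity)
        rw [← mul_pow, ← mul_assoc]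
        exact mul_le_mul_of_nonneg_right e3 (Nat.cast_nonneg _)
    have hb : bconv l M E ≤ ∑ ij ∈ Finset.HasAntidiagonal.antidiagonal l,
        (K1 / 2 * Lam ^ l * l.factorial) * (1 / 2) ^ ij.1 := by
      refine Finset.sum_le_sum fun ij hij => ?_
      have hs := Finset.HasAntidiagonal.mem_antidiagonal.1 hij
      rcases Nat.eq_zero_or_pos ij.1 with h0 | h0
      · rw [h0, hM0]; simp only [zero_mul, mul_zero]; positivity
      · have e := ih ij.2 (by omega)
        have e' : M ij.1 * E ij.2 ≤ (1 / (4 * K) * ((1 / 2) ^ ij.1 * Lam ^ ij.1 * ij.1.factorial))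
            * (2 * K * K1 * Lam ^ ij.2 * ij.2.factorial) :=
          mul_le_mul (hMi _) e (hE _) (by positivity)
        refine (mul_le_mul_of_nonneg_left e' (Nat.cast_nonneg _)).trans (le_of_eq ?_)
        rw [← choose_mul_factorials hij, ← hs, pow_add]
        field_simp; ring
    rw [← Finset.mul_sum] at hb
    have hb2 := hb.trans (mul_le_mul_of_nonneg_left (sum_half_pow_le l) (by positivity))
    refine (hrec l).trans ?_
    have := mul_le_mul_of_nonneg_left hb2 hK.le
    linarith

/-- The recursion of the energy estimate is controlled by its data, linearly. -/
lemma exists_bound_of_recursion (K : ℝ) (hK : 0 ≤ K) (M : ℕ → ℝ) (hM : ∀ i, 0 ≤ M i)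
    (hM0 : M 0 = 0) : ∃ c : ℕ → ℝ, (∀ l, 0 ≤ c l) ∧ ∀ S E : ℕ → ℝ, (∀ l, 0 ≤ S l) →
      (∀ l, E l ≤ K * (S l + bconv l M E)) → ∀ l, E l ≤ c l * ∑ j ∈ Finset.range (l + 1), S j := by
  suffices h : ∀ l, ∃ c : ℝ, 0 ≤ c ∧ ∀ S E : ℕ → ℝ, (∀ l, 0 ≤ S l) →
      (∀ l, E l ≤ K * (S l + bconv l M E)) → E l ≤ c * ∑ j ∈ Finset.range (l + 1), S j by
    choose c h0 hc using h
    exact ⟨c, h0, fun S E hS hE l => hc l S E hS hE⟩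
  intro l
  induction l using Nat.strong_induction_on with
  | _ l ih =>
    choose! c h0 hc using ih
    refine ⟨K * (1 + ∑ ij ∈ Finset.HasAntidiagonal.antidiagonal l,
      (l.choose ij.1 : ℝ) * (M ij.1 * |c ij.2|)), mul_nonneg hK (add_nonneg zero_le_one
        (Finset.sum_nonneg fun ij _ => mul_nonneg (Nat.cast_nonneg _)
          (mul_nonneg (hM _) (abs_nonneg _)))), fun S E hS hE => (hE l).trans ?_⟩
    rw [mul_assoc]
    refine mul_le_mul_of_nonneg_left ?_ hK
    rw [add_mul, one_mul, Finset.sum_mul]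
    refine add_le_add (Finset.single_le_sum (fun j _ => hS j) (by simp))
      (Finset.sum_le_sum fun ij hij => ?_)
    have hs := Finset.HasAntidiagonal.mem_antidiagonal.1 hij
    rw [mul_assoc, mul_assoc]
    refine mul_le_mul_of_nonneg_left ?_ (Nat.cast_nonneg _)
    rcases Nat.eq_zero_or_pos ij.1 with h1 | h1
    · rw [h1, hM0]; simp
    · refine mul_le_mul_of_nonneg_left ?_ (hM _)
      refine (hc ij.2 (by omega) S E hS hE).trans (mul_le_mul (le_abs_self _)
        (Finset.sum_le_sum_of_subset_of_nonneg (Finset.range_mono (by omega)) fun j _ _ => hS j)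
        (Finset.sum_nonneg fun j _ => hS j) (abs_nonneg _))

/-- Growth rates of analytic type are stable under products. -/
lemma bconv_growth {a b : ℕ → ℝ} {α β Lam1 Lam2 : ℝ} (hα : 0 ≤ α)
    (h1 : 0 ≤ Lam1) (h2 : 0 ≤ Lam2) (ha : ∀ i, a i ≤ α * Lam1 ^ i * i.factorial)
    (hb0 : ∀ i, 0 ≤ b i) (hb : ∀ i, b i ≤ β * Lam2 ^ i * i.factorial) (hβ : 0 ≤ β) (l : ℕ) :
    bconv l a b ≤ α * β * (Lam1 + Lam2) ^ l * l.factorial := by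
  rw [(Commute.all Lam1 Lam2).add_pow', Finset.mul_sum, Finset.sum_mul]
  refine Finset.sum_le_sum fun ij hij => ?_
  have e1 : a ij.1 * b ij.2 ≤ (α * Lam1 ^ ij.1 * ij.1.factorial)
      * (β * Lam2 ^ ij.2 * ij.2.factorial) := mul_le_mul (ha _) (hb _) (hb0 _) (by positivity)
  refine (mul_le_mul_of_nonneg_left e1 (Nat.cast_nonneg _)).trans ?_
  have hc : (1 : ℝ) ≤ l.choose ij.1 := by
    have hs := Finset.HasAntidiagonal.mem_antidiagonal.1 hij
    exact_mod_cast Nat.choose_pos (by omega)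
  have e2 : (l.choose ij.1 : ℝ) * (α * Lam1 ^ ij.1 * ij.1.factorial
      * (β * Lam2 ^ ij.2 * ij.2.factorial))
      = α * β * (Lam1 ^ ij.1 * Lam2 ^ ij.2) * l.factorial := by
    rw [← choose_mul_factorials hij]; ring
  rw [e2, nsmul_eq_mul]
  refine mul_le_mul_of_nonneg_right (mul_le_mul_of_nonneg_left ?_ (mul_nonneg hα hβ))
    (Nat.cast_nonneg _)
  exact le_mul_of_one_le_left (by positivity) hc

/-! ### Limits of bounded sequences along an ultrafilter -/

/-- A fixed nonprincipal ultrafilter on `ℕ`. Limits along it exist for all bounded sequences,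
which replaces the extraction of subsequences. -/
def hyper : Ultrafilter ℕ := Filter.hyperfilter ℕ

instance : (hyper : Filter ℕ).NeBot := hyper.neBot

lemma hyper_le_atTop : (hyper : Filter ℕ) ≤ Filter.atTop := by
  rw [← Nat.cofinite_eq_atTop]; exact Filter.hyperfilter_le_cofinite

lemma exists_tendsto_hyper {u : ℕ → ℝ} {C : ℝ} (h : ∀ j, |u j| ≤ C) :
    ∃ x, Filter.Tendsto u hyper (nhds x) := by
  obtain ⟨x, -, hx⟩ := (isCompact_Icc (a := -C) (b := C)).ultrafilter_le_nhds (hyper.map u)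
    (by
      rw [Ultrafilter.coe_map, Filter.le_principal_iff, Filter.mem_map]
      exact Filter.univ_mem' fun j => abs_le.1 (h j))
  exact ⟨x, hx⟩

/-- All derivatives are bounded uniformly along the family. -/
def BddSmooth {ι : Type*} (U : ι → TorusFun n d) : Prop := ∀ l, ∃ C, ∀ j, DN nrmS l (U j) ≤ C

/-- Pointwise convergence along the ultrafilter. -/
def PtLim (U : ℕ → TorusFun n d) (u : TorusFun n d) : Prop :=
  ∀ y, Filter.Tendsto (fun j => (U j).1 y) hyper (nhds (u.1 y))

lemma BddSmooth.dir {ι : Type*} {U : ι → TorusFun n d} (h : BddSmooth U) (b : Pt n d) :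
    BddSmooth fun j => dir b (U j) := fun l => by
  obtain ⟨C, hC⟩ := h (l + 1)
  exact ⟨‖b‖ * C, fun j => (DN_dir_le _ b l _).trans
    (mul_le_mul_of_nonneg_left (hC j) (norm_nonneg _))⟩

lemma BddSmooth.exists_tendsto {U : ℕ → TorusFun n d} (h : BddSmooth U) (y : Pt n d) :
    ∃ x, Filter.Tendsto (fun j => (U j).1 y) hyper (nhds x) := by
  obtain ⟨C, hC⟩ := h 0
  exact exists_tendsto_hyper fun j => (abs_le_nrmS _ y).trans (hC j)

lemma nrmS_tr_sub_le (b : Pt n d) (f : TorusFun n d) :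
    nrmS (tr b f - f) ≤ ‖b‖ * DN nrmS 1 f := by
  refine nrmS_le fun y => ?_
  have h := (convex_univ : Convex ℝ (Set.univ : Set ℝ)).norm_image_sub_le_of_norm_hasDerivWithin_le
    (f := fun s : ℝ => f.1 (y + s • b)) (C := ‖b‖ * DN nrmS 1 f) (x := 0) (y := 1)
    (fun t _ => (f.hasDerivAt_line y b t).hasDerivWithinAt)
    (fun t _ => (abs_le_nrmS _ _).trans (seminorm_dir_le _ b f)) (Set.mem_univ _) (Set.mem_univ _)
  simpa using h

/-- Taylor's formula of second order. -/
lemma nrmS_tr_sub_sub_dir_le (b : Pt n d) (f : TorusFun n d) :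
    nrmS (tr b f - f - dir b f) ≤ ‖b‖ ^ 2 * DN nrmS 2 f := by
  refine nrmS_le fun y => ?_
  have hb : ∀ t ∈ Set.Icc (0 : ℝ) 1, ‖(dir b f).1 (y + t • b) - (dir b f).1 y‖
      ≤ ‖b‖ ^ 2 * DN nrmS 2 f := fun t ht => by
    have h1 := (abs_le_nrmS _ y).trans (nrmS_tr_sub_le (t • b) (dir b f))
    have h2 : ‖t • b‖ ≤ ‖b‖ := by
      rw [norm_smul, Real.norm_eq_abs, abs_of_nonneg ht.1]
      exact mul_le_of_le_one_left (norm_nonneg _) ht.2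
    refine h1.trans ((mul_le_mul h2 (DN_dir_le _ b 1 f) (DN_nonneg _ _ _)
      (norm_nonneg _)).trans (le_of_eq (by ring)))
  have h := (convex_Icc (0 : ℝ) 1).norm_image_sub_le_of_norm_hasDerivWithin_le
    (f := fun s : ℝ => f.1 (y + s • b) - s * (dir b f).1 y) (C := ‖b‖ ^ 2 * DN nrmS 2 f)
    (x := 0) (y := 1) (f' := fun t => (dir b f).1 (y + t • b) - (dir b f).1 y)
    (fun t _ => by
      have h1 := (hasDerivAt_id t).mul_const ((dir b f).1 y)
      rw [one_mul] at h1
      exact ((f.hasDerivAt_line y b t).sub h1).hasDerivWithinAt)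
    hb (by simp) (by simp)
  simp only [one_smul, zero_smul, add_zero, one_mul, zero_mul, sub_zero, norm_one, mul_one] at h
  rw [Real.norm_eq_abs] at h
  refine le_trans (le_of_eq ?_) h
  congr 1
  simp only [TorusFun.sub_val, tr_val]; ring

/-- The limit along the ultrafilter of a sequence with bounded derivatives. -/
def ulim (U : ℕ → TorusFun n d) (y : Pt n d) : ℝ := (hyper : Filter ℕ).limUnder fun j => (U j).1 y

lemma BddSmooth.tendsto_ulim {U : ℕ → TorusFun n d} (h : BddSmooth U) (y : Pt n d) :
    Filter.Tendsto (fun j => (U j).1 y) hyper (nhds (ulim U y)) :=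
  tendsto_nhds_limUnder (h.exists_tendsto y)

/-- The limit may be differentiated termwise, since the Taylor remainders are of second order
uniformly along the sequence. -/
lemma BddSmooth.hasFDerivAt_ulim {U : ℕ → TorusFun n d} (h : BddSmooth U) (y : Pt n d) :
    ∃ L : Pt n d →L[ℝ] ℝ, HasFDerivAt (ulim U) L y ∧
      ∀ b, L b = ulim (fun j => Multiscale.dir b (U j)) y := by
  let L : Pt n d →ₗ[ℝ] ℝ :=
    { toFun := fun b => ulim (fun j => Multiscale.dir b (U j)) y
      map_add' := fun b c => by
        refine tendsto_nhds_unique ((h.dir (b + c)).tendsto_ulim y) ?_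
        simpa only [dir_add, TorusFun.add_val] using
          ((h.dir b).tendsto_ulim y).add ((h.dir c).tendsto_ulim y)
      map_smul' := fun r b => by
        refine tendsto_nhds_unique ((h.dir (r • b)).tendsto_ulim y) ?_
        change Filter.Tendsto _ _ (nhds (r * _))
        simpa only [dir_smul, TorusFun.smul_val] using
          ((h.dir b).tendsto_ulim y).const_mul r }
  refine ⟨LinearMap.toContinuousLinearMap L, ?_, fun b => rfl⟩
  obtain ⟨C, hC⟩ := h 2
  have key : ∀ b : Pt n d, |ulim U (y + b) - ulim U y - L b| ≤ C * ‖b‖ ^ 2 := fun b => by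
    have ht := (((h.tendsto_ulim (y + b)).sub (h.tendsto_ulim y)).sub
      ((h.dir b).tendsto_ulim y)).abs
    refine le_of_tendsto ht (.of_forall fun j => ?_)
    refine (abs_le_nrmS (tr b (U j) - U j - Multiscale.dir b (U j)) y).trans
      ((nrmS_tr_sub_sub_dir_le b (U j)).trans ?_)
    rw [mul_comm]
    exact mul_le_mul_of_nonneg_right (hC j) (sq_nonneg _)
  rw [hasFDerivAt_iff_isLittleO_nhds_zero]
  have hO : (fun b : Pt n d => ulim U (y + b) - ulim U y - L b)
      =O[nhds 0] fun b : Pt n d => ‖b‖ ^ 2 :=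
    Asymptotics.IsBigO.of_bound C (.of_forall fun b => by simpa using key b)
  exact hO.trans_isLittleO (Asymptotics.isLittleO_norm_pow_id one_lt_two)

lemma BddSmooth.contDiff_ulim {U : ℕ → TorusFun n d} (h : BddSmooth U) : ContDiff ℝ ∞ (ulim U) := by
  rw [contDiff_infty]
  intro k
  induction k generalizing U with
  | zero =>
    rw [Nat.cast_zero, contDiff_zero]
    exact continuous_iff_continuousAt.2 fun y => (h.hasFDerivAt_ulim y).choose_spec.1.continuousAt
  | succ k ih =>
    rw [Nat.cast_succ, contDiff_succ_iff_fderiv_apply]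
    refine ⟨fun y => (h.hasFDerivAt_ulim y).choose_spec.1.differentiableAt, by simp, fun b => ?_⟩
    have : (fun y => fderiv ℝ (ulim U) y b) = ulim fun j => Multiscale.dir b (U j) := by
      funext y
      obtain ⟨L, hL, hb⟩ := h.hasFDerivAt_ulim y
      rw [hL.fderiv, hb]
    rw [this]
    exact ih (h.dir b)

lemma BddSmooth.exists_ptLim {U : ℕ → TorusFun n d} (h : BddSmooth U) : ∃ u, PtLim U u :=
  ⟨⟨ulim U, h.contDiff_ulim, fun y z => by
    simp only [ulim, fun j => (U j).periodic y z]⟩, h.tendsto_ulim⟩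

lemma PtLim.dir {U : ℕ → TorusFun n d} {u : TorusFun n d} (h : BddSmooth U) (hu : PtLim U u)
    (b : Pt n d) : PtLim (fun j => dir b (U j)) (dir b u) := fun y => by
  have e : u.1 = ulim U := funext fun y => tendsto_nhds_unique (hu y) (h.tendsto_ulim y)
  obtain ⟨L, hL, hb⟩ := h.hasFDerivAt_ulim y
  have := (h.dir b).tendsto_ulim y
  rwa [← hb, ← hL.fderiv, ← e] at this

lemma PtLim.mul_left {U : ℕ → TorusFun n d} {u : TorusFun n d} (hu : PtLim U u)
    (f : TorusFun n d) : PtLim (fun j => f * U j) (f * u) := fun y => (hu y).const_mul _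

lemma PtLim.smul {U : ℕ → TorusFun n d} {u : TorusFun n d} (hu : PtLim U u) (c : ℝ) :
    PtLim (fun j => c • U j) (c • u) := fun y => (hu y).const_mul _

lemma PtLim.sub {U V : ℕ → TorusFun n d} {u v : TorusFun n d} (hu : PtLim U u) (hv : PtLim V v) :
    PtLim (fun j => U j - V j) (u - v) := fun y => (hu y).sub (hv y)

lemma PtLim.sum {α : Type*} (s : Finset α) {U : α → ℕ → TorusFun n d} {u : α → TorusFun n d}
    (h : ∀ a, PtLim (U a) (u a)) : PtLim (fun j => ∑ a ∈ s, U a j) (∑ a ∈ s, u a) := fun y => by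
  simp only [TorusFun.sum_val]
  exact tendsto_finsetSum _ fun a _ => h a y

lemma PtLim.unique {U : ℕ → TorusFun n d} {u v : TorusFun n d} (hu : PtLim U u)
    (hv : PtLim U v) : u = v := TorusFun.ext fun y => tendsto_nhds_unique (hu y) (hv y)

lemma BddSmooth.mul_left {ι : Type*} {U : ι → TorusFun n d} (h : BddSmooth U) (f : TorusFun n d) :
    BddSmooth fun j => f * U j := fun l => by
  choose C hC using h
  exact ⟨bconv l (fun i => DN nrmS i f) C, fun j => (DN_mul_le nrmS_mul l f (U j)).trans
    (bconv_mono_right (fun i => DN_nonneg _ _ _) fun i => hC i j)⟩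

lemma BddSmooth.sum {ι α : Type*} (s : Finset α) {U : α → ι → TorusFun n d}
    (h : ∀ a, BddSmooth (U a)) : BddSmooth fun j => ∑ a ∈ s, U a j := fun l => by
  choose C hC using h
  exact ⟨∑ a ∈ s, C a l, fun j => (seminorm_sum_le _ _ _).trans
    (Finset.sum_le_sum fun a _ => hC a l j)⟩

/-! ### Difference quotients -/

/-- The difference quotient along `b` with step `η`. -/
def fd (η : ℝ) (b : Pt n d) : TorusFun n d →ₗ[ℝ] TorusFun n d :=
  η⁻¹ • (tr (η • b) - LinearMap.id)

lemma fd_apply (η : ℝ) (b : Pt n d) (f : TorusFun n d) :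
    fd η b f = η⁻¹ • (tr (η • b) f - f) := rfl

lemma dir_fd (c b : Pt n d) (η : ℝ) (f : TorusFun n d) :
    dir c (fd η b f) = fd η b (dir c f) := by
  simp only [fd_apply, map_smul, map_sub, dir_tr]

lemma nrmS_fd_le {η : ℝ} (hη : η ≠ 0) (b : Pt n d) (f : TorusFun n d) :
    nrmS (fd η b f) ≤ ‖b‖ * DN nrmS 1 f := by
  have h := nrmS_tr_sub_le (η • b) f
  rw [fd_apply, map_smul_eq_mul, norm_inv, inv_mul_le_iff₀ (norm_pos_iff.2 hη)]
  rwa [norm_smul, mul_assoc] at h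

lemma nrmS_fd_sub_dir_le {η : ℝ} (hη : η ≠ 0) (b : Pt n d) (f : TorusFun n d) :
    nrmS (fd η b f - dir b f) ≤ |η| * (‖b‖ ^ 2 * DN nrmS 2 f) := by
  have h := nrmS_tr_sub_sub_dir_le (η • b) f
  have e : fd η b f - dir b f = η⁻¹ • (tr (η • b) f - f - dir (η • b) f) := by
    rw [fd_apply, dir_smul, smul_sub _ _ (η • _), smul_smul, inv_mul_cancel₀ hη, one_smul]
  rw [e, map_smul_eq_mul, norm_inv, inv_mul_le_iff₀ (norm_pos_iff.2 hη)]
  refine h.trans (le_of_eq ?_)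
  rw [norm_smul, Real.norm_eq_abs]; ring

lemma nrm2_fd_le (η : ℝ) (b : Pt n d) (f : TorusFun n d) :
    nrm2 (fd η b f) ≤ 2 * |η|⁻¹ * nrm2 f := by
  rw [fd_apply, map_smul_eq_mul, Real.norm_eq_abs, abs_inv, mul_assoc, mul_left_comm]
  refine mul_le_mul_of_nonneg_left ((map_sub_le_add _ _ _).trans ?_) (by positivity)
  rw [nrm2_tr]; linarith

lemma tint_fd_mul (η : ℝ) (b : Pt n d) (f g : TorusFun n d) :
    tint (fd η b f * g) = - tint (f * fd (-η) b g) := by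
  have h : tint (tr (η • b) f * g) = tint (f * tr (-η • b) g) := by
    rw [← tint_tr (-η • b) (tr (η • b) f * g), tr_mul]
    congr 2
    refine TorusFun.ext fun y => ?_
    simp
  simp only [fd_apply, smul_mul_assoc, mul_smul_comm, map_smul, sub_mul, mul_sub, map_sub, h,
    smul_eq_mul, inv_neg]
  ring

lemma BddSmooth.fd {U : ℕ → TorusFun n d} (h : BddSmooth U) {η : ℕ → ℝ} (hη : ∀ j, η j ≠ 0)
    (b : Pt n d) : BddSmooth fun j => fd (η j) b (U j) := fun l => by
  obtain ⟨C, hC⟩ := h (l + 1)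
  refine ⟨‖b‖ * C, fun j => ?_⟩
  refine (DN_comm_le (T := Multiscale.fd (η j) b) (fun p f => dir_fd _ b _ f)
    (nrmS_fd_le (hη j) b) l (U j)).trans ?_
  rw [DN_add_index]
  exact mul_le_mul_of_nonneg_left (hC j) (norm_nonneg _)

lemma PtLim.fd {U : ℕ → TorusFun n d} {u : TorusFun n d} (h : BddSmooth U) (hu : PtLim U u)
    {η : ℕ → ℝ} (hη : ∀ j, η j ≠ 0) (hη0 : Filter.Tendsto η Filter.atTop (nhds 0)) (b : Pt n d) :
    PtLim (fun j => fd (η j) b (U j)) (Multiscale.dir b u) := fun y => by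
  obtain ⟨C, hC⟩ := h 2
  have h0 : Filter.Tendsto (fun j => |η j| * (‖b‖ ^ 2 * C)) hyper (nhds 0) := by
    simpa using (hη0.mono_left hyper_le_atTop).abs.mul_const (‖b‖ ^ 2 * C)
  have h1 : Filter.Tendsto
      (fun j => (Multiscale.fd (η j) b (U j) - Multiscale.dir b (U j)).1 y) hyper (nhds 0) := by
    refine squeeze_zero_norm (fun j => ?_) h0
    refine (abs_le_nrmS _ y).trans ((nrmS_fd_sub_dir_le (hη j) b (U j)).trans ?_)
    gcongr
    exact hC j
  have h2 := h1.add (hu.dir h b y)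
  simpa using h2

/-! ### Solving the regularized equation by iteration -/

lemma summable_of_contraction {a b : ℕ → ℝ} {θ : ℝ} (hθ : θ < 1)
    (ha : ∀ j, 0 ≤ a j) (hb : ∀ j, 0 ≤ b j) (hbs : Summable b)
    (h : ∀ j, a (j + 1) ≤ θ * a j + b j) : Summable a := by
  refine summable_of_sum_range_le (c := (a 0 + ∑' j, b j) / (1 - θ)) ha fun N => ?_
  rw [le_div_iff₀ (by linarith)]
  have h1 : ∑ j ∈ Finset.range (N + 1), a j ≤
      θ * ∑ j ∈ Finset.range N, a j + ∑ j ∈ Finset.range N, b j + a 0 := by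
    rw [Finset.sum_range_succ', Finset.mul_sum, ← Finset.sum_add_distrib]
    exact add_le_add_left (Finset.sum_le_sum fun j _ => h j) _
  have h2 := hbs.sum_le_tsum (Finset.range N) fun j _ => hb j
  rw [Finset.sum_range_succ] at h1
  linarith [ha N]

/-- A linear map which contracts `L²` and commutes with derivatives up to lower order terms has a
convergent Neumann series of smooth functions. -/
lemma exists_neumann {T : TorusFun n d →ₗ[ℝ] TorusFun n d} {θ : ℝ} (hθ : θ < 1)
    (hT : ∀ w, nrm2 (T w) ≤ θ * nrm2 w)
    (hB : ∀ l, ∃ C, 0 ≤ C ∧ ∀ p w, DN nrm2 l (pd p (T w) - T (pd p w))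
      ≤ C * ∑ k ∈ Finset.range (l + 1), DN nrm2 k w) (w : TorusFun n d) :
    ∃ U : ℕ → TorusFun n d, BddSmooth U ∧ PtLim (fun j => U j - T (U j)) w := by
  -- contraction up to lower order terms for all derivatives
  have h1 : ∀ l, ∃ C, 0 ≤ C ∧ ∀ w, DN nrm2 l (T w)
      ≤ θ * DN nrm2 l w + C * ∑ k ∈ Finset.range l, DN nrm2 k w := fun l => by
    induction l with
    | zero => exact ⟨0, le_rfl, fun w => by simpa using hT w⟩
    | succ l ih =>
      obtain ⟨C1, hC1, h1⟩ := ih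
      obtain ⟨C2, hC2, h2⟩ := hB l
      refine ⟨C1 + (n * d : ℕ) * C2, by positivity, fun w => ?_⟩
      have h3 : ∀ p, DN nrm2 l (pd p (T w)) ≤ (θ * DN nrm2 l (pd p w)
          + C1 * ∑ k ∈ Finset.range l, DN nrm2 k (pd p w))
          + C2 * ∑ k ∈ Finset.range (l + 1), DN nrm2 k w := fun p => by
        have e : pd p (T w) = T (pd p w) + (pd p (T w) - T (pd p w)) := by abel
        rw [e]
        exact (map_add_le_add _ _ _).trans (add_le_add (h1 _) (h2 p w))
      rw [DN_succ]
      refine (Finset.sum_le_sum fun p _ => h3 p).trans ?_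
      rw [Finset.sum_add_distrib, Finset.sum_add_distrib, ← Finset.mul_sum, ← DN_succ,
        ← Finset.mul_sum, Finset.sum_comm]
      simp only [← DN_succ, Finset.sum_const, Finset.card_univ, Fintype.card_prod,
        Fintype.card_fin, nsmul_eq_mul]
      have h4 : ∑ k ∈ Finset.range l, DN nrm2 (k + 1) w
          ≤ ∑ k ∈ Finset.range (l + 1), DN nrm2 k w := by
        rw [Finset.sum_range_succ']
        exact le_add_of_nonneg_right (DN_nonneg _ _ _)
      nlinarith [mul_le_mul_of_nonneg_left h4 hC1]
  let W : ℕ → TorusFun n d := fun j => (T ^ j) w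
  have hW : ∀ j, W (j + 1) = T (W j) := fun j => by
    simp only [W, pow_succ', Module.End.mul_apply]
  have hs : ∀ l, Summable fun j => DN nrm2 l (W j) := fun l => by
    induction l using Nat.strong_induction_on with
    | _ l ih =>
      obtain ⟨C, hC, hl⟩ := h1 l
      refine summable_of_contraction hθ (fun j => DN_nonneg _ _ _)
        (b := fun j => C * ∑ k ∈ Finset.range l, DN nrm2 k (W j))
        (fun j => mul_nonneg hC (Finset.sum_nonneg fun _ _ => DN_nonneg _ _ _))
        (Summable.mul_left _ (summable_sum fun k hk => ih k (Finset.mem_range.1 hk)))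
        fun j => by rw [hW]; exact hl _
  refine ⟨fun N => ∑ j ∈ Finset.range N, W j, fun l => ?_, fun y => ?_⟩
  · refine ⟨2 ^ (n * d) * ∑ i ∈ Finset.range (n * d + 1), ∑' j, DN nrm2 (l + i) (W j), fun N => ?_⟩
    refine (DN_nrmS_le_sum_DN_nrm2 l _).trans (mul_le_mul_of_nonneg_left
      (Finset.sum_le_sum fun i _ => ?_) (by positivity))
    exact (seminorm_sum_le _ _ _).trans ((hs _).sum_le_tsum _ fun j _ => DN_nonneg _ _ _)
  · have e : ∀ N, (∑ j ∈ Finset.range N, W j) - T (∑ j ∈ Finset.range N, W j) = w - W N :=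
      fun N => by
        rw [map_sum, ← Finset.sum_sub_distrib]
        simp only [← hW]
        rw [Finset.sum_range_sub']; rfl
    simp only [e]
    have h0 : Filter.Tendsto (fun N => 2 ^ (n * d) * ∑ i ∈ Finset.range (n * d + 1),
        DN nrm2 (0 + i) (W N)) Filter.atTop (nhds 0) := by
      have := (tendsto_finsetSum (Finset.range (n * d + 1)) fun i _ =>
        (hs (0 + i)).tendsto_atTop_zero).const_mul ((2 : ℝ) ^ (n * d))
      simpa using this
    have h2 : Filter.Tendsto (fun N => (W N).1 y) hyper (nhds 0) :=
      squeeze_zero_norm (fun N => (abs_le_nrmS _ y).trans (DN_nrmS_le_sum_DN_nrm2 0 (W N)))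
        (h0.mono_left hyper_le_atTop)
    simpa using h2.const_sub (w.1 y)

/-- The operator `τ² + ∇_η* A ∇_η`, where `∇_η` consists of difference quotients with step `η`; the
adjoint of such a quotient is minus the quotient with step `-η`. -/
def fdOp (η τ : ℝ) (b : Fin d → Pt n d) (A : Fin d → Fin d → TorusFun n d) :
    TorusFun n d →ₗ[ℝ] TorusFun n d :=
  τ ^ 2 • LinearMap.id - ∑ a, (fd (-η) (b a)) ∘ₗ (∑ c, (LinearMap.mulLeft ℝ (A a c)) ∘ₗ fd η (b c))

lemma fdOp_apply (η τ : ℝ) (b : Fin d → Pt n d) (A : Fin d → Fin d → TorusFun n d)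
    (w : TorusFun n d) :
    fdOp η τ b A w = τ ^ 2 • w - ∑ a, fd (-η) (b a) (∑ c, A a c * fd η (b c) w) := by
  simp [fdOp, LinearMap.sum_apply]

/-- The gradient made of difference quotients. -/
def fdGrad (η : ℝ) (b : Fin d → Pt n d) : GradOp n d := fun a => fd η (b a)

lemma weakEq_fdOp (η τ : ℝ) (b : Fin d → Pt n d) (A : Fin d → Fin d → TorusFun n d)
    (w : TorusFun n d) : WeakEq (fdGrad η b) τ A 0 (fdOp η τ b A w) w := fun φ => by
  rw [fdOp_apply, sub_mul, map_sub, smul_mul_assoc, map_smul, Finset.sum_mul, map_sum]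
  simp only [tint_fd_mul, neg_neg, Pi.zero_apply, add_zero, fdGrad, Finset.sum_neg_distrib,
    smul_eq_mul]
  ring

lemma Coercive.sum_tint_nonneg {lam : ℝ} (hlam : 0 ≤ lam) {A : Fin d → Fin d → TorusFun n d}
    (hA : Coercive lam A) (g : Fin d → TorusFun n d) :
    0 ≤ ∑ a, tint ((∑ b, A a b * g b) * g a) := by
  rw [← map_sum]
  refine tint_nonneg fun y => ?_
  simp only [TorusFun.sum_val, TorusFun.mul_val]
  have h := hA y fun a => (g a).1 y
  have h0 : 0 ≤ lam * ∑ a, (g a).1 y ^ 2 :=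
    mul_nonneg hlam (Finset.sum_nonneg fun a _ => sq_nonneg _)
  exact (h0.trans h).trans (le_of_eq (Finset.sum_congr rfl fun a _ => mul_comm _ _))

lemma DN_nrm2_fd_le (l : ℕ) (η : ℝ) (b : Pt n d) (f : TorusFun n d) :
    DN nrm2 l (fd η b f) ≤ 2 * |η|⁻¹ * DN nrm2 l f :=
  DN_comm_le (fun _ f => dir_fd _ b _ f) (nrm2_fd_le η b) l f

/-- For fixed `η` the operator `-∇_η* A ∇_η` is of order zero: it is bounded on every Sobolev
space. -/
lemma DN_fd_mul_fd_le (η : ℝ) (b : Fin d → Pt n d) (A : Fin d → Fin d → TorusFun n d) (l : ℕ)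
    (w : TorusFun n d) :
    DN nrm2 l (∑ a, fd (-η) (b a) (∑ c, A a c * fd η (b c) w)) ≤
      (2 * |η|⁻¹ * (2 * |η|⁻¹ * ∑ ij ∈ Finset.HasAntidiagonal.antidiagonal l,
        (l.choose ij.1 : ℝ) * (d * matS A ij.1))) * ∑ k ∈ Finset.range (l + 1), DN nrm2 k w := by
  have hη : 0 ≤ 2 * |η|⁻¹ := by positivity
  refine (seminorm_sum_le _ _ _).trans ?_
  refine (Finset.sum_le_sum fun a _ => DN_nrm2_fd_le l (-η) (b a) _).trans ?_
  rw [abs_neg, ← Finset.mul_sum, mul_assoc (2 * |η|⁻¹)]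
  refine mul_le_mul_of_nonneg_left ((sum_DN_mul_le A _ l).trans ?_) hη
  rw [mul_comm (2 * |η|⁻¹), mul_assoc, Finset.sum_mul]
  refine Finset.sum_le_sum fun ij hij => ?_
  have hs := Finset.HasAntidiagonal.mem_antidiagonal.1 hij
  have h1 : ∑ c, DN nrm2 ij.2 (fd η (b c) w)
      ≤ d * (2 * |η|⁻¹ * ∑ k ∈ Finset.range (l + 1), DN nrm2 k w) := by
    refine (Finset.sum_le_sum fun c _ => DN_nrm2_fd_le ij.2 η (b c) w).trans ?_
    rw [Finset.sum_const, Finset.card_univ, Fintype.card_fin, nsmul_eq_mul]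
    refine mul_le_mul_of_nonneg_left (mul_le_mul_of_nonneg_left ?_ hη) (Nat.cast_nonneg _)
    exact Finset.single_le_sum (f := fun k => DN nrm2 k w) (fun _ _ => DN_nonneg _ _ _)
      (Finset.mem_range.2 (by omega))
  refine (mul_le_mul_of_nonneg_left (mul_le_mul_of_nonneg_left h1 (matS_nonneg A _))
    (Nat.cast_nonneg _)).trans (le_of_eq (by ring))

/-- For small `s > 0` the map `w ↦ w - s (τ² + ∇_η* A ∇_η) w` contracts `L²` by coercivity, so the
regularized equation is solved by a Neumann series. -/
lemma exists_fdOp_eq (η : ℝ) {τ lam : ℝ} (hτ : 0 < τ) (hlam : 0 < lam) (b : Fin d → Pt n d)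
    {A : Fin d → Fin d → TorusFun n d} (hA : Coercive lam A) (f : TorusFun n d) :
    ∃ u, fdOp η τ b A u = f := by
  -- an `L²` bound for the operator, made at least `τ²`
  obtain ⟨C, hCτ, hC⟩ : ∃ C, τ ^ 2 ≤ C ∧ ∀ w, nrm2 (fdOp η τ b A w) ≤ C * nrm2 w := by
    have h0 : ∀ i, 0 ≤ matS A i := matS_nonneg A
    refine ⟨τ ^ 2 + 2 * |η|⁻¹ * (2 * |η|⁻¹ * ∑ ij ∈ Finset.HasAntidiagonal.antidiagonal 0,
      ((0 : ℕ).choose ij.1 : ℝ) * (d * matS A ij.1)), le_add_of_nonneg_right ?_, fun w => ?_⟩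
    · exact mul_nonneg (by positivity) (mul_nonneg (by positivity)
        (Finset.sum_nonneg fun ij _ => mul_nonneg (Nat.cast_nonneg _)
          (mul_nonneg (Nat.cast_nonneg _) (h0 _))))
    · have h := DN_fd_mul_fd_le η b A 0 w
      simp only [DN_zero, zero_add, Finset.sum_range_one] at h
      rw [fdOp_apply]
      refine (map_sub_le_add _ _ _).trans ?_
      rw [map_smul_eq_mul, Real.norm_eq_abs, abs_of_pos (pow_pos hτ 2), add_mul]
      exact add_le_add_right h _
  have hC0 : 0 < C := (pow_pos hτ 2).trans_le hCτ
  set x : ℝ := τ ^ 4 / C ^ 2 with hx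
  have hx0 : 0 < x := by positivity
  have hx1 : x ≤ 1 := by
    rw [hx, div_le_one (by positivity)]
    calc τ ^ 4 = (τ ^ 2) ^ 2 := by ring
      _ ≤ C ^ 2 := pow_le_pow_left₀ (by positivity) hCτ 2
  -- the step which minimizes `1 - 2 s τ² + s² C²`
  set s : ℝ := τ ^ 2 / C ^ 2 with hs
  have hs0 : 0 < s := by positivity
  let T : TorusFun n d →ₗ[ℝ] TorusFun n d := LinearMap.id - s • fdOp η τ b A
  have hTa : ∀ w, T w = w - s • fdOp η τ b A w := fun w => rfl
  have hT : ∀ w, nrm2 (T w) ≤ (1 - x / 2) * nrm2 w := fun w => by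
    have h1 : τ ^ 2 * nrm2 w ^ 2 ≤ tint (fdOp η τ b A w * w) := by
      have h := weakEq_fdOp η τ b A w w
      simp only [Pi.zero_apply, add_zero] at h
      have h2 := hA.sum_tint_nonneg hlam.le fun a => fdGrad η b a w
      rw [nrm2_sq]; linarith
    have h2 : nrm2 (T w) ^ 2 = nrm2 w ^ 2 - 2 * s * tint (fdOp η τ b A w * w)
        + s ^ 2 * nrm2 (fdOp η τ b A w) ^ 2 := by
      have e : T w * T w = w * w - (2 * s) • (fdOp η τ b A w * w)
          + (s ^ 2) • (fdOp η τ b A w * fdOp η τ b A w) := by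
        rw [hTa]
        refine TorusFun.ext fun y => ?_
        simp only [TorusFun.mul_val, TorusFun.sub_val, TorusFun.add_val, TorusFun.smul_val]
        ring
      rw [nrm2_sq, nrm2_sq, nrm2_sq, e, map_add, map_sub, map_smul, map_smul]; rfl
    have h3 : nrm2 (fdOp η τ b A w) ^ 2 ≤ C ^ 2 * nrm2 w ^ 2 := by
      rw [← mul_pow]; exact pow_le_pow_left₀ (apply_nonneg _ _) (hC w) 2
    have e1 : s * τ ^ 2 = x := by rw [hs, hx]; ring
    have e2 : s ^ 2 * C ^ 2 = x := by rw [hs, hx]; field_simp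
    refine (abs_le_of_sq_le_sq' ?_ (mul_nonneg (by linarith) (apply_nonneg _ _))).2
    rw [h2, mul_pow]
    have h4 : 2 * s * (τ ^ 2 * nrm2 w ^ 2) ≤ 2 * s * tint (fdOp η τ b A w * w) :=
      mul_le_mul_of_nonneg_left h1 (by positivity)
    have h5 : s ^ 2 * nrm2 (fdOp η τ b A w) ^ 2 ≤ s ^ 2 * (C ^ 2 * nrm2 w ^ 2) :=
      mul_le_mul_of_nonneg_left h3 (by positivity)
    have h6 : 2 * s * (τ ^ 2 * nrm2 w ^ 2) = 2 * x * nrm2 w ^ 2 := by rw [← e1]; ring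
    have h7 : s ^ 2 * (C ^ 2 * nrm2 w ^ 2) = x * nrm2 w ^ 2 := by rw [← mul_assoc, e2]
    nlinarith [mul_nonneg (sq_nonneg x) (sq_nonneg (nrm2 w))]
  have hcomm : ∀ p w, pd p (T w) - T (pd p w)
      = s • ∑ a, fd (-η) (b a) (∑ c, pd p (A a c) * fd η (b c) w) := fun p w => by
    have e : pd p (fdOp η τ b A w) = fdOp η τ b A (pd p w)
        - ∑ a, fd (-η) (b a) (∑ c, pd p (A a c) * fd η (b c) w) := by
      rw [fdOp_apply, fdOp_apply, map_sub, map_smul, map_sum, sub_sub, ← Finset.sum_add_distrib]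
      congr 1
      refine Finset.sum_congr rfl fun a _ => ?_
      rw [dir_fd, map_sum, ← map_add, ← Finset.sum_add_distrib]
      congr 1
      exact Finset.sum_congr rfl fun c _ => by rw [dir_mul, dir_fd, add_comm]
    rw [hTa, hTa, map_sub, map_smul, e, smul_sub]; abel
  obtain ⟨U, hU, hlim⟩ := exists_neumann (T := T) (θ := 1 - x / 2) (by linarith) hT
    (fun l => by
      refine ⟨∑ p, s * (2 * |η|⁻¹ * (2 * |η|⁻¹ * ∑ ij ∈ Finset.HasAntidiagonal.antidiagonal l,
        (l.choose ij.1 : ℝ) * (d * matS (fun a c => pd p (A a c)) ij.1))), ?_, fun p w => ?_⟩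
      · have : ∀ p i, 0 ≤ matS (fun a c => pd p (A a c)) i := fun p i => matS_nonneg _ i
        exact Finset.sum_nonneg fun _ _ => mul_nonneg hs0.le (mul_nonneg (by positivity)
          (mul_nonneg (by positivity) (Finset.sum_nonneg fun ij _ => mul_nonneg
            (Nat.cast_nonneg _) (mul_nonneg (Nat.cast_nonneg _) (this _ _)))))
      · rw [hcomm, DN_smul, abs_of_pos hs0]
        refine (mul_le_mul_of_nonneg_left (DN_fd_mul_fd_le η b
          (fun a c => pd p (A a c)) l w) hs0.le).trans ?_
        rw [← mul_assoc]
        refine mul_le_mul_of_nonneg_right ?_ (Finset.sum_nonneg fun _ _ => DN_nonneg _ _ _)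
        refine Finset.single_le_sum (f := fun p => s * (2 * |η|⁻¹ * (2 * |η|⁻¹ *
          ∑ ij ∈ Finset.HasAntidiagonal.antidiagonal l,
          (l.choose ij.1 : ℝ) * (d * matS (fun a c => pd p (A a c)) ij.1)))) (fun p _ => ?_)
          (Finset.mem_univ p)
        exact mul_nonneg hs0.le (mul_nonneg (by positivity)
          (mul_nonneg (by positivity) (Finset.sum_nonneg fun ij _ => mul_nonneg
            (Nat.cast_nonneg _) (mul_nonneg (Nat.cast_nonneg _) (matS_nonneg _ _)))))) (s • f)
  obtain ⟨u, hu⟩ := hU.exists_ptLim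
  have hfd : ∀ (η : ℝ) (c : Pt n d) {V : ℕ → TorusFun n d} {v : TorusFun n d}, PtLim V v →
      PtLim (fun j => fd η c (V j)) (fd η c v) := fun η c V v hv y =>
    ((hv (y + η • c)).sub (hv y)).const_mul _
  have hP : PtLim (fun j => fdOp η τ b A (U j)) (fdOp η τ b A u) := by
    simp only [fdOp_apply]
    exact (hu.smul _).sub (PtLim.sum _ fun a => hfd _ _
      (PtLim.sum _ fun c => (hfd _ _ hu).mul_left _))
  have h1 : PtLim (fun j => U j - T (U j)) (s • fdOp η τ b A u) := by
    have : (fun j => U j - T (U j)) = fun j => s • fdOp η τ b A (U j) :=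
      funext fun j => by rw [hTa]; abel
    rw [this]; exact hP.smul s
  have h2 := h1.unique hlim
  refine ⟨u, TorusFun.ext fun y => ?_⟩
  have h3 := congrFun (congrArg Subtype.val h2) y
  simp only [TorusFun.smul_val] at h3
  exact mul_left_cancel₀ hs0.ne' h3

/-! ### Smooth solutions of the degenerate equation -/

/-- The gradient made of the directional derivatives along `b a`. -/
def dirGrad (b : Fin d → Pt n d) : GradOp n d := fun a => dir (b a)

lemma dirGrad_commPd (b : Fin d → Pt n d) : (dirGrad b).CommPd := fun _ _ f => dir_comm _ _ f

lemma fdGrad_commPd (η : ℝ) (b : Fin d → Pt n d) : (fdGrad η b).CommPd :=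
  fun _ _ f => dir_fd _ _ _ f

/-- Bounds for the solution depend linearly on the data, and do not depend on the gradient
operator. -/
lemma exists_energy_bound {lam : ℝ} (hlam : 0 < lam) (A : Fin d → Fin d → TorusFun n d)
    (hA : Coercive lam A) : ∃ c : ℕ → ℝ, (∀ l, 0 ≤ c l) ∧
      ∀ (G : GradOp n d) (τ : ℝ) (F : Fin d → TorusFun n d) (f u : TorusFun n d), G.CommPd →
        0 < τ → WeakEq G τ A F f u → ∀ l, energy G τ l u ≤
          c l * ∑ j ∈ Finset.range (l + 1), (∑ a, DN nrm2 j (F a) + DN nrm2 j f / τ) := by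
  obtain ⟨c, h0, hc⟩ := exists_bound_of_recursion (energyConst d lam) (energyConst_pos d hlam).le
    (matS' A) (matS'_nonneg A) (if_pos rfl)
  exact ⟨c, h0, fun G τ F f u hG hτ h l => hc _ _
    (fun l => add_nonneg (Finset.sum_nonneg fun _ _ => DN_nonneg _ _ _)
      (div_nonneg (DN_nonneg _ _ _) hτ.le)) (fun l => h.energy_rec hG hlam hτ hA l) l⟩

/-- The solutions for difference quotients with steps `1 / (j + 1)` have bounded derivatives, by
the energy estimate, and converge to a smooth solution of the degenerate equation. -/
lemma exists_strong_solution {τ lam : ℝ} (hτ : 0 < τ) (hlam : 0 < lam) (b : Fin d → Pt n d)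
    {A : Fin d → Fin d → TorusFun n d} (hA : Coercive lam A) (f : TorusFun n d) :
    ∃ u, τ ^ 2 • u - ∑ a, dir (b a) (∑ c, A a c * dir (b c) u) = f := by
  let η : ℕ → ℝ := fun j => 1 / ((j : ℝ) + 1)
  have hη : ∀ j, η j ≠ 0 := fun j => by positivity
  have hη0 : Filter.Tendsto η Filter.atTop (nhds 0) := tendsto_one_div_add_atTop_nhds_zero_nat
  choose U hU using fun j => exists_fdOp_eq (η j) hτ hlam b hA f
  obtain ⟨c, h0, hc⟩ := exists_energy_bound hlam A hA
  have hB : ∀ l j, DN nrm2 l (U j) ≤ c l * (∑ j ∈ Finset.range (l + 1), DN nrm2 j f / τ) / τ :=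
    fun l j => by
      have h := weakEq_fdOp (η j) τ b A (U j)
      rw [hU] at h
      have h1 := hc _ τ _ f (U j) (fdGrad_commPd (η j) b) hτ h l
      simp only [Pi.zero_apply, map_zero, Finset.sum_const_zero, zero_add] at h1
      rw [le_div_iff₀ hτ, mul_comm]
      exact (DN_le_energy _ τ l _).trans h1
  have hbdd : BddSmooth U := fun l => ⟨_, fun j => (DN_nrmS_le_sum_DN_nrm2 l _).trans
    (mul_le_mul_of_nonneg_left (Finset.sum_le_sum fun i _ => hB (l + i) j) (by positivity))⟩
  obtain ⟨u, hu⟩ := hbdd.exists_ptLim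
  refine ⟨u, ?_⟩
  have hη' : ∀ j, -η j ≠ 0 := fun j => neg_ne_zero.2 (hη j)
  have hη0' : Filter.Tendsto (fun j => -η j) Filter.atTop (nhds 0) := by simpa using hη0.neg
  have h1 : PtLim (fun j => fdOp (η j) τ b A (U j))
      (τ ^ 2 • u - ∑ a, dir (b a) (∑ c, A a c * dir (b c) u)) := by
    simp only [fdOp_apply]
    refine (hu.smul _).sub (PtLim.sum _ fun a => PtLim.fd ?_ ?_ hη' hη0' (b a))
    · exact BddSmooth.sum _ fun c => (hbdd.fd hη (b c)).mul_left _
    · exact PtLim.sum _ fun c => (hu.fd hbdd hη hη0 (b c)).mul_left _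
  simp only [hU] at h1
  exact h1.unique fun y => tendsto_const_nhds

lemma weakEq_of_strong {τ : ℝ} {b : Fin d → Pt n d} {A : Fin d → Fin d → TorusFun n d}
    {F : Fin d → TorusFun n d} {f u : TorusFun n d}
    (h : τ ^ 2 • u - ∑ a, dir (b a) (∑ c, A a c * dir (b c) u) = f + ∑ a, dir (b a) (F a)) :
    WeakEq (dirGrad b) τ A F f u := fun φ => by
  have h1 := congrArg (fun g => tint (g * φ)) h
  simp only [sub_mul, add_mul, Finset.sum_mul, map_sub, map_add, map_sum, tint_dir_mul,
    smul_mul_assoc, map_smul, Finset.sum_neg_distrib, smul_eq_mul] at h1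
  simp only [dirGrad, add_mul, map_add, Finset.sum_add_distrib, Finset.sum_mul, map_sum]
  linarith

lemma exists_weakEq {τ lam : ℝ} (hτ : 0 < τ) (hlam : 0 < lam) (b : Fin d → Pt n d)
    {A : Fin d → Fin d → TorusFun n d} (hA : Coercive lam A) (F : Fin d → TorusFun n d) :
    ∃ u, WeakEq (dirGrad b) τ A F 0 u := by
  obtain ⟨u, hu⟩ := exists_strong_solution hτ hlam b hA (∑ a, dir (b a) (F a))
  exact ⟨u, weakEq_of_strong (by rw [hu, zero_add])⟩

/-! ### Averages of smooth periodic functions -/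

/-- Differentiation under the integral sign. -/
lemma hasFDerivAt_segAvg (b : Pt n d) (f : TorusFun n d) (y : Pt n d) :
    ∃ L : Pt n d →L[ℝ] ℝ, HasFDerivAt (segAvg b f.1) L y ∧
      ∀ c, L c = segAvg b (dir c f).1 y := by
  have hc : Continuous (fderiv ℝ f.1) := f.contDiff.continuous_fderiv (by simp)
  have hf := f.continuous
  obtain ⟨C, hC⟩ := f.periodic.fderiv.exists_bound hc
  have hint : ∀ y, IntervalIntegrable (fun t : ℝ => fderiv ℝ f.1 (y + t • b)) volume 0 1 :=
    fun y => Continuous.intervalIntegrable (by fun_prop) _ _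
  refine ⟨∫ t in (0 : ℝ)..1, fderiv ℝ f.1 (y + t • b), ?_, fun c => ?_⟩
  · refine intervalIntegral.hasFDerivAt_integral_of_dominated_of_fderiv_le
      (F := fun y t => f.1 (y + t • b)) (F' := fun y t => fderiv ℝ f.1 (y + t • b))
      (bound := fun _ => C) (s := Set.univ) Filter.univ_mem ?_ ?_ ?_ ?_ ?_ ?_
    · exact .of_forall fun y => Continuous.aestronglyMeasurable (by fun_prop)
    · exact Continuous.intervalIntegrable (by fun_prop) _ _
    · exact Continuous.aestronglyMeasurable (by fun_prop)
    · exact .of_forall fun t _ y _ => hC _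
    · exact intervalIntegrable_const
    · refine .of_forall fun t _ y _ => ?_
      exact (hasFDerivAt_comp_add_right (t • b)).2 (f.differentiable (y + t • b)).hasFDerivAt
  · rw [ContinuousLinearMap.intervalIntegral_apply (hint y)]; rfl

lemma contDiff_segAvg (b : Pt n d) (f : TorusFun n d) : ContDiff ℝ ∞ (segAvg b f.1) := by
  rw [contDiff_infty]
  intro k
  induction k generalizing f with
  | zero =>
    rw [Nat.cast_zero, contDiff_zero]
    exact segAvg_continuous b f.continuous
  | succ k ih =>
    rw [Nat.cast_succ, contDiff_succ_iff_fderiv_apply]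
    refine ⟨fun y => (hasFDerivAt_segAvg b f y).choose_spec.1.differentiableAt, by simp,
      fun c => ?_⟩
    have : (fun y => fderiv ℝ (segAvg b f.1) y c) = segAvg b (dir c f).1 := by
      funext y
      obtain ⟨L, hL, hb⟩ := hasFDerivAt_segAvg b f y
      rw [hL.fderiv, hb]
    rw [this]
    exact ih (dir c f)

/-- The average over the segment from `0` to `b`, on smooth periodic functions. -/
def avg (b : Pt n d) : TorusFun n d →ₗ[ℝ] TorusFun n d where
  toFun f := ⟨segAvg b f.1, contDiff_segAvg b f, segAvg_periodic b f.periodic⟩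
  map_add' f g := TorusFun.ext fun y => segAvg_add b f.continuous g.continuous y
  map_smul' c _ := TorusFun.ext fun _ => intervalIntegral.integral_const_mul c _

lemma avg_val (b : Pt n d) (f : TorusFun n d) (y) : (avg b f).1 y = segAvg b f.1 y := rfl

lemma dir_avg (c b : Pt n d) (f : TorusFun n d) : dir c (avg b f) = avg b (dir c f) :=
  TorusFun.ext fun y => by
    obtain ⟨L, hL, hb⟩ := hasFDerivAt_segAvg b f y
    rw [dir_val, avg_val, ← hb, ← hL.fderiv]; rfl

lemma nrmS_avg_le (b : Pt n d) (f : TorusFun n d) : nrmS (avg b f) ≤ nrmS f :=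
  nrmS_le fun y => by
    have := intervalIntegral.norm_integral_le_of_norm_le_const (a := 0) (b := 1)
      (f := fun t : ℝ => f.1 (y + t • b)) (C := nrmS f) fun t _ => abs_le_nrmS f _
    simpa [avg_val, segAvg] using this

lemma nrmS_sub_avg_le (b : Pt n d) (f : TorusFun n d) : nrmS (f - avg b f) ≤ nrmS (dir b f) :=
  nrmS_le fun y => by
    have hf := f.continuous
    have h1 : ∀ t ∈ Set.uIoc (0 : ℝ) 1, ‖f.1 y - f.1 (y + t • b)‖ ≤ nrmS (dir b f) :=
      fun t ht => by
        rw [Set.uIoc_of_le zero_le_one] at ht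
        have h := Convex.norm_image_sub_le_of_norm_hasDerivWithin_le
          (f := fun s : ℝ => f.1 (y + s • b)) (C := nrmS (dir b f)) (x := t) (y := 0)
          (s := Set.univ) (fun t _ => (f.hasDerivAt_line y b t).hasDerivWithinAt)
          (fun t _ => abs_le_nrmS _ _) convex_univ (Set.mem_univ _) (Set.mem_univ _)
        simp only [zero_smul, add_zero, zero_sub, norm_neg, Real.norm_eq_abs,
          abs_of_pos ht.1] at h
        exact h.trans (mul_le_of_le_one_right (apply_nonneg _ _) ht.2)
    have h2 := intervalIntegral.norm_integral_le_of_norm_le_const h1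
    rw [intervalIntegral.integral_sub intervalIntegrable_const
      (Continuous.intervalIntegrable (by fun_prop) _ _)] at h2
    simpa [avg_val, segAvg] using h2

lemma IsPeriodic.add_unitVec {β : Type*} {f : Pt n d → β} (hf : IsPeriodic f)
    (p : Fin n × Fin d) (y : Pt n d) : f (y + unitVec p) = f y := by
  refine Eq.trans (congrArg f ?_) (hf y (Pi.single p.1 (Pi.single p.2 1)))
  funext i a
  by_cases h1 : i = p.1
  · subst h1
    by_cases h2 : a = p.2
    · subst h2; simp [unitVec]
    · simp [unitVec, h2]
  · simp [unitVec, h1]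

lemma pd_avg_self (p : Fin n × Fin d) (f : TorusFun n d) : pd p (avg (unitVec p) f) = 0 := by
  rw [dir_avg]
  refine TorusFun.ext fun y => ?_
  rw [avg_val, segAvg_dir, f.periodic.add_unitVec, sub_self]; rfl

lemma tint_avg (b : Pt n d) (f : TorusFun n d) : tint (avg b f) = tint f :=
  integral_segAvg b f.continuous f.periodic

/-- The average over the variable `y_i`. -/
def blockAvg (i : Fin n) : TorusFun n d →ₗ[ℝ] TorusFun n d :=
  ((List.finRange d).map fun a => avg (unitVec (i, a))).prod

/-- An induction principle for properties of compositions of linear maps. -/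
lemma listProd_induction {P : (TorusFun n d →ₗ[ℝ] TorusFun n d) → Prop} (h1 : P 1)
    (hm : ∀ S T, P S → P T → P (S * T)) (L : List (TorusFun n d →ₗ[ℝ] TorusFun n d))
    (hL : ∀ T ∈ L, P T) : P L.prod := by
  induction L with
  | nil => exact h1
  | cons T L ih =>
    rw [List.prod_cons]
    exact hm _ _ (hL T (by simp)) (ih fun S hS => hL S (by simp [hS]))

lemma blockAvg_induction (i : Fin n) {P : (TorusFun n d →ₗ[ℝ] TorusFun n d) → Prop} (h1 : P 1)
    (hm : ∀ S T, P S → P T → P (S * T)) (ha : ∀ a, P (avg (unitVec (i, a)))) :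
    P (blockAvg i) :=
  listProd_induction h1 hm _ fun T hT => by
    obtain ⟨a, -, rfl⟩ := List.mem_map.1 hT
    exact ha a

lemma dir_blockAvg (c : Pt n d) (i : Fin n) (f : TorusFun n d) :
    dir c (blockAvg i f) = blockAvg i (dir c f) :=
  blockAvg_induction i (P := fun T => ∀ f, dir c (T f) = T (dir c f)) (fun _ => rfl)
    (fun S T hS hT f => by rw [Module.End.mul_apply, Module.End.mul_apply, hS, hT])
    (fun _ f => dir_avg _ _ f) f

lemma nrmS_blockAvg_le (i : Fin n) (f : TorusFun n d) : nrmS (blockAvg i f) ≤ nrmS f :=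
  blockAvg_induction i (P := fun T => ∀ f, nrmS (T f) ≤ nrmS f) (fun _ => le_rfl)
    (fun _ T hS hT f => (hS (T f)).trans (hT f)) (fun _ f => nrmS_avg_le _ f) f

lemma tint_blockAvg (i : Fin n) (f : TorusFun n d) : tint (blockAvg i f) = tint f :=
  blockAvg_induction i (P := fun T => ∀ f, tint (T f) = tint f) (fun _ => rfl)
    (fun _ T hS hT f => (hS (T f)).trans (hT f)) (fun _ f => tint_avg _ f) f

lemma pd_blockAvg_self (i : Fin n) (a : Fin d) (f : TorusFun n d) :
    pd (i, a) (blockAvg i f) = 0 := by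
  have h : ∀ L : List (Fin d), a ∈ L → ∀ f : TorusFun n d,
      pd (i, a) ((L.map fun a => avg (unitVec (i, a))).prod f) = 0 := fun L => by
    induction L with
    | nil => simp
    | cons c L ih =>
      intro hL f
      rw [List.map_cons, List.prod_cons, Module.End.mul_apply]
      by_cases hc : a = c
      · subst hc; exact pd_avg_self _ _
      · rw [dir_avg, ih (by simpa [hc] using hL), map_zero]
  exact h _ (List.mem_finRange a) f

/-- Poincaré's inequality in the variable `y_i`, in the sup norm. -/
lemma nrmS_sub_blockAvg_le (i : Fin n) (f : TorusFun n d) :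
    nrmS (f - blockAvg i f) ≤ ∑ a, nrmS (pd (i, a) f) := by
  have h : ∀ L : List (Fin d), ∀ f : TorusFun n d,
      nrmS (f - (L.map fun a => avg (unitVec (i, a))).prod f)
        ≤ (L.map fun a => nrmS (pd (i, a) f)).sum := fun L => by
    induction L with
    | nil => intro f; simp
    | cons c L ih =>
      intro f
      rw [List.map_cons, List.prod_cons, Module.End.mul_apply, List.map_cons, List.sum_cons]
      set T := (L.map fun a => avg (n := n) (d := d) (unitVec (i, a))).prod
      have e : f - avg (unitVec (i, c)) (T f)
          = (f - avg (unitVec (i, c)) f) + avg (unitVec (i, c)) (f - T f) := by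
        rw [map_sub]; abel
      rw [e]
      exact (map_add_le_add _ _ _).trans (add_le_add (nrmS_sub_avg_le _ _)
        ((nrmS_avg_le _ _).trans (ih f)))
  rw [← List.sum_ofFn, List.ofFn_eq_map]
  exact h _ f

lemma DN_nrmS_blockAvg_le (i : Fin n) (l : ℕ) (f : TorusFun n d) :
    DN nrmS l (blockAvg i f) ≤ DN nrmS l f := by
  simpa using DN_comm_le (c := 1) (T := blockAvg i) (fun p f => dir_blockAvg _ i f)
    (fun f => by simpa using nrmS_blockAvg_le i f) l f

lemma DN_nrmS_sub_blockAvg_le (i : Fin n) (l : ℕ) (f : TorusFun n d) :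
    DN nrmS l (f - blockAvg i f) ≤ ∑ a, DN nrmS l (pd (i, a) f) := by
  induction l generalizing f with
  | zero => exact nrmS_sub_blockAvg_le i f
  | succ l ih =>
    simp only [DN_succ, map_sub, dir_blockAvg]
    refine (Finset.sum_le_sum fun p _ => ih (pd p f)).trans (le_of_eq ?_)
    rw [Finset.sum_comm]
    exact Finset.sum_congr rfl fun a _ => Finset.sum_congr rfl fun p _ => by rw [dir_comm]

/-! ### The sup bound through the hierarchy of scales -/

/-- The vector `b_a` with `∇̂_a = b_a · ∇`. -/
def hatVec (δ : Fin n → ℝ) (a : Fin d) : Pt n d := fun i => Pi.single a (δ i)⁻¹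

lemma dir_hatVec (δ : Fin n → ℝ) (a : Fin d) (f : TorusFun n d) :
    dir (hatVec δ a) f = ∑ i, (δ i)⁻¹ • pd (i, a) f := by
  rw [dir_eq_sum, Fintype.sum_prod_type]
  refine Finset.sum_congr rfl fun i _ => ?_
  rw [Finset.sum_eq_single a]
  · simp [hatVec]
  · intro c _ hc; simp [hatVec, Pi.single_eq_of_ne hc]
  · simp

/-- The average over the last `j` of the variables `y_1, …, y_n`. -/
def avgTail : ℕ → TorusFun n d →ₗ[ℝ] TorusFun n d
  | 0 => LinearMap.id
  | j + 1 => if h : j < n then blockAvg (Fin.rev ⟨j, h⟩) ∘ₗ avgTail j else avgTail j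

lemma avgTail_succ {j : ℕ} (h : j < n) (f : TorusFun n d) :
    avgTail (j + 1) f = blockAvg (Fin.rev ⟨j, h⟩) (avgTail j f) := by
  rw [avgTail, dif_pos h]; rfl

lemma avgTail_induction {P : (TorusFun n d →ₗ[ℝ] TorusFun n d) → Prop} (h1 : P LinearMap.id)
    (hm : ∀ i T, P T → P (blockAvg i ∘ₗ T)) (j : ℕ) : P (avgTail j) := by
  induction j with
  | zero => exact h1
  | succ j ih =>
    rw [avgTail]; split_ifs
    exacts [hm _ _ ih, ih]

lemma dir_avgTail (c : Pt n d) (j : ℕ) (f : TorusFun n d) :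
    dir c (avgTail j f) = avgTail j (dir c f) :=
  avgTail_induction (P := fun T => ∀ f, dir c (T f) = T (dir c f)) (fun _ => rfl)
    (fun i T h f => by
      rw [LinearMap.comp_apply, LinearMap.comp_apply, dir_blockAvg, h]) j f

lemma DN_nrmS_avgTail_le (j l : ℕ) (f : TorusFun n d) :
    DN nrmS l (avgTail j f) ≤ DN nrmS l f :=
  avgTail_induction (P := fun T => ∀ f, DN nrmS l (T f) ≤ DN nrmS l f) (fun _ => le_rfl)
    (fun i _ h f => (DN_nrmS_blockAvg_le i l _).trans (h f)) j f

lemma tint_avgTail (j : ℕ) (f : TorusFun n d) : tint (avgTail j f) = tint f :=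
  avgTail_induction (P := fun T => ∀ f, tint (T f) = tint f) (fun _ => rfl)
    (fun i _ h f => (tint_blockAvg i _).trans (h f)) j f

/-- The average over the last `j` variables does not depend on them. -/
lemma pd_avgTail {j : ℕ} (i : Fin n) (a : Fin d) (h : n ≤ j + i) (hj : j ≤ n)
    (f : TorusFun n d) : pd (i, a) (avgTail j f) = 0 := by
  induction j with
  | zero => exact absurd i.2 (by omega)
  | succ j ih =>
    rw [avgTail_succ hj]
    by_cases hi : i = Fin.rev ⟨j, hj⟩
    · rw [← hi]; exact pd_blockAvg_self i a _
    · have : (i : ℕ) ≠ n - (j + 1) := fun e => hi (Fin.ext (by rw [Fin.val_rev]; exact e))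
      rw [dir_blockAvg, ih (by omega) (by omega), map_zero]

/-- A constant with mean zero vanishes. -/
lemma eq_zero_of_pd_eq_zero {f : TorusFun n d} (h : ∀ p, pd p f = 0) (h0 : tint f = 0) :
    f = 0 := by
  have h1 : ∀ y, f.1 y = f.1 0 := fun y => by
    have e1 : DN nrmS 1 f = 0 := by
      rw [DN_succ]; exact Finset.sum_eq_zero fun p _ => by rw [h]; exact map_zero _
    have e2 := (abs_le_nrmS _ 0).trans (nrmS_tr_sub_le y f)
    rw [e1, mul_zero] at e2
    have e3 := abs_eq_zero.1 (le_antisymm e2 (abs_nonneg _))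
    simp only [TorusFun.sub_val, tr_val, zero_add] at e3
    linarith
  have h2 : tint f = f.1 0 := by rw [tint_def]; simp only [h1]; simp
  exact TorusFun.ext fun y => by rw [h1 y, ← h2, h0]; rfl

/-- The oscillation of `Y` in its last variable `y_k` is small, because `δ_k⁻¹ ∇_k` is
`∇̂` up to derivatives with the larger scales `δ_i`, `i < k`. -/
lemma DN_nrmS_osc_le {δ : Fin n → ℝ} (hδ : ∀ i, 0 < δ i) {k : Fin n} (hk1 : δ k ≤ 1) {r : ℝ}
    (hr : 0 ≤ r) (hrk : ∀ i < k, δ k * (δ i)⁻¹ ≤ r) {Y : TorusFun n d}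
    (hY : ∀ i a, k < i → pd (i, a) Y = 0) (l : ℕ) :
    DN nrmS l (Y - blockAvg k Y) ≤
      ∑ a, DN nrmS l (dir (hatVec δ a) (Y - blockAvg k Y))
        + r * DN nrmS (l + 1) (Y - blockAvg k Y) := by
  set Z := Y - blockAvg k Y with hZ
  have hZi : ∀ i a, k < i → pd (i, a) Z = 0 := fun i a hi => by
    rw [hZ, map_sub, dir_blockAvg, hY i a hi, map_zero, sub_zero]
  have hZk : ∀ a, pd (k, a) Y = pd (k, a) Z := fun a => by
    rw [hZ, map_sub, pd_blockAvg_self, sub_zero]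
  have hterm : ∀ a, DN nrmS l (pd (k, a) Z) ≤ DN nrmS l (dir (hatVec δ a) Z)
      + r * ∑ i, DN nrmS l (pd (i, a) Z) := fun a => by
    have e : pd (k, a) Z = δ k • dir (hatVec δ a) Z
        - ∑ i ∈ Finset.univ.erase k, (δ k * (δ i)⁻¹) • pd (i, a) Z := by
      rw [dir_hatVec, ← Finset.add_sum_erase _ _ (Finset.mem_univ k), smul_add, smul_smul,
        mul_inv_cancel₀ (hδ k).ne', one_smul, Finset.smul_sum]
      simp only [smul_smul]
      abel
    rw [e]
    refine (map_sub_le_add _ _ _).trans (add_le_add ?_ ?_)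
    · rw [DN_smul, abs_of_pos (hδ k)]
      exact mul_le_of_le_one_left (DN_nonneg _ _ _) hk1
    · refine (seminorm_sum_le _ _ _).trans ?_
      rw [Finset.mul_sum]
      refine (Finset.sum_le_sum fun i hi => ?_).trans
        (Finset.sum_le_sum_of_subset_of_nonneg (Finset.subset_univ _)
          fun i _ _ => mul_nonneg hr (DN_nonneg _ _ _))
      rw [DN_smul, abs_of_pos (mul_pos (hδ k) (inv_pos.2 (hδ i)))]
      rcases lt_or_gt_of_ne (Finset.ne_of_mem_erase hi) with h | h
      · exact mul_le_mul_of_nonneg_right (hrk i h) (DN_nonneg _ _ _)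
      · rw [hZi i a h]; simp
  refine (DN_nrmS_sub_blockAvg_le k l Y).trans ?_
  simp only [hZk]
  refine (Finset.sum_le_sum fun a _ => hterm a).trans (le_of_eq ?_)
  rw [Finset.sum_add_distrib, ← Finset.mul_sum, DN_succ, Fintype.sum_prod_type, Finset.sum_comm]

lemma pow_mul_factorial_le_exp {x : ℝ} (hx : 0 < x) {j : ℕ} (hj : (j : ℝ) ≤ 1 / (Real.exp 1 * x)) :
    x ^ j * j.factorial ≤ Real.exp (-1) ^ j := by
  have h1 : (j.factorial : ℝ) ≤ (j : ℝ) ^ j := by exact_mod_cast Nat.factorial_le_pow j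
  have h2 : x * j ≤ Real.exp (-1) := by
    rw [Real.exp_neg, ← one_div]
    have := mul_le_mul_of_nonneg_left hj hx.le
    refine this.trans (le_of_eq ?_)
    field_simp
  calc x ^ j * j.factorial ≤ x ^ j * (j : ℝ) ^ j :=
        mul_le_mul_of_nonneg_left h1 (pow_nonneg hx.le j)
    _ = (x * j) ^ j := (mul_pow _ _ _).symm
    _ ≤ _ := pow_le_pow_left₀ (by positivity) h2 j

/-- Iterating `m_l ≤ g_l + r m_{l+1}` about `1 / (e r Λ)` times gains a factor exponentially small
in `1 / r`, which compensates the large factor `T` in the bound for `m`. -/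
lemma iterate_bound {m g : ℕ → ℝ} {r Lam K T T0 : ℝ} (hr : 0 ≤ r) (hLam : 0 < Lam) (hK : 0 ≤ K)
    (hT0 : 0 ≤ T0) (hrec : ∀ l, m l ≤ g l + r * m (l + 1))
    (hg : ∀ l, g l ≤ K * Lam ^ l * l.factorial) (hm : ∀ l, m l ≤ K * T * Lam ^ l * l.factorial)
    (hT : 0 < r → T ≤ T0 * Real.exp (1 / (Real.exp 1 * Lam * r))) :
    m 0 ≤ K * (2 + Real.exp 1 * T0) := by
  have he : 0 < Real.exp 1 := Real.exp_pos 1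
  rcases hr.eq_or_lt with h0 | h0
  · have h1 := (hrec 0).trans_eq (by rw [← h0, zero_mul, add_zero])
    have h2 := hg 0
    simp only [pow_zero, mul_one, Nat.factorial_zero, Nat.cast_one] at h2
    nlinarith [mul_nonneg hK (mul_nonneg he.le hT0)]
  · set x : ℝ := Lam * r with hx
    have hx0 : 0 < x := mul_pos hLam h0
    -- the number of steps that minimizes `(x * k) ^ k`, a bound for `x ^ k * k!`
    set k : ℕ := ⌊1 / (Real.exp 1 * x)⌋₊ with hk
    have hk1 : (k : ℝ) ≤ 1 / (Real.exp 1 * x) := Nat.floor_le (by positivity)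
    have hk2 : 1 / (Real.exp 1 * x) - 1 < k := by
      have := Nat.lt_floor_add_one (1 / (Real.exp 1 * x)); linarith
    have hiter : ∀ k : ℕ, m 0 ≤ ∑ j ∈ Finset.range k, r ^ j * g j + r ^ k * m k := fun k => by
      induction k with
      | zero => simp
      | succ k ih =>
        rw [Finset.sum_range_succ, pow_succ]
        have := mul_le_mul_of_nonneg_left (hrec k) (pow_nonneg hr k)
        linarith
    have hq : Real.exp (-1) ≤ 1 / 2 := by
      rw [Real.exp_neg, ← one_div]
      exact one_div_le_one_div_of_le two_pos Real.exp_one_gt_two.le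
    have h1 : ∑ j ∈ Finset.range k, r ^ j * g j ≤ K * 2 := by
      have : ∀ j ∈ Finset.range k, r ^ j * g j ≤ K * (1 / 2) ^ j := fun j hj => by
        have hjk : (j : ℝ) ≤ 1 / (Real.exp 1 * x) :=
          le_trans (by exact_mod_cast (Finset.mem_range.1 hj).le) hk1
        have e1 := mul_le_mul_of_nonneg_left (hg j) (pow_nonneg hr j)
        have e2 := (pow_mul_factorial_le_exp hx0 hjk).trans
          (pow_le_pow_left₀ (Real.exp_pos _).le hq j)
        refine e1.trans (le_trans (le_of_eq ?_) (mul_le_mul_of_nonneg_left e2 hK))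
        rw [hx, mul_pow]; ring
      refine (Finset.sum_le_sum this).trans ?_
      rw [← Finset.mul_sum]
      exact mul_le_mul_of_nonneg_left (sum_geometric_two_le k) hK
    have h2 : r ^ k * m k ≤ K * (Real.exp 1 * T0) := by
      have e1 := mul_le_mul_of_nonneg_left (hm k) (pow_nonneg hr k)
      have e2 := pow_mul_factorial_le_exp hx0 hk1
      have e3 : x ^ k * k.factorial * T ≤ Real.exp 1 * T0 := by
        have hT' := hT h0
        have e4 : Real.exp (-1) ^ k ≤ Real.exp 1 * Real.exp (-(1 / (Real.exp 1 * x))) := by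
          rw [← Real.exp_nat_mul, ← Real.exp_add]
          exact Real.exp_le_exp.2 (by linarith)
        have e5 : Real.exp 1 * Lam * r = Real.exp 1 * x := by rw [hx]; ring
        rw [e5] at hT'
        have hxk : 0 ≤ x ^ k * k.factorial := by positivity
        calc x ^ k * k.factorial * T
            ≤ x ^ k * k.factorial * (T0 * Real.exp (1 / (Real.exp 1 * x))) :=
              mul_le_mul_of_nonneg_left hT' hxk
          _ ≤ Real.exp 1 * Real.exp (-(1 / (Real.exp 1 * x)))
                * (T0 * Real.exp (1 / (Real.exp 1 * x))) :=
              mul_le_mul_of_nonneg_right (e2.trans e4)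
                (mul_nonneg hT0 (Real.exp_pos _).le)
          _ = Real.exp 1 * T0 * (Real.exp (-(1 / (Real.exp 1 * x)))
                * Real.exp (1 / (Real.exp 1 * x))) := by ring
          _ = Real.exp 1 * T0 := by rw [← Real.exp_add]; simp
      refine e1.trans (le_trans (le_of_eq ?_) (mul_le_mul_of_nonneg_left e3 hK))
      rw [hx, mul_pow]; ring
    have := hiter k
    linarith

/-- The sup bound for a mean zero function in terms of the analytic size of `∇̂ u` and the
analytic size of `u`, the latter allowed to be exponentially large in the ratios of scales. -/
lemma nrmS_le_of_hierarchy {δ : Fin n → ℝ} (hδ : ∀ i, 0 < δ i) (hδ1 : ∀ i, δ i ≤ 1)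
    {r : Fin n → ℝ} (hr : ∀ k, 0 ≤ r k) (hrk : ∀ k, ∀ i < k, δ k * (δ i)⁻¹ ≤ r k)
    {Lam K T T0 : ℝ} (hLam : 0 < Lam) (hK : 0 ≤ K) (hT0 : 0 ≤ T0)
    (hT : ∀ k, 0 < r k → T ≤ T0 * Real.exp (1 / (Real.exp 1 * Lam * r k)))
    {u : TorusFun n d} (h0 : tint u = 0)
    (hg : ∀ l, ∑ a, DN nrmS l (dir (hatVec δ a) u) ≤ K * Lam ^ l * l.factorial)
    (hu : ∀ l, DN nrmS l u ≤ K * T * Lam ^ l * l.factorial) :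
    nrmS u ≤ n * (2 * K * (2 + Real.exp 1 * T0)) := by
  have hstep : ∀ j (hj : j < n), nrmS (avgTail j u - avgTail (j + 1) u)
      ≤ 2 * K * (2 + Real.exp 1 * T0) := fun j hj => by
    set k := Fin.rev ⟨j, hj⟩ with hk
    have hkv : (k : ℕ) = n - (j + 1) := by rw [hk, Fin.val_rev]
    have e : avgTail (j + 1) u = blockAvg k (avgTail j u) := avgTail_succ hj u
    have hsub : ∀ l (f : TorusFun n d), DN nrmS l (avgTail j f - blockAvg k (avgTail j f))
        ≤ 2 * DN nrmS l f := fun l f => by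
      refine (map_sub_le_add _ _ _).trans ?_
      have h1 := DN_nrmS_avgTail_le j l f
      have h2 := DN_nrmS_blockAvg_le k l (avgTail j f)
      linarith
    rw [e]
    refine iterate_bound (m := fun l => DN nrmS l (avgTail j u - blockAvg k (avgTail j u)))
      (g := fun l => ∑ a, DN nrmS l (dir (hatVec δ a) (avgTail j u - blockAvg k (avgTail j u))))
      (r := r k) (T := T) (hr k) hLam (by positivity) hT0
      (fun l => DN_nrmS_osc_le hδ (hδ1 k) (hr k) (hrk k) (fun i a hi => ?_) l)
      (fun l => ?_) (fun l => ?_) (hT k)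
    · refine pd_avgTail i a ?_ hj.le u
      have : (k : ℕ) < i := hi
      omega
    · simp only [map_sub, dir_blockAvg, dir_avgTail]
      refine (Finset.sum_le_sum fun a _ => hsub l (dir (hatVec δ a) u)).trans ?_
      rw [← Finset.mul_sum]
      have := hg l
      linarith
    · have := hsub l u
      have := hu l
      linarith
  have hlast : avgTail n u = 0 := eq_zero_of_pd_eq_zero
    (fun p => pd_avgTail p.1 p.2 (by omega) le_rfl u) (by rw [tint_avgTail, h0])
  have htel : u = ∑ j ∈ Finset.range n, (avgTail j u - avgTail (j + 1) u) := by
    rw [Finset.sum_range_sub' (fun j => avgTail j u), hlast, sub_zero]; rfl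
  rw [htel]
  refine (seminorm_sum_le _ _ _).trans ?_
  refine (Finset.sum_le_sum fun j hj => hstep j (Finset.mem_range.1 hj)).trans (le_of_eq ?_)
  rw [Finset.sum_const, Finset.card_range, nsmul_eq_mul]

/-! ### Analytic growth under Sobolev's inequality -/

/-- The constant lost in passing from `L¹` to sup bounds for functions of analytic growth. -/
def sobConst (n d : ℕ) (Lam : ℝ) : ℝ :=
  2 ^ (n * d) * ∑ j ∈ Finset.range (n * d + 1), (2 * Lam) ^ j * j.factorial

lemma sobConst_pos (n d : ℕ) {Lam : ℝ} (h : 0 < Lam) : 0 < sobConst n d Lam :=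
  mul_pos (by positivity) (Finset.sum_pos (fun j _ => by positivity) ⟨0, by simp⟩)

/-- Sobolev's inequality preserves analytic growth: the shift by at most `n d` orders costs a factor
`2` in the radius, by `(l + j)! ≤ 2^(l + j) l! j!`. -/
lemma sobolev_growth {a b : ℕ → ℝ} {K Lam : ℝ} (hK : 0 ≤ K) (hLam : 0 < Lam) {l : ℕ}
    (hab : a l ≤ 2 ^ (n * d) * ∑ j ∈ Finset.range (n * d + 1), b (l + j))
    (hb : ∀ l, b l ≤ K * Lam ^ l * l.factorial) :
    a l ≤ K * sobConst n d Lam * (2 * Lam) ^ l * l.factorial := by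
  refine hab.trans ?_
  have h : ∀ j, b (l + j) ≤ K * (2 * Lam) ^ l * l.factorial * ((2 * Lam) ^ j * j.factorial) :=
    fun j => by
      refine (hb _).trans ?_
      have h1 : ((l + j).factorial : ℝ) ≤ 2 ^ (l + j) * (l.factorial * j.factorial) := by
        have := Nat.add_choose_mul_factorial_mul_factorial l j
        rw [← this, mul_assoc]
        push_cast
        exact mul_le_mul_of_nonneg_right (by exact_mod_cast Nat.choose_le_two_pow _ _)
          (by positivity)
      refine (mul_le_mul_of_nonneg_left h1 (by positivity)).trans (le_of_eq ?_)
      rw [mul_pow, mul_pow]; ring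
  refine (mul_le_mul_of_nonneg_left (Finset.sum_le_sum fun j _ => h j) (by positivity)).trans
    (le_of_eq ?_)
  rw [← Finset.mul_sum, sobConst]; ring

/-! ### The derivative seminorms and the norms `normD` -/

/-- `D^J f` as a smooth periodic function. -/
def DJ : {l : ℕ} → (Fin l → Fin n × Fin d) → TorusFun n d → TorusFun n d
  | 0, _, f => f
  | l + 1, J, f => DJ (Fin.init J) (pd (J (Fin.last l)) f)

/-- The iterated partial derivatives agree with the entries of the tensor `D_n^l f`. -/
lemma DJ_val {l : ℕ} (J : Fin l → Fin n × Fin d) (f : TorusFun n d) (y : Pt n d) :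
    (DJ J f).1 y = partialD J f.1 y := by
  induction l generalizing f with
  | zero => simp [DJ, partialD]
  | succ l ih =>
    rw [DJ, ih, partialD, partialD, iteratedFDeriv_succ_apply_right]
    have hc : ContDiff ℝ ∞ (fderiv ℝ f.1) := f.contDiff.fderiv_right (by simp)
    exact iteratedFDeriv_clm_apply_const_apply (hc.of_le (m := l) (by exact_mod_cast le_top)) le_rfl

lemma sum_snoc {l : ℕ} {M : Type*} [AddCommMonoid M] (F : (Fin (l + 1) → Fin n × Fin d) → M) :
    ∑ J, F J = ∑ p : Fin n × Fin d, ∑ J : Fin l → Fin n × Fin d, F (Fin.snoc J p) := by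
  rw [← Fintype.sum_prod_type' (f := fun p J => F (Fin.snoc J p))]
  exact (Fintype.sum_equiv (Fin.snocEquiv fun _ => Fin n × Fin d) _ _ fun _ => rfl).symm

lemma DN_eq_sum (ρ : Seminorm ℝ (TorusFun n d)) (l : ℕ) (f : TorusFun n d) :
    DN ρ l f = ∑ J : Fin l → Fin n × Fin d, ρ (DJ J f) := by
  induction l generalizing f with
  | zero => simp [DJ]
  | succ l ih =>
    rw [DN_succ, sum_snoc]
    refine Finset.sum_congr rfl fun p _ => ?_
    rw [ih]
    refine Finset.sum_congr rfl fun J _ => ?_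
    rw [DJ, Fin.init_snoc, Fin.snoc_last]

/-- A periodic property which holds almost everywhere on the cell holds almost everywhere. -/
lemma ae_of_ae_cell {P : Pt n d → Prop} (hP : IsPeriodic P) (h : ∀ᵐ y ∂(cell n d), P y) :
    ∀ᵐ y ∂(volume : Measure (Pt n d)), P y := by
  have : Countable (Submodule.span ℤ (Set.range (cellBasis n d))).toAddSubgroup :=
    inferInstanceAs (Countable (Submodule.span ℤ (Set.range (cellBasis n d))))
  rw [cell_eq, ae_restrict_iff' (ZSpan.fundamentalDomain_measurableSet _)] at h
  have h1 := ZSpan.isAddFundamentalDomain' (cellBasis n d) volume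
  refine h1.measure_zero_of_invariant {y | ¬ P y} (fun g => ?_) ?_
  · ext y
    rw [Set.mem_vadd_set_iff_neg_vadd_mem, Set.mem_ofPred_eq, Set.mem_ofPred_eq,
      hP.vadd_lattice]
  · refine measure_mono_null (fun y hy => ?_) h
    exact fun hc => hy.1 (hc hy.2)

lemma eLpNorm_two_eq (f : TorusFun n d) :
    eLpNorm f.1 2 (cell n d) = ENNReal.ofReal (nrm2 f) := by
  rw [nrm2_eq, ENNReal.ofReal_toReal (f.memLp 2).2.ne]

/-- For continuous periodic functions the essential supremum over the cell is the supremum. -/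
lemma eLpNorm_top_eq (f : TorusFun n d) :
    eLpNorm f.1 ∞ (cell n d) = ENNReal.ofReal (nrmS f) := by
  refine le_antisymm ?_ ?_
  · rw [eLpNorm_exponent_top]
    exact eLpNormEssSup_le_of_ae_bound (.of_forall fun y => abs_le_nrmS f y)
  · have hfin : eLpNorm f.1 ∞ (cell n d) ≠ ⊤ := (f.memLp ∞).2.ne
    rw [← ENNReal.ofReal_toReal hfin]
    refine ENNReal.ofReal_le_ofReal (nrmS_le fun y => ?_)
    set C := (eLpNorm f.1 ∞ (cell n d)).toReal with hC
    have h1 : ∀ᵐ y ∂(cell n d), |f.1 y| ≤ C := by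
      filter_upwards [ae_le_eLpNormEssSup (f := f.1) (μ := cell n d)] with y hy
      rw [← eLpNorm_exponent_top] at hy
      have := ENNReal.toReal_mono hfin hy
      simpa [hC] using this
    have h2 := ae_of_ae_cell (P := fun y => |f.1 y| ≤ C)
      (fun y z => by simp only [f.periodic y z]) h1
    have h3 : IsOpen {y : Pt n d | ¬ |f.1 y| ≤ C} := by
      simp only [not_le]
      exact isOpen_lt continuous_const f.continuous.abs
    have h4 := h3.measure_eq_zero_iff (μ := (volume : Measure (Pt n d))).1 h2
    by_contra hy
    exact (Set.eq_empty_iff_forall_notMem.1 h4 y) hy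

lemma normD_eq {p : ℝ≥0∞} {ρ : Seminorm ℝ (TorusFun n d)}
    (h : ∀ f : TorusFun n d, eLpNorm f.1 p (cell n d) = ENNReal.ofReal (ρ f)) (l : ℕ)
    (f : TorusFun n d) : normD p l f.1 = ENNReal.ofReal (DN ρ l f) := by
  rw [DN_eq_sum, ENNReal.ofReal_sum_of_nonneg fun _ _ => apply_nonneg _ _, normD]
  refine Finset.sum_congr rfl fun J _ => ?_
  rw [← h]
  congr 1
  exact funext fun y => (DJ_val J f y).symm

lemma normD_two (l : ℕ) (f : TorusFun n d) :
    normD 2 l f.1 = ENNReal.ofReal (DN nrm2 l f) := normD_eq eLpNorm_two_eq l f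

lemma normD_top (l : ℕ) (f : TorusFun n d) :
    normD ∞ l f.1 = ENNReal.ofReal (DN nrmS l f) := normD_eq eLpNorm_top_eq l f

/-- Pointwise bounds on a sum of derivative tensors bound the corresponding `L¹` norms. -/
lemma sum_DN_nrm1_le {α : Type*} (s : Finset α) (f : α → TorusFun n d) (l : ℕ) {C : ℝ}
    (h : ∀ y, ∑ x ∈ s, ∑ J : Fin l → Fin n × Fin d, |partialD J (f x).1 y| ≤ C) :
    ∑ x ∈ s, DN nrm1 l (f x) ≤ C := by
  have e : ∑ x ∈ s, DN nrm1 l (f x)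
      = ∫ y, ∑ x ∈ s, ∑ J : Fin l → Fin n × Fin d, |(DJ J (f x)).1 y| ∂(cell n d) := by
    rw [integral_finsetSum _ fun x _ => integrable_finsetSum _ fun J _ =>
      (DJ J (f x)).integrable.abs]
    refine Finset.sum_congr rfl fun x _ => ?_
    rw [DN_eq_sum, integral_finsetSum _ fun J _ => (DJ J (f x)).integrable.abs]
    rfl
  rw [e]
  simp only [DJ_val]
  have h2 := integral_mono_of_nonneg (μ := cell n d) (.of_forall fun y =>
    Finset.sum_nonneg fun x _ => Finset.sum_nonneg fun J _ => abs_nonneg (partialD J (f x).1 y))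
    (integrable_const C) (.of_forall h)
  simpa using h2

/-! ### The weak formulation on the torus -/

lemma hatGrad_eq (δ : Fin n → ℝ) (f : TorusFun n d) (y : Pt n d) (a : Fin d) :
    hatGrad δ f.1 y a = (dir (hatVec δ a) f).1 y := by
  rw [dir_hatVec]
  simp only [TorusFun.sum_val, TorusFun.smul_val]; rfl

/-- A smooth periodic matrix field as a matrix of smooth periodic functions. -/
def matFun (A : Pt n d → Matrix (Fin d) (Fin d) ℝ) (hs : IsSmoothMat A) (hp : IsPeriodic A) :
    Fin d → Fin d → TorusFun n d :=
  fun a b => ⟨fun y => A y a b, hs a b, fun y z => by simp only [hp y z]⟩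

lemma coercive_matFun {lam : ℝ} {A : Pt n d → Matrix (Fin d) (Fin d) ℝ} (hA : IsElliptic lam A)
    (hs : IsSmoothMat A) (hp : IsPeriodic A) : Coercive lam (matFun A hs hp) := fun y ξ => by
  have h := (hA y ξ).1
  simp only [dotProduct, Matrix.mulVec, ← sq] at h
  exact h

lemma Coercive.transpose {lam : ℝ} {A : Fin d → Fin d → TorusFun n d} (hA : Coercive lam A) :
    Coercive lam fun a b => A b a := fun y ξ => by
  refine (hA y ξ).trans (le_of_eq ?_)
  simp only [Finset.mul_sum]
  rw [Finset.sum_comm]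
  exact Finset.sum_congr rfl fun a _ => Finset.sum_congr rfl fun b _ => by ring

/-- The flux `A v`. -/
def fluxOf (A : Fin d → Fin d → TorusFun n d) (v : Fin d → ℝ) (a : Fin d) : TorusFun n d :=
  ∑ b, v b • A a b

lemma fluxOf_val (A : Pt n d → Matrix (Fin d) (Fin d) ℝ) (hs : IsSmoothMat A) (hp : IsPeriodic A)
    (v : Fin d → ℝ) (a : Fin d) (y : Pt n d) :
    (fluxOf (matFun A hs hp) v a).1 y = (A y *ᵥ v) a := by
  simp only [fluxOf, TorusFun.sum_val, TorusFun.smul_val, Matrix.mulVec, dotProduct]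
  exact Finset.sum_congr rfl fun b _ => mul_comm _ _

/-- Smooth solutions of the tested equation are weak solutions. -/
lemma isWeakSolution_of_weakEq {δ : Fin n → ℝ} {τ : ℝ} {A : Pt n d → Matrix (Fin d) (Fin d) ℝ}
    (hs : IsSmoothMat A) (hp : IsPeriodic A) {v : Fin d → ℝ} {u : TorusFun n d}
    (h : WeakEq (dirGrad (hatVec δ)) τ (matFun A hs hp) (fluxOf (matFun A hs hp) v) 0 u) :
    IsWeakSolution δ τ A (fun y => A y *ᵥ v) u.1 := by
  refine ⟨u.periodic, u.memLp 2, fun y a => (dir (hatVec δ a) u).1 y, fun y z => ?_,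
    fun a => (dir (hatVec δ a) u).memLp 2, fun φ hφ a => ?_, fun φ hφ => ?_⟩
  · funext a; exact (dir (hatVec δ a) u).periodic y z
  · have h1 := tint_dir_mul (hatVec δ a) u ⟨φ, hφ⟩
    have h2 : ∀ y, hatGrad δ φ y a = (dir (hatVec δ a) ⟨φ, hφ⟩).1 y := fun y =>
      hatGrad_eq δ ⟨φ, hφ⟩ y a
    simp only [h2]
    rw [eq_neg_iff_add_eq_zero, add_comm, ← eq_neg_iff_add_eq_zero]
    exact h1
  · have h1 := h ⟨φ, hφ⟩
    rw [zero_mul, map_zero] at h1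
    have h2 : ∀ y, hatGrad δ φ y = fun a => (dir (hatVec δ a) ⟨φ, hφ⟩).1 y := fun y =>
      funext fun a => hatGrad_eq δ ⟨φ, hφ⟩ y a
    have e1 : (∫ y, ((A y *ᵥ fun a => (dir (hatVec δ a) u).1 y) ⬝ᵥ hatGrad δ φ y
        + τ ^ 2 * u.1 y * φ y) ∂(cell n d))
        = tint (∑ a, (∑ b, matFun A hs hp a b * dir (hatVec δ b) u) * dir (hatVec δ a) ⟨φ, hφ⟩
          + τ ^ 2 • (u * ⟨φ, hφ⟩)) := by
      rw [tint_def]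
      refine integral_congr_ae (.of_forall fun y => ?_)
      simp only [h2, TorusFun.add_val, TorusFun.sum_val, TorusFun.mul_val, TorusFun.smul_val,
        Matrix.mulVec, dotProduct, matFun]
      ring
    have e2 : (∫ y, (A y *ᵥ v) ⬝ᵥ hatGrad δ φ y ∂(cell n d))
        = tint (∑ a, fluxOf (matFun A hs hp) v a * dir (hatVec δ a) ⟨φ, hφ⟩) := by
      rw [tint_def]
      refine integral_congr_ae (.of_forall fun y => ?_)
      simp only [h2, TorusFun.sum_val, TorusFun.mul_val, fluxOf_val]
      rfl
    rw [e1, e2, eq_neg_iff_add_eq_zero, map_add, map_sum, map_sum, map_smul, smul_eq_mul,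
      add_right_comm, ← Finset.sum_add_distrib, ← h1]
    simp only [add_mul, map_add, dirGrad]

/-! ### Uniqueness by duality -/

lemma integrable_mul_torusFun {w : Pt n d → ℝ} (hw : Integrable w (cell n d)) (f : TorusFun n d) :
    Integrable (fun y => w y * f.1 y) (cell n d) := by
  obtain ⟨C, hC⟩ := f.exists_bound
  exact hw.mul_bdd (c := C) f.continuous.aestronglyMeasurable (.of_forall hC)

/-- Testing a weak solution with the solution `φ` of the adjoint problem with right hand side `ψ`
determines its integral against `ψ`. -/
lemma integral_mul_of_isWeakSolution {δ : Fin n → ℝ} {τ : ℝ}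
    {A : Pt n d → Matrix (Fin d) (Fin d) ℝ} (hs : IsSmoothMat A) (hp : IsPeriodic A)
    {F : Pt n d → Fin d → ℝ} {Z : Pt n d → ℝ} (hZ : IsWeakSolution δ τ A F Z)
    {ψ φ : TorusFun n d} (h : τ ^ 2 • φ - ∑ a, dir (hatVec δ a)
      (∑ c, matFun A hs hp c a * dir (hatVec δ c) φ) = ψ) :
    ∫ y, Z y * ψ.1 y ∂(cell n d) = - ∫ y, F y ⬝ᵥ hatGrad δ φ.1 y ∂(cell n d) := by
  obtain ⟨-, hZ2, g, -, hg2, hg, heq⟩ := hZ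
  have hZi : Integrable Z (cell n d) := hZ2.integrable (by norm_num)
  have hgi : ∀ a, Integrable (fun y => g y a) (cell n d) := fun a =>
    (hg2 a).integrable (by norm_num)
  rw [← heq φ.1 φ.isTest]
  set Φ : Fin d → TorusFun n d := fun a => ∑ c, matFun A hs hp c a * dir (hatVec δ c) φ with hΦ
  have e1 : ∀ y, Z y * ψ.1 y = τ ^ 2 * (Z y * φ.1 y)
      - ∑ a, Z y * (dir (hatVec δ a) (Φ a)).1 y := fun y => by
    rw [← h]
    simp only [TorusFun.sub_val, TorusFun.sum_val, TorusFun.smul_val, mul_sub, Finset.mul_sum]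
    ring
  have e2 : ∀ a, ∫ y, Z y * (dir (hatVec δ a) (Φ a)).1 y ∂(cell n d)
      = - ∫ y, g y a * (Φ a).1 y ∂(cell n d) := fun a => by
    rw [← hg (Φ a).1 (Φ a).isTest a]
    simp only [hatGrad_eq]
  have e3 : ∀ y, (A y *ᵥ g y) ⬝ᵥ hatGrad δ φ.1 y + τ ^ 2 * Z y * φ.1 y
      = τ ^ 2 * (Z y * φ.1 y) + ∑ a, g y a * (Φ a).1 y := fun y => by
    have : (A y *ᵥ g y) ⬝ᵥ hatGrad δ φ.1 y = ∑ a, g y a * (Φ a).1 y := by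
      simp only [hΦ, TorusFun.sum_val, TorusFun.mul_val, Matrix.mulVec, dotProduct, Finset.mul_sum,
        Finset.sum_mul, hatGrad_eq]
      rw [Finset.sum_comm]
      exact Finset.sum_congr rfl fun a _ => Finset.sum_congr rfl fun b _ => by
        simp only [matFun]; ring
    rw [this]; ring
  simp only [e1, e3]
  rw [integral_sub ((integrable_mul_torusFun hZi φ).const_mul _)
    (integrable_finsetSum _ fun a _ => integrable_mul_torusFun hZi _),
    integral_add ((integrable_mul_torusFun hZi φ).const_mul _)
    (integrable_finsetSum _ fun a _ => integrable_mul_torusFun (hgi a) _),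
    integral_finsetSum _ fun a _ => integrable_mul_torusFun hZi _,
    integral_finsetSum _ fun a _ => integrable_mul_torusFun (hgi a) _]
  simp only [e2]
  rw [Finset.sum_neg_distrib, sub_neg_eq_add]

/-- The open unit cube. -/
def openCell (n d : ℕ) : Set (Pt n d) :=
  Set.pi Set.univ fun _ => Set.pi Set.univ fun _ => Set.Ioo (0 : ℝ) 1

lemma isOpen_openCell : IsOpen (openCell n d) :=
  isOpen_set_pi Set.finite_univ fun _ _ => isOpen_set_pi Set.finite_univ fun _ _ => isOpen_Ioo

lemma mem_openCell {y : Pt n d} : y ∈ openCell n d ↔ ∀ i a, 0 < y i a ∧ y i a < 1 := by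
  simp [openCell]

lemma openCell_subset : openCell n d ⊆ ZSpan.fundamentalDomain (cellBasis n d) := by
  rw [fundamentalDomain_eq]
  exact Set.pi_mono fun i _ => Set.pi_mono fun a _ => Set.Ioo_subset_Ico_self

lemma openCell_ae_eq : openCell n d =ᵐ[volume] ZSpan.fundamentalDomain (cellBasis n d) := by
  have h : volume (openCell n d) = 1 := by
    rw [openCell, volume_pi_pi]
    refine Finset.prod_eq_one fun i _ => ?_
    rw [volume_pi_pi]
    simp
  refine ae_eq_of_subset_of_measure_ge openCell_subset ?_
    isOpen_openCell.measurableSet.nullMeasurableSet ?_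
  · rw [h, volume_fundamentalDomain]
  · rw [volume_fundamentalDomain]; simp

/-- The periodic extension of a function given on the unit cube. -/
def perExt (g : Pt n d → ℝ) (y : Pt n d) : ℝ := g fun i a => Int.fract (y i a)

lemma eventually_fract_notMem {K : Set ℝ} (hK : IsCompact K) (hK1 : K ⊆ Set.Ioo 0 1) (m : ℤ) :
    ∀ᶠ t in nhds (m : ℝ), Int.fract t ∉ K := by
  have h0 : ∀ᶠ s in nhds (0 : ℝ), s ∉ K ∧ s < 1 :=
    Filter.Eventually.and (hK.isClosed.isOpen_compl.mem_nhds fun h => lt_irrefl _ (hK1 h).1)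
      (gt_mem_nhds one_pos)
  have h1 : ∀ᶠ s in nhds (1 : ℝ), s ∉ K ∧ 0 < s :=
    Filter.Eventually.and (hK.isClosed.isOpen_compl.mem_nhds fun h => lt_irrefl _ (hK1 h).2)
      (lt_mem_nhds one_pos)
  have t0 : Filter.Tendsto (fun t : ℝ => t - m) (nhds (m : ℝ)) (nhds 0) := by
    simpa using (continuous_sub_right (m : ℝ)).tendsto (m : ℝ)
  have t1 : Filter.Tendsto (fun t : ℝ => t - m + 1) (nhds (m : ℝ)) (nhds 1) := by
    simpa using t0.add_const 1
  filter_upwards [t0.eventually h0, t1.eventually h1] with t ht0 ht1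
  rcases le_or_gt (m : ℝ) t with h | h
  · have : Int.fract t = t - m := Int.fract_eq_iff.2 ⟨by linarith, ht0.2, m, by ring⟩
    rw [this]; exact ht0.1
  · have : Int.fract t = t - m + 1 :=
      Int.fract_eq_iff.2 ⟨ht1.2.le, by linarith, m - 1, by push_cast; ring⟩
    rw [this]; exact ht1.1

/-- The periodic extension is smooth if the function is compactly supported inside the open cell. -/
lemma isTest_perExt {g : Pt n d → ℝ} (hg : ContDiff ℝ ∞ g) (hc : HasCompactSupport g)
    (hU : tsupport g ⊆ openCell n d) : IsTest (perExt g) := by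
  refine ⟨contDiff_iff_contDiffAt.2 fun y0 => ?_, fun y z => ?_⟩
  · by_cases h : ∃ i a, Int.fract (y0 i a) = 0
    · -- near a point with an integral coordinate the extension vanishes
      obtain ⟨i, a, hia⟩ := h
      set K : Set ℝ := (fun y : Pt n d => y i a) '' tsupport g with hK
      have hKc : IsCompact K := hc.isCompact.image (by fun_prop)
      have hK1 : K ⊆ Set.Ioo 0 1 := by
        rintro _ ⟨y, hy, rfl⟩
        exact mem_openCell.1 (hU hy) i a
      have hm : ((⌊y0 i a⌋ : ℤ) : ℝ) = y0 i a := by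
        rw [Int.fract] at hia; linarith
      have hev := eventually_fract_notMem hKc hK1 ⌊y0 i a⌋
      rw [hm] at hev
      have hcont : Filter.Tendsto (fun y : Pt n d => y i a) (nhds y0) (nhds (y0 i a)) :=
        Continuous.tendsto (by fun_prop) _
      refine contDiffAt_const (c := (0 : ℝ)) |>.congr_of_eventuallyEq ?_
      filter_upwards [hcont.eventually hev] with y hy
      by_contra hne
      exact hy ⟨_, subset_tsupport g (Function.mem_support.2 hne), rfl⟩
    · push Not at h
      have hev : ∀ᶠ y : Pt n d in nhds y0, ∀ i a, ⌊y i a⌋ = ⌊y0 i a⌋ := by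
        refine Filter.eventually_all.2 fun i => Filter.eventually_all.2 fun a => ?_
        have hcont : Filter.Tendsto (fun y : Pt n d => y i a) (nhds y0) (nhds (y0 i a)) :=
          Continuous.tendsto (by fun_prop) _
        have hpos : 0 < Int.fract (y0 i a) := lt_of_le_of_ne (Int.fract_nonneg _) (h i a).symm
        rw [Int.fract] at hpos
        have e1 := lt_mem_nhds (show ((⌊y0 i a⌋ : ℤ) : ℝ) < y0 i a by linarith)
        have e2 := gt_mem_nhds (Int.lt_floor_add_one (y0 i a))
        filter_upwards [hcont.eventually e1, hcont.eventually e2] with y h1 h2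
        exact Int.floor_eq_iff.2 ⟨h1.le, h2⟩
      have : ContDiffAt ℝ ∞ (fun y : Pt n d => g fun i a => y i a - (⌊y0 i a⌋ : ℝ)) y0 :=
        (hg.comp (contDiff_pi.2 fun i => contDiff_pi.2 fun a => by fun_prop)).contDiffAt
      refine this.congr_of_eventuallyEq ?_
      filter_upwards [hev] with y hy
      simp only [perExt, Int.fract, hy]
  · simp only [perExt, Int.fract_add_intCast]

lemma perExt_eq {g : Pt n d → ℝ} {y : Pt n d}
    (hy : y ∈ ZSpan.fundamentalDomain (cellBasis n d)) : perExt g y = g y := by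
  rw [fundamentalDomain_eq] at hy
  refine congrArg g (funext fun i => funext fun a => ?_)
  have := hy i trivial a trivial
  exact Int.fract_eq_self.2 ⟨this.1, this.2⟩

/-- A function orthogonal to all smooth periodic functions vanishes. -/
lemma ae_eq_zero_of_forall_integral_mul {w : Pt n d → ℝ} (hw : Integrable w (cell n d))
    (hp : IsPeriodic w) (h : ∀ ψ : TorusFun n d, ∫ y, w y * ψ.1 y ∂(cell n d) = 0) :
    w =ᵐ[volume] 0 := by
  refine ae_of_ae_cell (P := fun y => w y = (0 : Pt n d → ℝ) y)
    (fun y z => by simp only [hp y z]; rfl) ?_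
  have hcell : cell n d = volume.restrict (openCell n d) := by
    rw [cell_eq]; exact (Measure.restrict_congr_set openCell_ae_eq).symm
  have hloc : LocallyIntegrableOn w (openCell n d) volume := by
    rw [hcell] at hw
    exact IntegrableOn.locallyIntegrableOn hw
  have key := isOpen_openCell.ae_eq_zero_of_integral_contDiff_smul_eq_zero hloc
    fun g hg hgc hgU => by
      have h1 := h ⟨perExt g, isTest_perExt hg hgc hgU⟩
      rw [← setIntegral_eq_integral_of_forall_compl_eq_zero (s := openCell n d)
        (fun y hy => by
          have : g y = 0 := image_eq_zero_of_notMem_tsupport fun hc => hy (hgU hc)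
          rw [this, zero_smul])]
      rw [← h1, hcell]
      refine setIntegral_congr_fun isOpen_openCell.measurableSet fun y hy => ?_
      simp only [perExt_eq (openCell_subset hy), smul_eq_mul, mul_comm]
  rw [hcell, ae_restrict_iff' isOpen_openCell.measurableSet]
  exact key

/-- Weak solutions are only assumed to be in `L²`, so the energy estimate does not apply to them;
uniqueness comes from the solvability of the adjoint problem for smooth data. -/
lemma isWeakSolution_unique {δ : Fin n → ℝ} {τ lam : ℝ} (hτ : 0 < τ) (hlam : 0 < lam)
    {A : Pt n d → Matrix (Fin d) (Fin d) ℝ} (hA : IsElliptic lam A) (hs : IsSmoothMat A)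
    (hp : IsPeriodic A) {F : Pt n d → Fin d → ℝ} {Z X : Pt n d → ℝ}
    (hZ : IsWeakSolution δ τ A F Z) (hX : IsWeakSolution δ τ A F X) : Z =ᵐ[volume] X := by
  have hZi : Integrable Z (cell n d) := hZ.2.1.integrable (by norm_num)
  have hXi : Integrable X (cell n d) := hX.2.1.integrable (by norm_num)
  have h := ae_eq_zero_of_forall_integral_mul (w := fun y => Z y - X y) (hZi.sub hXi)
    (fun y z => by simp only [hZ.1 y z, hX.1 y z]) fun ψ => by
      obtain ⟨φ, hφ⟩ := exists_strong_solution hτ hlam (hatVec δ)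
        (coercive_matFun hA hs hp).transpose ψ
      simp only [sub_mul]
      rw [integral_sub (integrable_mul_torusFun hZi ψ) (integrable_mul_torusFun hXi ψ),
        integral_mul_of_isWeakSolution hs hp hZ hφ, integral_mul_of_isWeakSolution hs hp hX hφ,
        sub_self]
  filter_upwards [h] with y hy
  exact sub_eq_zero.1 hy

/-! ### Analytic bounds and sup bounds for solutions -/

/-- The energy estimate for data of analytic growth. -/
lemma WeakEq.energy_growth {G : GradOp n d} (hG : G.CommPd) {τ lam : ℝ} (hlam : 0 < lam)
    (hτ : 0 < τ) {A : Fin d → Fin d → TorusFun n d} (hA : Coercive lam A) {C0 Lam0 K Lam : ℝ}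
    (hLam0 : 0 ≤ Lam0) (hM : ∀ i, matS A i ≤ C0 * Lam0 ^ i * i.factorial) (hC0 : 0 ≤ C0)
    {F : Fin d → TorusFun n d} {u : TorusFun n d} (h : WeakEq G τ A F 0 u) (hK : 0 ≤ K)
    (hF : ∀ l, ∑ a, DN nrm2 l (F a) ≤ K * Lam ^ l * l.factorial) (hLam : 0 < Lam)
    (h1 : 2 * Lam0 ≤ Lam) (h2 : 8 * energyConst d lam * C0 * Lam0 ≤ Lam) (l : ℕ) :
    energy G τ l u ≤ 2 * energyConst d lam * K * Lam ^ l * l.factorial := by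
  refine growth_of_recursion (M := matS' A) (energyConst_pos d hlam) hK hLam0
    (fun l => energy_nonneg G hτ l u) (if_pos rfl) (fun i => ?_) h1 h2 hLam (fun l => ?_) l
  · rw [matS']; split_ifs
    exacts [by positivity, hM i]
  · have := h.energy_rec hG hlam hτ hA l
    simp only [map_zero, zero_div, add_zero] at this
    refine this.trans (mul_le_mul_of_nonneg_left ?_ (energyConst_pos d hlam).le)
    linarith [hF l]

/-- Testing the equation with the constant function `1`. -/
lemma WeakEq.tint_eq_zero {b : Fin d → Pt n d} {τ : ℝ} (hτ : 0 < τ)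
    {A : Fin d → Fin d → TorusFun n d} {F : Fin d → TorusFun n d} {u : TorusFun n d}
    (h : WeakEq (dirGrad b) τ A F 0 u) : tint u = 0 := by
  have h1 := h 1
  simp only [dirGrad, dir_one, mul_zero, map_zero, Finset.sum_const_zero, zero_add, mul_one] at h1
  exact (mul_eq_zero.1 h1).resolve_left (pow_pos hτ 2).ne'

/-- Sobolev's inequality for a finite sum. With `sum_DN_nrm1_le` it turns a bound on the supremum of
a sum of absolute values into a bound on the sum of the suprema. -/
lemma sum_DN_nrmS_le_sum {α : Type*} (s : Finset α) (l : ℕ) (f : α → TorusFun n d) :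
    ∑ x ∈ s, DN nrmS l (f x)
      ≤ 2 ^ (n * d) * ∑ j ∈ Finset.range (n * d + 1), ∑ x ∈ s, DN nrm1 (l + j) (f x) := by
  rw [Finset.sum_comm, Finset.mul_sum]
  exact Finset.sum_le_sum fun x _ => DN_nrmS_le_sum_DN_nrm1 l (f x)

/-- The constant of the sup bound in `nrmS_le_of_energy`. -/
def supConst (n d : ℕ) (Lam κ : ℝ) : ℝ := n * (2 * sobConst n d Lam * (2 + Real.exp 1 * κ))

lemma supConst_nonneg {Lam κ : ℝ} (hLam : 0 < Lam) (hκ : 0 ≤ κ) : 0 ≤ supConst n d Lam κ := by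
  have := (sobConst_pos n d hLam).le
  have := (Real.exp_pos 1).le
  rw [supConst]; positivity

lemma IsScales.pos {ε : ℕ → ℝ} (h : IsScales n ε) {i : ℕ} (h1 : 1 ≤ i) (h2 : i ≤ n) : 0 < ε i :=
  h.1 i (Finset.mem_Icc.2 ⟨h1, h2⟩)

lemma IsScales.anti {ε : ℕ → ℝ} (h : IsScales n ε) {i j : ℕ} (h1 : 1 ≤ i) (hij : i ≤ j)
    (h2 : j ≤ n) : ε j ≤ ε i := by
  induction j, hij using Nat.le_induction with
  | base => exact le_rfl
  | succ j hij ih =>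
    refine le_trans ?_ (ih (by omega))
    exact (h.2 (j + 1) (Finset.mem_Icc.2 ⟨by omega, h2⟩)).le

/-- `τ⁻¹` is at most exponential in each ratio of consecutive scales. -/
lemma inv_le_of_comparable {ε : ℕ → ℝ} {κ τ c : ℝ} (hn : 2 ≤ n) (hκ : 1 ≤ κ)
    (hτ : 0 < τ) (h : Comparable κ (τ ^ 2) (maxRate n hn c ε)) {j : ℕ} (h1 : 2 ≤ j) (h2 : j ≤ n) :
    1 / τ ≤ κ * Real.exp (c * ε (j - 1) / ε j / 2) := by
  set s := c * ε (j - 1) / ε j with hs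
  have hκ0 : 0 < κ := one_pos.trans_le hκ
  have h3 : Real.exp (-s) ≤ maxRate n hn c ε :=
    Finset.le_sup' (fun j => Real.exp (-(c * ε (j - 1) / ε j))) (Finset.mem_Icc.2 ⟨h1, h2⟩)
  have h4 : κ⁻¹ * Real.exp (-s) ≤ τ ^ 2 :=
    (mul_le_mul_of_nonneg_left h3 (inv_nonneg.2 hκ0.le)).trans h.1
  have h5 : (1 : ℝ) ≤ (τ * (κ * Real.exp (s / 2))) ^ 2 := by
    have e1 : (τ * (κ * Real.exp (s / 2))) ^ 2 = τ ^ 2 * (κ * (κ * Real.exp s)) := by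
      have : Real.exp (s / 2) ^ 2 = Real.exp s := by
        rw [← Real.exp_nat_mul]; congr 1; push_cast; ring
      rw [mul_pow, mul_pow, this]; ring
    rw [e1]
    have e2 : κ⁻¹ * Real.exp (-s) * (κ * (κ * Real.exp s)) = κ := by
      have : Real.exp (-s) * Real.exp s = 1 := by rw [← Real.exp_add]; simp
      calc κ⁻¹ * Real.exp (-s) * (κ * (κ * Real.exp s))
          = (κ⁻¹ * κ) * κ * (Real.exp (-s) * Real.exp s) := by ring
        _ = κ := by rw [this, inv_mul_cancel₀ hκ0.ne']; ring
    calc (1 : ℝ) ≤ κ := hκ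
      _ = κ⁻¹ * Real.exp (-s) * (κ * (κ * Real.exp s)) := e2.symm
      _ ≤ _ := mul_le_mul_of_nonneg_right h4 (by positivity)
  rw [div_le_iff₀ hτ, mul_comm]
  exact (abs_le_of_sq_le_sq' (by simpa using h5) (by positivity)).2

/-- A solution of analytic growth in the energy norm is bounded, uniformly in the scales and in
`τ`. -/
lemma nrmS_le_of_energy {ε : ℕ → ℝ} {κ τ Lam K : ℝ} (hn : 2 ≤ n) (hε : IsScales n ε) (hκ : 1 ≤ κ)
    (hτ : 0 < τ) (hLam : 0 < Lam)
    (hcmp : Comparable κ (τ ^ 2) (maxRate n hn (1 / (Real.exp 1 * Lam)) ε)) (hK : 0 ≤ K)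
    {u : TorusFun n d} (h0 : tint u = 0)
    (hu : ∀ l, energy (dirGrad (hatVec (ratio ε))) τ l u ≤ K * Lam ^ l * l.factorial) :
    nrmS u ≤ supConst n d Lam κ * K := by
  have hpos : ∀ i : Fin n, 0 < ε (i + 1) := fun i => hε.pos (by omega) i.2
  -- `k : Fin n` stands for `y_{k+1}`; for `k = 0` there is no larger scale and the ratio is `0`
  have h1 : 0 < ε 1 := hε.pos le_rfl (by omega)
  have hS := (sobConst_pos n d hLam).le
  have he := Real.exp_pos 1
  have key := nrmS_le_of_hierarchy (δ := ratio ε) (u := u)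
    (r := fun k => if (k : ℕ) = 0 then 0 else ε (k + 1) / ε k) (Lam := 2 * Lam)
    (K := K * sobConst n d Lam) (T := 1 / τ) (T0 := κ)
    (fun i => div_pos (hpos i) h1)
    (fun i => (div_le_one h1).2 (hε.anti le_rfl (by omega) i.2))
    (fun k => by
      split_ifs with hk
      exacts [le_rfl, (div_pos (hpos k) (hε.pos (by omega) k.2.le)).le])
    (fun k i hik => by
      have hik' : (i : ℕ) < k := hik
      have hk : (k : ℕ) ≠ 0 := by omega
      rw [if_neg hk, ratio, ratio, inv_div, div_mul_div_comm, mul_comm (ε 1),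
        mul_div_mul_right _ _ h1.ne']
      exact div_le_div_of_nonneg_left (hpos k).le (hε.pos (by omega) k.2.le)
        (hε.anti (by omega) (by omega) k.2.le))
    (by positivity) (by positivity) (by linarith)
    (fun k hr => by
      by_cases hk : (k : ℕ) = 0
      · rw [if_pos hk] at hr; exact absurd hr (lt_irrefl _)
      · rw [if_neg hk]
        have h2 := inv_le_of_comparable hn hκ hτ hcmp (j := k + 1) (by omega) k.2
        have hk0 := hε.pos (i := k) (by omega) k.2.le
        have hk1 := hpos k
        rw [Nat.add_sub_cancel] at h2
        refine h2.trans (le_of_eq ?_)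
        congr 2
        field_simp)
    h0
    (fun l => by
      refine sobolev_growth (n := n) (d := d)
        (a := fun l => ∑ a, DN nrmS l (dir (hatVec (ratio ε) a) u)) (l := l)
        (b := fun l => ∑ a, DN nrm2 l (dir (hatVec (ratio ε) a) u)) hK hLam ?_ fun l =>
          (le_add_of_nonneg_right (mul_nonneg hτ.le (DN_nonneg _ _ _))).trans (hu l)
      rw [Finset.sum_comm, Finset.mul_sum]
      exact Finset.sum_le_sum fun a _ => DN_nrmS_le_sum_DN_nrm2 l _)
    (fun l => by
      have := sobolev_growth (n := n) (d := d) (a := fun l => τ * DN nrmS l u)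
        (b := fun l => τ * DN nrm2 l u) (l := l) hK hLam (by
          rw [← Finset.mul_sum, mul_left_comm]
          exact mul_le_mul_of_nonneg_left (DN_nrmS_le_sum_DN_nrm2 l u) hτ.le)
        fun l => (DN_le_energy (dirGrad (hatVec (ratio ε))) τ l u).trans (hu l)
      have e : K * sobConst n d Lam * (1 / τ) * (2 * Lam) ^ l * l.factorial
          = (K * sobConst n d Lam * (2 * Lam) ^ l * l.factorial) / τ := by ring
      rw [e, le_div_iff₀ hτ, mul_comm]
      exact this)
  refine key.trans (le_of_eq ?_)
  rw [supConst]; ring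

lemma abs_le_one_of_dotProduct {v : Fin d → ℝ} (hv : v ⬝ᵥ v = 1) (b : Fin d) : |v b| ≤ 1 := by
  have h : v b * v b ≤ v ⬝ᵥ v :=
    Finset.single_le_sum (f := fun b => v b * v b) (fun _ _ => mul_self_nonneg _)
      (Finset.mem_univ b)
  rw [hv] at h
  exact abs_le.2 ⟨by nlinarith, by nlinarith⟩

lemma sum_DN_fluxOf_le (A : Fin d → Fin d → TorusFun n d) {v : Fin d → ℝ} (hv : v ⬝ᵥ v = 1)
    (l : ℕ) : ∑ a, DN nrm2 l (fluxOf A v a) ≤ matS A l :=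
  Finset.sum_le_sum fun a _ => (seminorm_sum_le _ _ _).trans (Finset.sum_le_sum fun b _ => by
    rw [DN_smul]
    exact (mul_le_of_le_one_left (DN_nonneg _ _ _) (abs_le_one_of_dotProduct hv b)).trans
      (DN_mono nrm2_le_nrmS l _))

/-- Without parameter the hypothesis is a bound on the sum of the sup norms: no constant is lost. -/
lemma matS_le_of_isAnalyticMat {C0 Lam0 : ℝ} (hC0 : 0 < C0) (hLam0 : 0 < Lam0)
    {A : Pt n d → Matrix (Fin d) (Fin d) ℝ} (hA : IsAnalyticMat C0 Lam0 A) (hp : IsPeriodic A)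
    (l : ℕ) : matS (matFun A hA.1 hp) l ≤ C0 * Lam0 ^ l * l.factorial := by
  have h := hA.2 l
  have e : ∑ a, ∑ b, normD ∞ l (fun y => A y a b)
      = ENNReal.ofReal (matS (matFun A hA.1 hp) l) := by
    rw [matS, ENNReal.ofReal_sum_of_nonneg fun _ _ =>
      Finset.sum_nonneg fun _ _ => DN_nonneg _ _ _]
    refine Finset.sum_congr rfl fun a _ => ?_
    rw [ENNReal.ofReal_sum_of_nonneg fun _ _ => DN_nonneg _ _ _]
    exact Finset.sum_congr rfl fun b _ => normD_top l (matFun A hA.1 hp a b)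
  rw [e] at h
  exact (ENNReal.ofReal_le_ofReal_iff (by positivity)).1 h

lemma sum_normD_hatGrad (δ : Fin n → ℝ) (u : TorusFun n d) (l : ℕ) :
    ∑ a, normD 2 l (fun y => hatGrad δ u.1 y a)
      = ENNReal.ofReal (∑ a, DN nrm2 l (dir (hatVec δ a) u)) := by
  rw [ENNReal.ofReal_sum_of_nonneg fun _ _ => DN_nonneg _ _ _]
  refine Finset.sum_congr rfl fun a _ => ?_
  rw [← normD_two]
  congr 1
  exact funext fun y => hatGrad_eq δ u y a

lemma sum_normD_eq_energy (δ : Fin n → ℝ) {τ : ℝ} (hτ : 0 < τ) (u : TorusFun n d) (l : ℕ) :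
    ∑ a, normD 2 l (fun y => hatGrad δ u.1 y a) + ENNReal.ofReal τ * normD 2 l u.1
      = ENNReal.ofReal (energy (dirGrad (hatVec δ)) τ l u) := by
  rw [sum_normD_hatGrad, normD_two, ← ENNReal.ofReal_mul hτ.le, ← ENNReal.ofReal_add
    (Finset.sum_nonneg fun _ _ => DN_nonneg _ _ _) (mul_nonneg hτ.le (DN_nonneg _ _ _))]
  rfl

/-- The factor by which `Λ` grows from the coefficients to the solution. -/
def growthConst (d : ℕ) (lam C0 : ℝ) : ℝ := 2 + 8 * energyConst d lam * C0

lemma growthConst_pos {lam C0 : ℝ} (hlam : 0 < lam) (hC0 : 0 ≤ C0) : 0 < growthConst d lam C0 := by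
  have := (energyConst_pos d hlam).le
  rw [growthConst]; positivity

lemma two_mul_le_growthConst {lam C0 Lam0 : ℝ} (hlam : 0 < lam) (hC0 : 0 ≤ C0) (hLam0 : 0 ≤ Lam0) :
    2 * Lam0 ≤ growthConst d lam C0 * Lam0 ∧
      8 * energyConst d lam * C0 * Lam0 ≤ growthConst d lam C0 * Lam0 := by
  have h := (energyConst_pos d hlam).le
  have h1 : 0 ≤ 8 * energyConst d lam * C0 := by positivity
  refine ⟨mul_le_mul_of_nonneg_right ?_ hLam0, mul_le_mul_of_nonneg_right ?_ hLam0⟩ <;>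
    rw [growthConst] <;> linarith

/-- The analytic bound for the corrector. -/
lemma energy_corrector_le {τ lam C0 Lam0 : ℝ} (hlam : 0 < lam) (hC0 : 0 < C0) (hLam0 : 0 < Lam0)
    (hτ : 0 < τ) {b : Fin d → Pt n d} {A : Fin d → Fin d → TorusFun n d} (hA : Coercive lam A)
    (hM : ∀ i, matS A i ≤ C0 * Lam0 ^ i * i.factorial) {v : Fin d → ℝ} (hv : v ⬝ᵥ v = 1)
    {u : TorusFun n d} (h : WeakEq (dirGrad b) τ A (fluxOf A v) 0 u) (l : ℕ) :
    energy (dirGrad b) τ l u ≤ 2 * energyConst d lam * C0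
      * (growthConst d lam C0 * Lam0) ^ l * l.factorial := by
  have hB := two_mul_le_growthConst (d := d) hlam hC0.le hLam0.le
  refine h.energy_growth (dirGrad_commPd b) hlam hτ hA hLam0.le hM hC0.le hC0.le (fun l => ?_)
    (mul_pos (growthConst_pos hlam hC0.le) hLam0) hB.1 hB.2 l
  refine (sum_DN_fluxOf_le A hv l).trans ((hM l).trans ?_)
  have : Lam0 ≤ growthConst d lam C0 * Lam0 := by linarith [hB.1]
  gcongr

/-! ### Families of smooth functions depending on a parameter -/

lemma BddSmooth.sub {ι : Type*} {U V : ι → TorusFun n d} (hU : BddSmooth U) (hV : BddSmooth V) :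
    BddSmooth fun i => U i - V i := fun l => by
  obtain ⟨C, hC⟩ := hU l
  obtain ⟨C', hC'⟩ := hV l
  exact ⟨C + C', fun i => (map_sub_le_add _ _ _).trans (add_le_add (hC i) (hC' i))⟩

lemma BddSmooth.add {ι : Type*} {U V : ι → TorusFun n d} (hU : BddSmooth U) (hV : BddSmooth V) :
    BddSmooth fun i => U i + V i := fun l => by
  obtain ⟨C, hC⟩ := hU l
  obtain ⟨C', hC'⟩ := hV l
  exact ⟨C + C', fun i => (map_add_le_add _ _ _).trans (add_le_add (hC i) (hC' i))⟩

lemma BddSmooth.const {ι : Type*} (f : TorusFun n d) : BddSmooth fun _ : ι => f :=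
  fun _ => ⟨_, fun _ => le_rfl⟩

lemma BddSmooth.comp {ι κ : Type*} {U : ι → TorusFun n d} (hU : BddSmooth U) (φ : κ → ι) :
    BddSmooth fun k => U (φ k) := fun l => (hU l).imp fun _ hC k => hC (φ k)

lemma BddSmooth.mul {ι : Type*} {U V : ι → TorusFun n d} (hU : BddSmooth U) (hV : BddSmooth V) :
    BddSmooth fun i => U i * V i := fun l => by
  choose C hC using hU
  choose C' hC' using hV
  exact ⟨bconv l (fun i => |C i|) C', fun i => (DN_mul_le nrmS_mul l _ _).trans
    (bconv_mono (fun k => (hC k i).trans (le_abs_self _)) (fun k _ => hC' k i)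
      (fun _ => abs_nonneg _) fun _ => DN_nonneg _ _ _)⟩

lemma BddSmooth.smul {ι : Type*} {U : ι → TorusFun n d} (hU : BddSmooth U) {r : ι → ℝ}
    (hr : ∀ i, |r i| ≤ 1) : BddSmooth fun i => r i • U i := fun l => by
  obtain ⟨C, hC⟩ := hU l
  refine ⟨C, fun i => ?_⟩
  rw [DN_smul]
  exact (mul_le_of_le_one_left (DN_nonneg _ _ _) (hr i)).trans (hC i)

lemma BddSmooth.of_nrm2 {ι : Type*} {U : ι → TorusFun n d}
    (h : ∀ l, ∃ C, ∀ i, DN nrm2 l (U i) ≤ C) : BddSmooth U := fun l => by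
  choose C hC using h
  exact ⟨2 ^ (n * d) * ∑ j ∈ Finset.range (n * d + 1), C (l + j), fun i =>
    (DN_nrmS_le_sum_DN_nrm2 l _).trans (mul_le_mul_of_nonneg_left
      (Finset.sum_le_sum fun j _ => hC _ i) (by positivity))⟩

/-- Interpolation between a norm of `f` and the second derivatives of `f`. -/
lemma mul_nrm2_dir_le (b : Pt n d) {s : ℝ} (hs : 0 < s) (f : TorusFun n d) :
    s * nrm2 (dir b f) ≤ 2 * nrm2 f + s ^ 2 * (‖b‖ ^ 2 * DN nrmS 2 f) := by
  have e : s • dir b f = (tr (s • b) f - f) - (tr (s • b) f - f - dir (s • b) f) := by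
    rw [dir_smul]; abel
  have h1 : s * nrm2 (dir b f) = nrm2 (s • dir b f) := by
    rw [map_smul_eq_mul, Real.norm_of_nonneg hs.le]
  have h2 : nrm2 (tr (s • b) f - f) ≤ 2 * nrm2 f := by
    refine (map_sub_le_add _ _ _).trans ?_
    rw [nrm2_tr]; linarith
  have h3 : nrm2 (tr (s • b) f - f - dir (s • b) f) ≤ s ^ 2 * (‖b‖ ^ 2 * DN nrmS 2 f) := by
    refine (nrm2_le_nrmS _).trans ((nrmS_tr_sub_sub_dir_le _ _).trans (le_of_eq ?_))
    rw [norm_smul, Real.norm_of_nonneg hs.le]; ring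
  rw [h1, e]
  exact (map_sub_le_add _ _ _).trans (add_le_add h2 h3)

/-- For a family with bounded derivatives, convergence to zero in `L²` passes to derivatives. -/
lemma BddSmooth.tendsto_nrm2_dir {ι : Type*} {F : Filter ι} {U : ι → TorusFun n d}
    (hU : BddSmooth U) (h : Filter.Tendsto (fun i => nrm2 (U i)) F (nhds 0)) (b : Pt n d) :
    Filter.Tendsto (fun i => nrm2 (Multiscale.dir b (U i))) F (nhds 0) := by
  obtain ⟨C, hC⟩ := hU 2
  set M : ℝ := ‖b‖ ^ 2 * |C| + 1 with hM
  have hM0 : 0 < M := by positivity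
  rw [Metric.tendsto_nhds] at h ⊢
  intro r hr
  -- the step `s` makes the contribution of the second derivatives smaller than `r / 2`
  set s : ℝ := r / (2 * M) with hs
  have hs0 : 0 < s := by positivity
  filter_upwards [h (s * r / 4) (by positivity)] with i hi
  rw [Real.dist_0_eq_abs, abs_of_nonneg (apply_nonneg _ _)] at hi ⊢
  refine lt_of_mul_lt_mul_left ((mul_nrm2_dir_le b hs0 (U i)).trans_lt ?_) hs0.le
  have h1 : ‖b‖ ^ 2 * DN nrmS 2 (U i) ≤ M := by
    have := mul_le_mul_of_nonneg_left ((hC i).trans (le_abs_self C)) (sq_nonneg ‖b‖)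
    linarith
  have h2 : s ^ 2 * (‖b‖ ^ 2 * DN nrmS 2 (U i)) ≤ s * r / 2 := by
    refine (mul_le_mul_of_nonneg_left h1 (sq_nonneg s)).trans (le_of_eq ?_)
    have : s * M = r / 2 := by rw [hs]; field_simp
    calc s ^ 2 * M = s * (s * M) := by ring
      _ = s * r / 2 := by rw [this]; ring
  linarith

/-- Dominated convergence. -/
lemma tendsto_nrm2_of_pointwise {ι : Type*} {F : Filter ι} [F.IsCountablyGenerated]
    {U : ι → TorusFun n d} (hU : BddSmooth U)
    (h : ∀ y, Filter.Tendsto (fun i => (U i).1 y) F (nhds 0)) :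
    Filter.Tendsto (fun i => nrm2 (U i)) F (nhds 0) := by
  obtain ⟨C, hC⟩ := hU 0
  have h1 : Filter.Tendsto (fun i => ∫ y, (U i).1 y * (U i).1 y ∂(cell n d)) F
      (nhds (∫ _, (0 : ℝ) ∂(cell n d))) := by
    refine tendsto_integral_filter_of_dominated_convergence (fun _ => C * C)
      (.of_forall fun i => ((U i).continuous.mul (U i).continuous).aestronglyMeasurable)
      (.of_forall fun i => .of_forall fun y => ?_) (integrable_const _)
      (.of_forall fun y => ?_)
    · have := (abs_le_nrmS (U i) y).trans (hC i)
      rw [norm_mul, Real.norm_eq_abs]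
      exact mul_le_mul this this (abs_nonneg _) ((abs_nonneg _).trans this)
    · simpa using (h y).mul (h y)
  rw [integral_zero] at h1
  have h2 : (fun i => nrm2 (U i)) = fun i => √(∫ y, (U i).1 y * (U i).1 y ∂(cell n d)) := by
    funext i
    rw [← Real.sqrt_sq (apply_nonneg nrm2 (U i)), nrm2_sq, tint_def]; rfl
  rw [h2]
  simpa using h1.sqrt

/-- A family with bounded derivatives which converges to zero pointwise does so in every Sobolev
norm. -/
lemma BddSmooth.tendsto_DN_nrm2 {ι : Type*} {F : Filter ι} [F.IsCountablyGenerated]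
    {U : ι → TorusFun n d} (hU : BddSmooth U)
    (h : ∀ y, Filter.Tendsto (fun i => (U i).1 y) F (nhds 0)) (l : ℕ) :
    Filter.Tendsto (fun i => DN nrm2 l (U i)) F (nhds 0) := by
  have key : ∀ V : ι → TorusFun n d, BddSmooth V →
      Filter.Tendsto (fun i => nrm2 (V i)) F (nhds 0) →
      Filter.Tendsto (fun i => DN nrm2 l (V i)) F (nhds 0) := by
    induction l with
    | zero => exact fun V _ h => h
    | succ l ih =>
      intro V hV h
      simp only [DN_succ]
      have := tendsto_finsetSum (Finset.univ : Finset (Fin n × Fin d)) fun p _ =>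
        ih (fun i => pd p (V i)) (hV.dir _) (hV.tendsto_nrm2_dir h _)
      simpa using this
  exact key U hU (tendsto_nrm2_of_pointwise hU h)

lemma tendsto_nrmS_of_DN_nrm2 {ι : Type*} {F : Filter ι} {U : ι → TorusFun n d}
    (h : ∀ l, Filter.Tendsto (fun i => DN nrm2 l (U i)) F (nhds 0)) :
    Filter.Tendsto (fun i => nrmS (U i)) F (nhds 0) := by
  have h1 := (tendsto_finsetSum (Finset.range (n * d + 1)) fun j _ => h (0 + j)).const_mul
    ((2 : ℝ) ^ (n * d))
  rw [Finset.sum_const_zero, mul_zero] at h1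
  exact squeeze_zero (fun i => apply_nonneg _ _) (fun i => DN_nrmS_le_sum_DN_nrm2 0 (U i)) h1

/-- The linear form `h ↦ ∑ k, w k * h k`. -/
def gradForm {N : ℕ} (w : Fin N → ℝ) : (Fin N → ℝ) →L[ℝ] ℝ :=
  ∑ k, w k • ContinuousLinearMap.proj (R := ℝ) (φ := fun _ : Fin N => ℝ) k

lemma gradForm_apply {N : ℕ} (w h : Fin N → ℝ) : gradForm w h = ∑ k, w k * h k := by
  simp [gradForm]

/-- The family `f x` of smooth periodic functions is differentiable in `x`, pointwise in `y`, with
partial derivatives the smooth periodic functions `f' k x`. -/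
def HasParamDeriv {N : ℕ} (f : (Fin N → ℝ) → TorusFun n d)
    (f' : Fin N → (Fin N → ℝ) → TorusFun n d) : Prop :=
  ∀ x y, HasFDerivAt (fun x => (f x).1 y) (gradForm fun k => (f' k x).1 y) x

/-- The mean value inequality in the parameter. -/
lemma nrmS_sub_le {N : ℕ} {f : (Fin N → ℝ) → TorusFun n d}
    {f' : Fin N → (Fin N → ℝ) → TorusFun n d} (h : HasParamDeriv f f') {C : ℝ}
    (hC : ∀ k x, nrmS (f' k x) ≤ C) (x s : Fin N → ℝ) :
    nrmS (f (x + s) - f x) ≤ N * C * ‖s‖ := by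
  refine nrmS_le fun y => ?_
  have := Convex.norm_image_sub_le_of_norm_hasFDerivWithin_le
    (f := fun x => (f x).1 y) (C := N * C) (x := x) (y := x + s) (s := Set.univ)
    (fun z _ => (h z y).hasFDerivWithinAt) (fun z _ => ?_) convex_univ (Set.mem_univ _)
    (Set.mem_univ _)
  · simpa using this
  · refine (norm_sum_le _ _).trans ?_
    have h1 : ∀ k ∈ (Finset.univ : Finset (Fin N)),
        ‖(f' k z).1 y • ContinuousLinearMap.proj (R := ℝ) (φ := fun _ : Fin N => ℝ) k‖ ≤ C := by
      intro k _
      rw [norm_smul]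
      have h2 := (abs_le_nrmS (f' k z) y).trans (hC k z)
      have h3 : ‖ContinuousLinearMap.proj (R := ℝ) (φ := fun _ : Fin N => ℝ) k‖ ≤ 1 :=
        ContinuousLinearMap.opNorm_le_bound _ zero_le_one fun w => by
          rw [one_mul]; exact norm_le_pi_norm w k
      exact (mul_le_of_le_one_right (norm_nonneg _) h3).trans h2
    refine (Finset.sum_le_card_nsmul _ _ _ h1).trans (le_of_eq ?_)
    simp

lemma HasParamDeriv.fd {N : ℕ} {f : (Fin N → ℝ) → TorusFun n d}
    {f' : Fin N → (Fin N → ℝ) → TorusFun n d} (h : HasParamDeriv f f') (η : ℝ) (b : Pt n d) :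
    HasParamDeriv (fun x => fd η b (f x)) (fun k x => fd η b (f' k x)) := fun x y => by
  have h1 := ((h x (y + η • b)).sub (h x y)).const_smul η⁻¹
  refine h1.congr_fderiv ?_
  ext s
  simp only [fd_apply, TorusFun.smul_val, TorusFun.sub_val, tr_val, gradForm_apply, smul_eq_mul,
    FunLike.coe_smul, FunLike.coe_sub, Pi.smul_apply, Pi.sub_apply,
    ← Finset.sum_sub_distrib, Finset.mul_sum]
  exact Finset.sum_congr rfl fun k _ => by ring

/-- Derivatives in `y` of a family depend on the parameter in a Lipschitz way. The difference
quotients in `y` belong to families of the same kind, with bounds uniform in the step. -/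
lemma DN_sub_le {N : ℕ} (l : ℕ) {f : (Fin N → ℝ) → TorusFun n d}
    {f' : Fin N → (Fin N → ℝ) → TorusFun n d} (h : HasParamDeriv f f') {C : ℝ}
    (hC : ∀ k x, DN nrmS l (f' k x) ≤ C) (x s : Fin N → ℝ) :
    DN nrmS l (f (x + s) - f x) ≤ (Fintype.card (Fin n × Fin d)) ^ l * (N * C * ‖s‖) := by
  induction l generalizing f f' with
  | zero => simpa using nrmS_sub_le h hC x s
  | succ l ih =>
    set g := f (x + s) - f x with hg
    rw [DN_succ]
    have key : ∀ p ∈ (Finset.univ : Finset (Fin n × Fin d)), DN nrmS l (pd p g) ≤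
        (Fintype.card (Fin n × Fin d)) ^ l * (N * C * ‖s‖) := fun p _ => by
      have hp : ‖unitVec p‖ ≤ 1 := by
        refine (pi_norm_le_iff_of_nonneg zero_le_one).2 fun i =>
          (pi_norm_le_iff_of_nonneg zero_le_one).2 fun a => ?_
        rw [unitVec]
        by_cases hi : i = p.1
        · subst hi
          rw [Pi.single_eq_same]
          by_cases ha : a = p.2
          · subst ha; simp
          · simp [Pi.single_eq_of_ne ha]
        · simp [Pi.single_eq_of_ne hi]
      have h1 : ∀ η : ℝ, 0 < η → DN nrmS l (pd p g) ≤
          (Fintype.card (Fin n × Fin d)) ^ l * (N * C * ‖s‖)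
            + η * (‖unitVec p‖ ^ 2 * DN nrmS (l + 2) g) := fun η hη => by
        have e : pd p g = fd η (unitVec p) g - (fd η (unitVec p) g - pd p g) := by abel
        have e1 : fd η (unitVec p) g
            = fd η (unitVec p) (f (x + s)) - fd η (unitVec p) (f x) := map_sub _ _ _
        have h2 := ih (h.fd η (unitVec p)) fun k x => by
          refine (DN_comm_le (T := fd η (unitVec p)) (c := 1) (σ := DN nrmS 1)
            (fun q f => dir_fd _ _ _ f) (fun f => ?_) l (f' k x)).trans ?_
          · exact (nrmS_fd_le hη.ne' _ f).trans (mul_le_mul_of_nonneg_right hp (DN_nonneg _ _ _))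
          · rw [one_mul, DN_add_index]; exact hC k x
        have h3 : DN nrmS l (fd η (unitVec p) g - pd p g)
            ≤ η * (‖unitVec p‖ ^ 2 * DN nrmS (l + 2) g) := by
          have := DN_comm_le (ρ := nrmS) (σ := DN nrmS 2)
            (T := fun f => fd η (unitVec p) f - pd p f) (c := η * ‖unitVec p‖ ^ 2)
            (fun q f => by rw [map_sub, dir_fd, dir_comm])
            (fun f => by
              have := nrmS_fd_sub_dir_le hη.ne' (unitVec p) f
              rwa [abs_of_pos hη, ← mul_assoc] at this) l g
          rwa [DN_add_index, mul_assoc] at this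
        rw [e]
        refine (map_sub_le_add _ _ _).trans (add_le_add ?_ h3)
        rw [e1]; exact h2
      refine le_of_forall_pos_le_add fun r hr => ?_
      set M := ‖unitVec p‖ ^ 2 * DN nrmS (l + 2) g with hM
      have hM0 : 0 ≤ M := mul_nonneg (sq_nonneg _) (DN_nonneg _ _ _)
      refine (h1 (r / (M + 1)) (by positivity)).trans (add_le_add le_rfl ?_)
      rw [div_mul_eq_mul_div, div_le_iff₀ (by positivity)]
      nlinarith
    refine (Finset.sum_le_card_nsmul _ _ _ key).trans (le_of_eq ?_)
    rw [nsmul_eq_mul, Finset.card_univ]; ring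

/-- The normalized remainder of the first order expansion in the parameter at `x`. -/
def paramRem {N : ℕ} (f : (Fin N → ℝ) → TorusFun n d) (w : Fin N → TorusFun n d)
    (x s : Fin N → ℝ) : TorusFun n d :=
  ‖s‖⁻¹ • (f (x + s) - f x - ∑ k, s k • w k)

lemma norm_inv_mul_le (N : ℕ) (s : Fin N → ℝ) : ‖s‖⁻¹ * ‖s‖ ≤ 1 := by
  rcases eq_or_ne ‖s‖ 0 with h | h
  · simp [h]
  · rw [inv_mul_cancel₀ h]

lemma HasParamDeriv.bddSmooth_quot {N : ℕ} {f : (Fin N → ℝ) → TorusFun n d}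
    {f' : Fin N → (Fin N → ℝ) → TorusFun n d} (h : HasParamDeriv f f')
    (hb : ∀ k, BddSmooth (f' k)) (x : Fin N → ℝ) :
    BddSmooth fun s => ‖s‖⁻¹ • (f (x + s) - f x) := fun l => by
  choose C hC using fun k => hb k l
  set C1 := ∑ k, |C k| with hC1
  have h1 : ∀ k x, DN nrmS l (f' k x) ≤ C1 := fun k x => (hC k x).trans ((le_abs_self _).trans
    (Finset.single_le_sum (f := fun k => |C k|) (fun _ _ => abs_nonneg _) (Finset.mem_univ k)))
  have hC0 : 0 ≤ C1 := Finset.sum_nonneg fun _ _ => abs_nonneg _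
  refine ⟨(Fintype.card (Fin n × Fin d)) ^ l * (N * C1), fun s => ?_⟩
  rw [DN_smul, abs_of_nonneg (inv_nonneg.2 (norm_nonneg _))]
  refine (mul_le_mul_of_nonneg_left (DN_sub_le l h h1 x s)
    (inv_nonneg.2 (norm_nonneg s))).trans ?_
  calc ‖s‖⁻¹ * ((Fintype.card (Fin n × Fin d) : ℝ) ^ l * (N * C1 * ‖s‖))
      = (‖s‖⁻¹ * ‖s‖) * ((Fintype.card (Fin n × Fin d) : ℝ) ^ l * (N * C1)) := by ring
    _ ≤ _ := mul_le_of_le_one_left (by positivity) (norm_inv_mul_le N s)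

lemma abs_norm_inv_mul_le {N : ℕ} (s : Fin N → ℝ) (k : Fin N) : |‖s‖⁻¹ * s k| ≤ 1 := by
  rw [abs_mul, abs_of_nonneg (inv_nonneg.2 (norm_nonneg _))]
  exact (mul_le_mul_of_nonneg_left (norm_le_pi_norm s k) (inv_nonneg.2 (norm_nonneg s))).trans
    (norm_inv_mul_le N s)

lemma paramRem_eq {N : ℕ} (f : (Fin N → ℝ) → TorusFun n d) (w : Fin N → TorusFun n d)
    (x s : Fin N → ℝ) :
    paramRem f w x s = ‖s‖⁻¹ • (f (x + s) - f x) - ∑ k, (‖s‖⁻¹ * s k) • w k := by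
  simp only [paramRem, smul_sub _ (f (x + s) - f x), Finset.smul_sum, smul_smul]

lemma HasParamDeriv.bddSmooth_rem {N : ℕ} {f : (Fin N → ℝ) → TorusFun n d}
    {f' : Fin N → (Fin N → ℝ) → TorusFun n d} (h : HasParamDeriv f f')
    (hb : ∀ k, BddSmooth (f' k)) (x : Fin N → ℝ) :
    BddSmooth (paramRem f (fun k => f' k x) x) := by
  have := (h.bddSmooth_quot hb x).sub (BddSmooth.sum Finset.univ fun k =>
    (BddSmooth.const (f' k x)).smul fun s => abs_norm_inv_mul_le s k)
  refine fun l => ?_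
  obtain ⟨C, hC⟩ := this l
  exact ⟨C, fun s => by rw [paramRem_eq]; exact hC s⟩

/-- Differentiability in the parameter in terms of the normalized remainder. -/
lemma hasFDerivAt_iff_tendsto_paramRem {N : ℕ} (f : (Fin N → ℝ) → TorusFun n d)
    (w : Fin N → TorusFun n d) (x : Fin N → ℝ) (y : Pt n d) :
    HasFDerivAt (fun x => (f x).1 y) (gradForm fun k => (w k).1 y) x ↔
      Filter.Tendsto (fun s => (paramRem f w x s).1 y) (nhds 0) (nhds 0) := by
  have e : ∀ s, |(paramRem f w x s).1 y|
      = ‖s‖⁻¹ * ‖(f (x + s)).1 y - (f x).1 y - gradForm (fun k => (w k).1 y) s‖ := fun s => by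
    rw [paramRem, TorusFun.smul_val, abs_mul, abs_of_nonneg (inv_nonneg.2 (norm_nonneg _)),
      Real.norm_eq_abs]
    simp only [TorusFun.sub_val, TorusFun.sum_val, TorusFun.smul_val, gradForm_apply, mul_comm]
  rw [hasFDerivAt_iff_isLittleO_nhds_zero, ← Asymptotics.isLittleO_norm_norm,
    Asymptotics.isLittleO_iff_tendsto (fun s hs => by simp [norm_eq_zero.1 hs])]
  simp only [div_eq_inv_mul, ← e]
  exact (tendsto_zero_iff_abs_tendsto_zero (f := fun s => (paramRem f w x s).1 y)).symm

/-! ### Differentiating the equation in a parameter -/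

/-- The equation `G* H + τ² u = 0` with prescribed flux `H`. It is linear in `(H, u)`. -/
def FluxEq (G : GradOp n d) (τ : ℝ) (H : Fin d → TorusFun n d) (u : TorusFun n d) : Prop :=
  ∀ φ, ∑ a, tint (H a * G a φ) + τ ^ 2 * tint (u * φ) = 0

lemma weakEq_iff_fluxEq {G : GradOp n d} {τ : ℝ} {A : Fin d → Fin d → TorusFun n d}
    {F : Fin d → TorusFun n d} {u : TorusFun n d} :
    WeakEq G τ A F 0 u ↔ FluxEq G τ (fun a => ∑ b, A a b * G b u + F a) u := by
  simp only [WeakEq, FluxEq, zero_mul, map_zero]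

lemma FluxEq.sub {G : GradOp n d} {τ : ℝ} {H H' : Fin d → TorusFun n d} {u u' : TorusFun n d}
    (h : FluxEq G τ H u) (h' : FluxEq G τ H' u') :
    FluxEq G τ (fun a => H a - H' a) (u - u') := fun φ => by
  have h1 := h φ
  have h2 := h' φ
  simp only [sub_mul, map_sub, Finset.sum_sub_distrib]
  linarith

lemma FluxEq.smul {G : GradOp n d} {τ : ℝ} {H : Fin d → TorusFun n d} {u : TorusFun n d}
    (h : FluxEq G τ H u) (r : ℝ) : FluxEq G τ (fun a => r • H a) (r • u) := fun φ => by
  have h1 := congrArg (r * ·) (h φ)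
  simp only [smul_mul_assoc, map_smul, smul_eq_mul, ← Finset.mul_sum] at h1 ⊢
  linarith

lemma FluxEq.sum {G : GradOp n d} {τ : ℝ} {α : Type*} (s : Finset α)
    {H : α → Fin d → TorusFun n d} {u : α → TorusFun n d} (h : ∀ k, FluxEq G τ (H k) (u k)) :
    FluxEq G τ (fun a => ∑ k ∈ s, H k a) (∑ k ∈ s, u k) := fun φ => by
  simp only [Finset.sum_mul, map_sum, Finset.mul_sum]
  rw [Finset.sum_comm, ← Finset.sum_add_distrib]
  exact Finset.sum_eq_zero fun k _ => by rw [← h k φ]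

/-- The field `v + ∇u`. -/
def fieldOf (G : GradOp n d) (v : Fin d → ℝ) (u : TorusFun n d) (b : Fin d) : TorusFun n d :=
  v b • 1 + G b u

lemma flux_add_eq (G : GradOp n d) (A : Fin d → Fin d → TorusFun n d) (v : Fin d → ℝ)
    (u : TorusFun n d) (a : Fin d) :
    ∑ b, A a b * G b u + fluxOf A v a = ∑ b, A a b * fieldOf G v u b := by
  rw [fluxOf, ← Finset.sum_add_distrib]
  exact Finset.sum_congr rfl fun b _ => by
    rw [fieldOf, mul_add, mul_smul_comm, mul_one, add_comm]

/-- The increment of a solution under a change of the coefficients solves the equation with the old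
coefficients; the factor `r` normalizes the increment. -/
lemma weakEq_quot {G : GradOp n d} {τ : ℝ} {A0 A1 : Fin d → Fin d → TorusFun n d}
    {v : Fin d → ℝ} {X0 X1 : TorusFun n d} (h0 : WeakEq G τ A0 (fluxOf A0 v) 0 X0)
    (h1 : WeakEq G τ A1 (fluxOf A1 v) 0 X1) (r : ℝ) :
    WeakEq G τ A0 (fun a => ∑ b, (r • (A1 a b - A0 a b)) * fieldOf G v X1 b) 0 (r • (X1 - X0)) := by
  rw [weakEq_iff_fluxEq] at h0 h1 ⊢
  simp only [flux_add_eq] at h0 h1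
  have h := (h1.sub h0).smul r
  convert h using 2 with a
  rw [← Finset.sum_add_distrib, ← Finset.sum_sub_distrib, Finset.smul_sum]
  refine Finset.sum_congr rfl fun b _ => ?_
  simp only [fieldOf, map_smul, map_sub, smul_sub, sub_mul, mul_sub, mul_add, smul_add,
    mul_smul_comm, smul_mul_assoc, smul_comm r (v b)]
  abel

/-- The equation for the normalized first order remainder. Both terms of the flux are small: the
first contains the remainder of the coefficients, the second a product of two increments. -/
lemma weakEq_rem {N : ℕ} {G : GradOp n d} {τ : ℝ} {A0 A1 : Fin d → Fin d → TorusFun n d}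
    {A' : Fin N → Fin d → Fin d → TorusFun n d}
    {v : Fin d → ℝ} {X0 X1 : TorusFun n d} {W : Fin N → TorusFun n d}
    (h0 : WeakEq G τ A0 (fluxOf A0 v) 0 X0) (h1 : WeakEq G τ A1 (fluxOf A1 v) 0 X1)
    (hW : ∀ k, WeakEq G τ A0 (fun a => ∑ b, A' k a b * fieldOf G v X0 b) 0 (W k))
    (r : ℝ) (s : Fin N → ℝ) :
    WeakEq G τ A0 (fun a => ∑ b, ((r • (A1 a b - A0 a b - ∑ k, s k • A' k a b)) * fieldOf G v X0 b
      + (A1 a b - A0 a b) * G b (r • (X1 - X0)))) 0 (r • (X1 - X0 - ∑ k, s k • W k)) := by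
  have hW' := fun k => weakEq_iff_fluxEq.1 (hW k)
  rw [weakEq_iff_fluxEq] at h0 h1 ⊢
  simp only [flux_add_eq] at h0 h1
  have h := ((h1.sub h0).sub (FluxEq.sum Finset.univ fun k => (hW' k).smul (s k))).smul r
  convert h using 2 with a
  simp only [← Finset.sum_add_distrib, Finset.smul_sum]
  rw [Finset.sum_comm, ← Finset.sum_sub_distrib, ← Finset.sum_sub_distrib, Finset.smul_sum]
  refine Finset.sum_congr rfl fun b _ => ?_
  have e : A0 a b * G b (r • (X1 - X0 - ∑ k, s k • W k))
      = r • (A0 a b * G b X1 - A0 a b * G b X0 - ∑ k, s k • (A0 a b * G b (W k))) := by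
    simp only [map_smul, map_sub, map_sum, mul_smul_comm, mul_sub, Finset.mul_sum]
  have e' : (r • (A1 a b - A0 a b - ∑ k, s k • A' k a b)) * fieldOf G v X0 b
      = r • (A1 a b * fieldOf G v X0 b - A0 a b * fieldOf G v X0 b
        - ∑ k, s k • (A' k a b * fieldOf G v X0 b)) := by
    simp only [smul_mul_assoc, sub_mul, Finset.sum_mul]
  rw [e, e']
  simp only [fieldOf, map_smul, map_sub, smul_sub, sub_mul, mul_sub, mul_add, smul_add,
    mul_smul_comm, Finset.sum_add_distrib]
  abel

/-- The energy bound for a family of equations with fixed coefficients, whose fluxes have bounded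
derivatives. -/
lemma bddSmooth_of_weakEq {ι : Type*} {G : GradOp n d} (hG : G.CommPd) {τ lam : ℝ} (hlam : 0 < lam)
    (hτ : 0 < τ) {A : Fin d → Fin d → TorusFun n d} (hA : Coercive lam A)
    {F : Fin d → ι → TorusFun n d} {u : ι → TorusFun n d} (hF : ∀ a, BddSmooth (F a))
    (h : ∀ i, WeakEq G τ A (fun a => F a i) 0 (u i)) : BddSmooth u := by
  obtain ⟨c, hc0, hc⟩ := exists_energy_bound hlam A hA
  choose C hC using hF
  refine .of_nrm2 fun l => ⟨(c l * ∑ j ∈ Finset.range (l + 1), ∑ a, C a j) / τ, fun i => ?_⟩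
  rw [le_div_iff₀ hτ, mul_comm]
  refine (DN_le_energy G τ l (u i)).trans ((hc G τ _ _ _ hG hτ (h i) l).trans
    (mul_le_mul_of_nonneg_left (Finset.sum_le_sum fun j _ => ?_) (hc0 l)))
  rw [map_zero, zero_div, add_zero]
  exact Finset.sum_le_sum fun a _ => (DN_mono nrm2_le_nrmS j _).trans (hC a j i)

/-- The solutions tend to zero uniformly if the fluxes tend to zero in every Sobolev norm. -/
lemma tendsto_nrmS_of_weakEq {ι : Type*} {𝓕 : Filter ι} {G : GradOp n d} (hG : G.CommPd)
    {τ lam : ℝ} (hlam : 0 < lam)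
    (hτ : 0 < τ) {A : Fin d → Fin d → TorusFun n d} (hA : Coercive lam A)
    {F : Fin d → ι → TorusFun n d} {u : ι → TorusFun n d}
    (hF : ∀ a l, Filter.Tendsto (fun i => DN nrm2 l (F a i)) 𝓕 (nhds 0))
    (h : ∀ i, WeakEq G τ A (fun a => F a i) 0 (u i)) :
    Filter.Tendsto (fun i => nrmS (u i)) 𝓕 (nhds 0) := by
  obtain ⟨c, hc0, hc⟩ := exists_energy_bound hlam A hA
  refine tendsto_nrmS_of_DN_nrm2 fun l => ?_
  have h1 : Filter.Tendsto (fun i => (c l * ∑ j ∈ Finset.range (l + 1),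
      ∑ a, DN nrm2 j (F a i)) / τ) 𝓕 (nhds 0) := by
    have := ((tendsto_finsetSum (Finset.range (l + 1)) fun j _ =>
      tendsto_finsetSum (Finset.univ : Finset (Fin d)) fun a _ => hF a j).const_mul
        (c l)).div_const τ
    simpa using this
  refine squeeze_zero (fun i => DN_nonneg _ _ _) (fun i => ?_) h1
  rw [le_div_iff₀ hτ, mul_comm]
  refine (DN_le_energy G τ l (u i)).trans ((hc G τ _ _ _ hG hτ (h i) l).trans (le_of_eq ?_))
  simp only [map_zero, zero_div, add_zero]

/-- Solutions depend differentiably on a parameter in the coefficients, and the derivative solves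
the differentiated equation. -/
lemma hasFDerivAt_of_weakEq {N : ℕ} {b : Fin d → Pt n d} {τ lam : ℝ} (hlam : 0 < lam) (hτ : 0 < τ)
    {A : (Fin N → ℝ) → Fin d → Fin d → TorusFun n d}
    {A' : Fin N → (Fin N → ℝ) → Fin d → Fin d → TorusFun n d}
    (hd : ∀ a b, HasParamDeriv (fun x => A x a b) fun k x => A' k x a b)
    (hAb : ∀ a b, BddSmooth fun x => A x a b) (hb : ∀ k a b, BddSmooth fun x => A' k x a b)
    {X : (Fin N → ℝ) → TorusFun n d}
    (hXb : BddSmooth X) {v : Fin d → ℝ}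
    (hX : ∀ x, WeakEq (dirGrad b) τ (A x) (fluxOf (A x) v) 0 (X x)) {x : Fin N → ℝ}
    (hA : Coercive lam (A x)) {W : Fin N → TorusFun n d}
    (hW : ∀ k, WeakEq (dirGrad b) τ (A x)
      (fun a => ∑ c, A' k x a c * fieldOf (dirGrad b) v (X x) c) 0 (W k)) (y : Pt n d) :
    HasFDerivAt (fun x => (X x).1 y) (gradForm fun k => (W k).1 y) x := by
  rw [hasFDerivAt_iff_tendsto_paramRem]
  have hG := dirGrad_commPd b
  have hq : ∀ c, BddSmooth fun s => fieldOf (dirGrad b) v (X (x + s)) c := fun c =>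
    (BddSmooth.const _).add ((hXb.comp fun s => x + s).dir (b c))
  have hQ := fun a c => (hd a c).bddSmooth_quot (fun k => hb k a c) x
  have hD : BddSmooth fun s => ‖s‖⁻¹ • (X (x + s) - X x) :=
    bddSmooth_of_weakEq hG hlam hτ hA
      (F := fun a s => ∑ c, (‖s‖⁻¹ • (A (x + s) a c - A x a c))
        * fieldOf (dirGrad b) v (X (x + s)) c)
      (fun a => BddSmooth.sum _ fun c => (hQ a c).mul (hq c))
      fun s => weakEq_quot (hX x) (hX (x + s)) ‖s‖⁻¹
  have hZ := fun s : Fin N → ℝ => weakEq_rem (hX x) (hX (x + s)) hW ‖s‖⁻¹ s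
  have hsub : ∀ a c, BddSmooth fun s => A (x + s) a c - A x a c :=
    fun a c => ((hAb a c).comp fun s => x + s).sub (BddSmooth.const _)
  have hF : ∀ a, BddSmooth fun s => ∑ c, (paramRem (fun x => A x a c) (fun k => A' k x a c) x s
      * fieldOf (dirGrad b) v (X x) c
      + (A (x + s) a c - A x a c) * dirGrad b c (‖s‖⁻¹ • (X (x + s) - X x))) := fun a =>
    BddSmooth.sum _ fun c =>
      (((hd a c).bddSmooth_rem (fun k => hb k a c) x).mul (BddSmooth.const _)).add
        ((hsub a c).mul (hD.dir _))
  have h0 := tendsto_nrmS_of_weakEq (𝓕 := nhds 0) hG hlam hτ hA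
    (fun a l => (hF a).tendsto_DN_nrm2 (fun y => ?_) l) hZ
  · exact squeeze_zero_norm (fun s => abs_le_nrmS _ y) h0
  · obtain ⟨C, hC⟩ : ∃ C, ∀ c s, |(dirGrad b c (‖s‖⁻¹ • (X (x + s) - X x))).1 y| ≤ C := by
      choose C hC using fun c => hD.dir (b c) 0
      exact ⟨∑ c, |C c|, fun c s => (abs_le_nrmS _ y).trans ((hC c s).trans ((le_abs_self _).trans
        (Finset.single_le_sum (f := fun c => |C c|) (fun _ _ => abs_nonneg _)
          (Finset.mem_univ c))))⟩
    simp only [TorusFun.sum_val, TorusFun.add_val, TorusFun.mul_val, TorusFun.sub_val]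
    rw [show (0 : ℝ) = ∑ c : Fin d, (0 * (fieldOf (dirGrad b) v (X x) c).1 y + 0) by simp]
    refine tendsto_finsetSum _ fun c _ => Filter.Tendsto.add ?_ ?_
    · exact ((hasFDerivAt_iff_tendsto_paramRem _ _ x y).1 (hd a c x y)).mul_const _
    · have h1 : Filter.Tendsto (fun s => (A (x + s) a c).1 y - (A x a c).1 y) (nhds 0)
          (nhds 0) := by
        have h2 : Filter.Tendsto (fun s => x + s) (nhds (0 : Fin N → ℝ)) (nhds x) := by
          simpa using (continuous_const_add x).tendsto (0 : Fin N → ℝ)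
        simpa using (((hd a c x y).continuousAt.tendsto).comp h2).sub_const ((A x a c).1 y)
      refine squeeze_zero_norm (a := fun s => |(A (x + s) a c).1 y - (A x a c).1 y| * C)
        (fun s => ?_) ?_
      · rw [norm_mul, Real.norm_eq_abs, Real.norm_eq_abs]
        exact mul_le_mul_of_nonneg_left (hC c s) (abs_nonneg _)
      · simpa using h1.abs.mul_const C

/-! ### Coefficients depending on a parameter -/

/-- A finite family of sequences whose sum has growth `M Λ^l l!` is bounded termwise by
`K k (2Λ)^l l!`, with a total constant `∑ K k` that does not depend on the size of the family. -/
lemma exists_split_growth {α : Type*} (s : Finset α) {m : α → ℕ → ℝ} {M Lam : ℝ} (hLam : 0 < Lam)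
    (h0 : ∀ k l, 0 ≤ m k l) (h : ∀ l, ∑ k ∈ s, m k l ≤ M * Lam ^ l * l.factorial) :
    ∃ K : α → ℝ, (∀ k ∈ s, 0 ≤ K k) ∧
      (∀ k ∈ s, ∀ l, m k l ≤ K k * (2 * Lam) ^ l * l.factorial) ∧ ∑ k ∈ s, K k ≤ 2 * M := by
  have hw : ∀ l : ℕ, 0 < (2 * Lam) ^ l * l.factorial := fun l => by positivity
  have ht0 : ∀ k l, 0 ≤ m k l / ((2 * Lam) ^ l * l.factorial) := fun k l =>
    div_nonneg (h0 k l) (hw l).le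
  have hsum : ∀ l : ℕ,
      ∑ k ∈ s, m k l / ((2 * Lam) ^ l * l.factorial) ≤ M * (1 / 2) ^ l := fun l => by
    rw [← Finset.sum_div, div_le_iff₀ (hw l)]
    refine (h l).trans (le_of_eq ?_)
    rw [mul_pow, one_div, inv_pow]
    field_simp
  have hgeo : Summable fun l : ℕ => M * (1 / 2 : ℝ) ^ l := summable_geometric_two.mul_left M
  have hs : ∀ k ∈ s, Summable fun l : ℕ => m k l / ((2 * Lam) ^ l * l.factorial) := fun k hk =>
    hgeo.of_nonneg_of_le (ht0 k) fun l =>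
      (Finset.single_le_sum (f := fun k => m k l / ((2 * Lam) ^ l * l.factorial))
        (fun k _ => ht0 k l) hk).trans (hsum l)
  refine ⟨fun k => ∑' l : ℕ, m k l / ((2 * Lam) ^ l * l.factorial), fun k _ => tsum_nonneg (ht0 k),
    fun k hk l => ?_, ?_⟩
  · have := (hs k hk).le_tsum l fun j _ => ht0 k j
    rwa [div_le_iff₀ (hw l), ← mul_assoc] at this
  · rw [← Summable.tsum_finsetSum hs]
    refine ((summable_sum hs).tsum_le_tsum hsum hgeo).trans (le_of_eq ?_)
    rw [tsum_mul_left, tsum_geometric_two, mul_comm]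

section family

variable {N : ℕ} {C0 Lam0 L0 : ℝ} {A : (Fin N → ℝ) → Pt n d → Matrix (Fin d) (Fin d) ℝ}

/-- The derivative of a family of matrix fields in the parameter, as a matrix of smooth periodic
functions. -/
def paramMat (hA : IsAnalyticFamily C0 Lam0 L0 A) (hp : ∀ x, IsPeriodic (A x)) (k : Fin N)
    (x : Fin N → ℝ) (a b : Fin d) : TorusFun n d :=
  ⟨fun y => paramD k (fun x' y' => A x' y' a b) x y, hA.2.2.1 x k a b, fun y z => by
    simp only [paramD, fun x => hp x y z]⟩

lemma hasParamDeriv_matFun (hA : IsAnalyticFamily C0 Lam0 L0 A) (hp : ∀ x, IsPeriodic (A x))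
    (a b : Fin d) : HasParamDeriv (fun x => matFun (A x) (hA.1 x) (hp x) a b)
      fun k x => paramMat hA hp k x a b := fun x y => by
  refine ((hA.2.1 y a b) x).hasFDerivAt.congr_fderiv ?_
  refine ContinuousLinearMap.ext fun s => ?_
  rw [gradForm_apply]
  conv_lhs => rw [← Finset.univ_sum_single s, map_sum]
  refine Finset.sum_congr rfl fun k _ => ?_
  have : Pi.single k (s k) = s k • (Pi.single k 1 : Fin N → ℝ) := by
    rw [← Pi.single_smul, smul_eq_mul, mul_one]
  rw [this, map_smul, smul_eq_mul, mul_comm]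
  rfl

/-- With a parameter only the supremum of the sum of the entries is bounded, so that the bound on
the sum of the suprema comes from Sobolev's inequality. -/
lemma matS_matFun_le (hLam0 : 0 < Lam0) (hC0 : 0 ≤ C0) (hA : IsAnalyticFamily C0 Lam0 L0 A)
    (hp : ∀ x, IsPeriodic (A x)) (x : Fin N → ℝ) (l : ℕ) :
    matS (matFun (A x) (hA.1 x) (hp x)) l
      ≤ C0 * sobConst n d Lam0 * (2 * Lam0) ^ l * l.factorial := by
  have h := sum_DN_nrmS_le_sum (Finset.univ : Finset (Fin d × Fin d)) (l := l)
    fun q => matFun (A x) (hA.1 x) (hp x) q.1 q.2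
  have h1 := fun l => sum_DN_nrm1_le (Finset.univ : Finset (Fin d × Fin d))
    (fun q => matFun (A x) (hA.1 x) (hp x) q.1 q.2) l (C := C0 * Lam0 ^ l * l.factorial)
    fun y => by rw [Fintype.sum_prod_type]; exact hA.2.2.2.1 l x y
  rw [matS, ← Fintype.sum_prod_type' fun a b => DN nrmS l (matFun (A x) (hA.1 x) (hp x) a b)]
  exact sobolev_growth (a := fun l => ∑ q : Fin d × Fin d,
    DN nrmS l (matFun (A x) (hA.1 x) (hp x) q.1 q.2)) hC0 hLam0 h h1

lemma sum_matS_paramMat_le (hLam0 : 0 < Lam0) (hL0 : 0 ≤ L0) (hA : IsAnalyticFamily C0 Lam0 L0 A)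
    (hp : ∀ x, IsPeriodic (A x)) (x : Fin N → ℝ) (l : ℕ) :
    ∑ k, matS (paramMat hA hp k x) l
      ≤ L0 * sobConst n d Lam0 * (2 * Lam0) ^ l * l.factorial := by
  have h := sum_DN_nrmS_le_sum (Finset.univ : Finset (Fin N × Fin d × Fin d)) (l := l)
    fun q => paramMat hA hp q.1 x q.2.1 q.2.2
  have h1 := fun l => sum_DN_nrm1_le (Finset.univ : Finset (Fin N × Fin d × Fin d))
    (fun q => paramMat hA hp q.1 x q.2.1 q.2.2) l (C := L0 * Lam0 ^ l * l.factorial)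
    fun y => by simp only [Fintype.sum_prod_type]; exact hA.2.2.2.2 l x y
  have e : ∑ k, matS (paramMat hA hp k x) l = ∑ q : Fin N × Fin d × Fin d,
      DN nrmS l (paramMat hA hp q.1 x q.2.1 q.2.2) := by
    simp only [Fintype.sum_prod_type, matS]
  rw [e]
  exact sobolev_growth (a := fun l => ∑ q : Fin N × Fin d × Fin d,
    DN nrmS l (paramMat hA hp q.1 x q.2.1 q.2.2)) hL0 hLam0 h h1

lemma IsAnalyticFamily.nonneg (hA : IsAnalyticFamily C0 Lam0 L0 A) : 0 ≤ L0 := by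
  have h := hA.2.2.2.2 0 0 0
  simp only [pow_zero, mul_one, Nat.factorial_zero, Nat.cast_one] at h
  exact (Finset.sum_nonneg fun k _ => Finset.sum_nonneg fun a _ => Finset.sum_nonneg fun b _ =>
    Finset.sum_nonneg fun J _ => abs_nonneg _).trans h

end family

lemma bddSmooth_of_matS {ι : Type*} {B : ι → Fin d → Fin d → TorusFun n d}
    (h : ∀ l, ∃ C, ∀ i, matS (B i) l ≤ C) (a b : Fin d) : BddSmooth fun i => B i a b := fun l => by
  refine (h l).imp fun C hC i => le_trans ?_ (hC i)
  exact (Finset.single_le_sum (f := fun b => DN nrmS l (B i a b)) (fun _ _ => DN_nonneg _ _ _)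
    (Finset.mem_univ b)).trans (Finset.single_le_sum (f := fun a => ∑ b, DN nrmS l (B i a b))
    (fun _ _ => Finset.sum_nonneg fun _ _ => DN_nonneg _ _ _) (Finset.mem_univ a))

lemma nrm2_one_le : nrm2 (1 : TorusFun n d) ≤ 1 :=
  (nrm2_le_nrmS _).trans (nrmS_le fun y => by simp)

lemma DN_one_succ (l : ℕ) : DN nrm2 (l + 1) (1 : TorusFun n d) = 0 := by
  rw [DN_succ]
  exact Finset.sum_eq_zero fun p _ => by rw [dir_one, map_zero]

/-- The field `v + ∇u` has analytic growth; the constant `v` contributes at order zero only. -/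
lemma sum_DN_fieldOf_le {G : GradOp n d} {τ : ℝ} (hτ : 0 < τ) {v : Fin d → ℝ} (hv : v ⬝ᵥ v = 1)
    {u : TorusFun n d} {K Lam : ℝ} (hLam : 0 ≤ Lam)
    (h : ∀ l, energy G τ l u ≤ K * Lam ^ l * l.factorial) (l : ℕ) :
    ∑ b, DN nrm2 l (fieldOf G v u b) ≤ (d + K) * Lam ^ l * l.factorial := by
  have h1 : ∑ b, DN nrm2 l (v b • (1 : TorusFun n d)) ≤ d * Lam ^ l * l.factorial := by
    cases l with
    | zero =>
      have : ∀ b ∈ (Finset.univ : Finset (Fin d)), DN nrm2 0 (v b • (1 : TorusFun n d)) ≤ 1 :=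
        fun b _ => by
          rw [DN_smul]
          exact mul_le_one₀ (abs_le_one_of_dotProduct hv b) (DN_nonneg _ _ _) nrm2_one_le
      refine (Finset.sum_le_card_nsmul _ _ _ this).trans (le_of_eq ?_)
      simp
    | succ l =>
      simp only [DN_smul, DN_one_succ, mul_zero, Finset.sum_const_zero]
      positivity
  calc ∑ b, DN nrm2 l (fieldOf G v u b)
      ≤ ∑ b, (DN nrm2 l (v b • (1 : TorusFun n d)) + DN nrm2 l (G b u)) :=
        Finset.sum_le_sum fun b _ => map_add_le_add _ _ _
    _ = ∑ b, DN nrm2 l (v b • (1 : TorusFun n d)) + ∑ b, DN nrm2 l (G b u) :=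
        Finset.sum_add_distrib
    _ ≤ d * Lam ^ l * l.factorial + K * Lam ^ l * l.factorial :=
        add_le_add h1 ((sum_DN_le_energy G hτ l u).trans (h l))
    _ = _ := by ring

/-- The analytic bound for the derivative of the corrector in a parameter. -/
lemma energy_paramCorrector_le {τ lam C1 Lam1 K K' Lam2 : ℝ} (hlam : 0 < lam) (hC1 : 0 ≤ C1)
    (hLam1 : 0 < Lam1) (hτ : 0 < τ) {b : Fin d → Pt n d} {A B : Fin d → Fin d → TorusFun n d}
    (hA : Coercive lam A) (hM : ∀ i, matS A i ≤ C1 * Lam1 ^ i * i.factorial) {v : Fin d → ℝ}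
    (hv : v ⬝ᵥ v = 1) {u w : TorusFun n d} (hK : 0 ≤ K) (hK' : 0 ≤ K')
    (hLam2 : growthConst d lam C1 * Lam1 ≤ Lam2)
    (hu : ∀ l, energy (dirGrad b) τ l u ≤ K * Lam2 ^ l * l.factorial)
    (hB : ∀ i, matS B i ≤ K' * (2 * Lam1) ^ i * i.factorial)
    (hw : WeakEq (dirGrad b) τ A (fun a => ∑ c, B a c * fieldOf (dirGrad b) v u c) 0 w) (l : ℕ) :
    energy (dirGrad b) τ l w ≤ 2 * energyConst d lam * (K' * (d + K))
      * (2 * Lam1 + Lam2) ^ l * l.factorial := by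
  have hB' := two_mul_le_growthConst (d := d) hlam hC1 hLam1.le
  have hL2 : 0 ≤ Lam2 :=
    (mul_pos (growthConst_pos (d := d) hlam hC1) hLam1).le.trans hLam2
  refine hw.energy_growth (dirGrad_commPd b) hlam hτ hA hLam1.le hM hC1 (by positivity)
    (fun l => ?_) (by positivity) (by linarith) (by linarith [hB'.2]) l
  exact (sum_DN_mul_le B _ l).trans (bconv_growth hK' (by positivity) hL2 hB
    (fun j => Finset.sum_nonneg fun _ _ => DN_nonneg _ _ _)
    (fun j => sum_DN_fieldOf_le hτ hv hL2 hu j) (by positivity) l)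

lemma paramD_eq {N : ℕ} {X : (Fin N → ℝ) → TorusFun n d} {W : Fin N → (Fin N → ℝ) → TorusFun n d}
    (h : HasParamDeriv X W) (k : Fin N) (x : Fin N → ℝ) :
    paramD k (fun x y => (X x).1 y) x = (W k x).1 := by
  funext y
  rw [paramD, (h x y).fderiv, gradForm_apply, Finset.sum_eq_single k]
  · simp
  · intro j _ hj; simp [Pi.single_eq_of_ne hj]
  · simp

/-! ### Correctors -/

/-- The corrector for coefficients without parameter, with explicit constants. -/
lemma exists_corrector {ε : ℕ → ℝ} {κ τ lam C0 Lam0 : ℝ} (hn : 2 ≤ n) (hlam : 0 < lam)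
    (hC0 : 0 < C0) (hLam0 : 0 < Lam0) (hκ : 1 ≤ κ) (hε : IsScales n ε) (hτ : 0 < τ)
    (hcmp : Comparable κ (τ ^ 2)
      (maxRate n hn (1 / (Real.exp 1 * (growthConst d lam C0 * Lam0))) ε))
    {A : Pt n d → Matrix (Fin d) (Fin d) ℝ} (hE : IsElliptic lam A) (hp : IsPeriodic A)
    (hA : IsAnalyticMat C0 Lam0 A) {v : Fin d → ℝ} (hv : v ⬝ᵥ v = 1) :
    ∃ u : TorusFun n d, IsWeakSolution (ratio ε) τ A (fun y => A y *ᵥ v) u.1 ∧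
      nrmS u ≤ supConst n d (growthConst d lam C0 * Lam0) κ * (2 * energyConst d lam * C0) ∧
      ∀ l, energy (dirGrad (hatVec (ratio ε))) τ l u ≤ 2 * energyConst d lam * C0
        * (growthConst d lam C0 * Lam0) ^ l * l.factorial := by
  have hco := coercive_matFun hE hA.1 hp
  obtain ⟨u, hu⟩ := exists_weakEq hτ hlam (hatVec (ratio ε)) hco (fluxOf (matFun A hA.1 hp) v)
  have hen := energy_corrector_le hlam hC0 hLam0 hτ hco (matS_le_of_isAnalyticMat hC0 hLam0 hA hp)
    hv hu
  have hc := (energyConst_pos d hlam).le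
  exact ⟨u, isWeakSolution_of_weakEq hA.1 hp hu,
    nrmS_le_of_energy hn hε hκ hτ (mul_pos (growthConst_pos hlam hC0.le) hLam0) hcmp
      (by positivity) (hu.tint_eq_zero hτ) hen, hen⟩

lemma energy_bound_mono {f : ℕ → ℝ} {K K' Lam Lam' : ℝ} (hK : 0 ≤ K) (hKK : K ≤ K')
    (hLam : 0 ≤ Lam) (hLL : Lam ≤ Lam') (h : ∀ l, f l ≤ K * Lam ^ l * l.factorial) (l : ℕ) :
    f l ≤ K' * Lam' ^ l * l.factorial := by
  have h1 : 0 ≤ Lam' := hLam.trans hLL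
  have h2 : 0 ≤ K' := hK.trans hKK
  refine (h l).trans ?_
  gcongr

/-- The growth rate `Λ` for the derivatives of correctors in a parameter. Sobolev's inequality and
the splitting of the bound on the derivative of the coefficients cost a factor `2` each, whence
`4 Λ₀`; the other summand is the growth rate of the corrector, and the rates add up in products. -/
def paramRadius (d : ℕ) (lam C1 Lam0 : ℝ) : ℝ :=
  2 * (2 * Lam0) + growthConst d lam C1 * (2 * Lam0)

/-- The corrector `X` for coefficients depending on a parameter, and its derivatives `W k`, with
explicit constants. -/
lemma exists_paramCorrector {ε : ℕ → ℝ} {κ τ lam C0 Lam0 : ℝ} (hn : 2 ≤ n) (hlam : 0 < lam)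
    (hC0 : 0 < C0) (hLam0 : 0 < Lam0) (hκ : 1 ≤ κ) (hε : IsScales n ε) (hτ : 0 < τ)
    {C1 Lam4 K : ℝ} (hC1 : C1 = C0 * sobConst n d Lam0) (hLam4 : Lam4 = paramRadius d lam C1 Lam0)
    (hK : K = 2 * energyConst d lam * C1)
    (hcmp : Comparable κ (τ ^ 2) (maxRate n hn (1 / (Real.exp 1 * Lam4)) ε))
    {N : ℕ} {L0 : ℝ} {A : (Fin N → ℝ) → Pt n d → Matrix (Fin d) (Fin d) ℝ}
    (hE : ∀ x, IsElliptic lam (A x)) (hp : ∀ x, IsPeriodic (A x))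
    (hA : IsAnalyticFamily C0 Lam0 L0 A) {v : Fin d → ℝ} (hv : v ⬝ᵥ v = 1) :
    ∃ (X : (Fin N → ℝ) → TorusFun n d) (W : Fin N → (Fin N → ℝ) → TorusFun n d),
      HasParamDeriv X W ∧
      (∀ x, IsWeakSolution (ratio ε) τ (A x) (fun y => A x y *ᵥ v) (X x).1) ∧
      (∀ x, tint (X x) = 0) ∧
      (∀ x, nrmS (X x) ≤ supConst n d Lam4 κ * K) ∧
      (∀ x, ∑ k, nrmS (W k x) ≤ supConst n d Lam4 κ *
        (4 * energyConst d lam * sobConst n d Lam0 * (d + K)) * L0) ∧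
      (∀ l x, energy (dirGrad (hatVec (ratio ε))) τ l (X x)
        ≤ K * (growthConst d lam C1 * (2 * Lam0)) ^ l * l.factorial) ∧
      ∀ l x, ∑ k, energy (dirGrad (hatVec (ratio ε))) τ l (W k x)
        ≤ L0 * (4 * energyConst d lam * sobConst n d Lam0 * (d + K)) * Lam4 ^ l * l.factorial := by
  have hL0 := hA.nonneg
  have hS := sobConst_pos n d hLam0
  have hc := energyConst_pos d hlam
  have hC1' : 0 < C1 := by rw [hC1]; positivity
  have hK0 : 0 ≤ K := by rw [hK]; positivity
  have hg := growthConst_pos (d := d) hlam hC1'.le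
  have hLam4' : 0 < Lam4 := by rw [hLam4, paramRadius]; positivity
  have hLam24 : growthConst d lam C1 * (2 * Lam0) ≤ Lam4 := by
    rw [hLam4, paramRadius]; linarith
  have hco := fun x => coercive_matFun (hE x) (hA.1 x) (hp x)
  have hM : ∀ x l, matS (matFun (A x) (hA.1 x) (hp x)) l ≤ C1 * (2 * Lam0) ^ l * l.factorial := by
    rw [hC1]; exact matS_matFun_le hLam0 hC0.le hA hp
  set G := dirGrad (hatVec (d := d) (ratio (n := n) ε)) with hG
  choose X hX using fun x => exists_weakEq hτ hlam (hatVec (ratio ε)) (hco x)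
    (fluxOf (matFun (A x) (hA.1 x) (hp x)) v)
  choose W hW using fun k x => exists_weakEq hτ hlam (hatVec (ratio ε)) (hco x)
    (fun a => ∑ c, paramMat hA hp k x a c * fieldOf G v (X x) c)
  have hXe : ∀ x l, energy G τ l (X x)
      ≤ K * (growthConst d lam C1 * (2 * Lam0)) ^ l * l.factorial := fun x => by
    rw [hK]
    exact energy_corrector_le hlam hC1' (by positivity) hτ (hco x) (hM x) hv (hX x)
  have hWe : ∀ x, ∃ k' : Fin N → ℝ, (∀ k, 0 ≤ k' k) ∧
      ∑ k, k' k ≤ 2 * (L0 * sobConst n d Lam0) ∧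
      ∀ k l, energy G τ l (W k x)
        ≤ 2 * energyConst d lam * (k' k * (d + K)) * Lam4 ^ l * l.factorial := fun x => by
    obtain ⟨k', h0, h1, h2⟩ := exists_split_growth (Finset.univ : Finset (Fin N))
      (m := fun k l => matS (paramMat hA hp k x) l) (Lam := 2 * Lam0) (by positivity)
      (fun k l => matS_nonneg _ _) (sum_matS_paramMat_le hLam0 hL0 hA hp x)
    refine ⟨k', fun k => h0 k (Finset.mem_univ k), h2, fun k l => ?_⟩
    rw [hLam4, paramRadius]
    exact energy_paramCorrector_le hlam hC1'.le (by positivity) hτ (hco x) (hM x) hv hK0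
      (h0 k (Finset.mem_univ k)) le_rfl (hXe x) (h1 k (Finset.mem_univ k)) (hW k x) l
  have hXb : BddSmooth X := .of_nrm2 fun l => ⟨_, fun x => by
    have := (DN_le_energy G τ l (X x)).trans (hXe x l)
    rwa [mul_comm, ← le_div_iff₀ hτ] at this⟩
  refine ⟨X, W, fun x y => ?_, fun x => isWeakSolution_of_weakEq (hA.1 x) (hp x) (hX x),
    fun x => (hX x).tint_eq_zero hτ, fun x => ?_, fun x => ?_, fun l x => hXe x l, fun l x => ?_⟩
  · refine hasFDerivAt_of_weakEq hlam hτ (hasParamDeriv_matFun hA hp)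
      (bddSmooth_of_matS fun l => ⟨_, fun x => hM x l⟩)
      (fun k => bddSmooth_of_matS fun l => ⟨_, fun x => le_trans ?_
        (sum_matS_paramMat_le hLam0 hL0 hA hp x l)⟩) hXb hX (hco x) (fun k => hW k x) y
    exact Finset.single_le_sum (f := fun k => matS (paramMat hA hp k x) l)
      (fun _ _ => matS_nonneg _ _) (Finset.mem_univ k)
  · exact nrmS_le_of_energy hn hε hκ hτ hLam4' hcmp hK0 ((hX x).tint_eq_zero hτ)
      (energy_bound_mono hK0 le_rfl (by positivity) hLam24 (hXe x))
  · obtain ⟨k', h0, h1, h2⟩ := hWe x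
    have h3 := supConst_nonneg (n := n) (d := d) hLam4' (zero_le_one.trans hκ)
    calc ∑ k, nrmS (W k x)
        ≤ ∑ k, supConst n d Lam4 κ * (2 * energyConst d lam * (k' k * (d + K))) :=
          Finset.sum_le_sum fun k _ => nrmS_le_of_energy hn hε hκ hτ hLam4' hcmp
            (by have := h0 k; positivity) ((hW k x).tint_eq_zero hτ) (h2 k)
      _ = supConst n d Lam4 κ * (2 * energyConst d lam * (d + K)) * ∑ k, k' k := by
          rw [Finset.mul_sum]
          exact Finset.sum_congr rfl fun k _ => by ring
      _ ≤ supConst n d Lam4 κ * (2 * energyConst d lam * (d + K))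
            * (2 * (L0 * sobConst n d Lam0)) := mul_le_mul_of_nonneg_left h1 (by positivity)
      _ = _ := by ring
  · obtain ⟨k', h0, h1, h2⟩ := hWe x
    calc ∑ k, energy G τ l (W k x)
        ≤ ∑ k, 2 * energyConst d lam * (k' k * (d + K)) * Lam4 ^ l * l.factorial :=
          Finset.sum_le_sum fun k _ => h2 k l
      _ = 2 * energyConst d lam * (d + K) * Lam4 ^ l * l.factorial * ∑ k, k' k := by
          rw [Finset.mul_sum]
          exact Finset.sum_congr rfl fun k _ => by ring
      _ ≤ 2 * energyConst d lam * (d + K) * Lam4 ^ l * l.factorial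
            * (2 * (L0 * sobConst n d Lam0)) := mul_le_mul_of_nonneg_left h1 (by positivity)
      _ = _ := by ring

end Multiscale
end

open Multiscale in
theorem theorem3p6 (d : ℕ) (lam C0 : ℝ) (hlam : 0 < lam) (hC0 : 0 < C0) :
    -- Coefficients without parameter; `Cstar` depends on `d`, `lam`, `C0` only.
    (∃ Cstar : ℝ, 0 < Cstar ∧
      ∀ (n : ℕ) (hn : 2 ≤ n) (Lam0 : ℝ), 0 < Lam0 → ∀ κ : ℝ, 1 ≤ κ →
      ∃ (c : ℝ) (cs : ℕ → ℝ) (C : ℝ), 0 < c ∧ (∀ j, 0 < cs j) ∧ 0 < C ∧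
      ∀ ε : ℕ → ℝ, Multiscale.IsScales n ε → Multiscale.ScaleSeparated n cs ε →
      ∀ τ : ℝ, 0 < τ → Multiscale.Comparable κ (τ ^ 2) (Multiscale.maxRate n hn c ε) →
      ∀ A : Multiscale.Pt n d → Matrix (Fin d) (Fin d) ℝ,
        Multiscale.IsElliptic lam A → Multiscale.IsPeriodic A →
        Multiscale.IsAnalyticMat C0 Lam0 A →
      ∀ v : Fin d → ℝ, v ⬝ᵥ v = 1 →
      ∃ X : Multiscale.Pt n d → ℝ,
        ContDiff ℝ ∞ X ∧
        Multiscale.IsWeakSolution (Multiscale.ratio ε) τ A (fun y => A y *ᵥ v) X ∧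
        (∀ Z : Multiscale.Pt n d → ℝ,
          Multiscale.IsWeakSolution (Multiscale.ratio ε) τ A (fun y => A y *ᵥ v) Z →
          Z =ᵐ[volume] X) ∧
        Multiscale.normD ∞ 0 X ≤ ENNReal.ofReal C ∧
        ∀ l : ℕ,
          ∑ a, Multiscale.normD 2 l (fun y => Multiscale.hatGrad (Multiscale.ratio ε) X y a)
            + ENNReal.ofReal τ * Multiscale.normD 2 l X
          ≤ ENNReal.ofReal (Cstar * (Cstar * Lam0) ^ l * (l.factorial : ℝ))) ∧
    -- Coefficients depending on a parameter `x` in `ℝ^N`; no constant depends on `N` or `L0`.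
    (∀ (n : ℕ) (hn : 2 ≤ n) (Lam0 : ℝ), 0 < Lam0 → ∀ κ : ℝ, 1 ≤ κ →
      ∃ (c : ℝ) (cs : ℕ → ℝ) (C Cstar Csharp Lsharp : ℝ),
        0 < c ∧ (∀ j, 0 < cs j) ∧ 0 < C ∧ 0 < Cstar ∧ 0 < Csharp ∧ 0 < Lsharp ∧
      ∀ ε : ℕ → ℝ, Multiscale.IsScales n ε → Multiscale.ScaleSeparated n cs ε →
      ∀ τ : ℝ, 0 < τ → Multiscale.Comparable κ (τ ^ 2) (Multiscale.maxRate n hn c ε) →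
      ∀ (N : ℕ) (L0 : ℝ) (A : (Fin N → ℝ) → Multiscale.Pt n d → Matrix (Fin d) (Fin d) ℝ),
        (∀ x, Multiscale.IsElliptic lam (A x)) → (∀ x, Multiscale.IsPeriodic (A x)) →
        Multiscale.IsAnalyticFamily C0 Lam0 L0 A →
      ∀ v : Fin d → ℝ, v ⬝ᵥ v = 1 →
      ∃ X : (Fin N → ℝ) → Multiscale.Pt n d → ℝ,
        (∀ x, ContDiff ℝ ∞ (X x)) ∧
        (∀ y, Differentiable ℝ (fun x => X x y)) ∧
        (∀ x k, ContDiff ℝ ∞ (Multiscale.paramD k X x)) ∧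
        (∀ x, Multiscale.IsWeakSolution (Multiscale.ratio ε) τ (A x) (fun y => A x y *ᵥ v) (X x)) ∧
        (∀ x, ∫ y, X x y ∂(Multiscale.cell n d) = 0) ∧
        (∀ x, ∀ Z : Multiscale.Pt n d → ℝ,
          Multiscale.IsWeakSolution (Multiscale.ratio ε) τ (A x) (fun y => A x y *ᵥ v) Z →
          Z =ᵐ[volume] X x) ∧
        (∀ x, Multiscale.normD ∞ 0 (X x) ≤ ENNReal.ofReal C) ∧
        (∀ x, ∑ k, Multiscale.normD ∞ 0 (Multiscale.paramD k X x) ≤ ENNReal.ofReal (C * L0)) ∧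
        (∀ (l : ℕ) x,
          ∑ a, Multiscale.normD 2 l (fun y => Multiscale.hatGrad (Multiscale.ratio ε) (X x) y a)
            ≤ ENNReal.ofReal (Cstar * (Cstar * Lam0) ^ l * (l.factorial : ℝ))) ∧
        (∀ (l : ℕ) x,
          ∑ k, ∑ a, Multiscale.normD 2 l
              (fun y => Multiscale.hatGrad (Multiscale.ratio ε) (Multiscale.paramD k X x) y a)
            ≤ ENNReal.ofReal (L0 * Csharp * Lsharp ^ l * (l.factorial : ℝ)))) := by
  have hc := energyConst_pos d hlam
  constructor
  · set g := growthConst d lam C0 with hg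
    have hg0 : 0 < g := growthConst_pos hlam hC0.le
    have hK : 0 < 2 * energyConst d lam * C0 := by positivity
    -- `c = 1 / (e Λ)` matches the exponential gain in `iterate_bound`; `c_j = 1` suffices
    refine ⟨g + 2 * energyConst d lam * C0, by positivity, fun n hn Lam0 hLam0 κ hκ =>
      ⟨1 / (Real.exp 1 * (g * Lam0)), fun _ => 1,
        supConst n d (g * Lam0) κ * (2 * energyConst d lam * C0) + 1, by positivity,
        fun _ => one_pos, ?_, fun ε hε _ τ hτ hcmp A hE hp hA v hv => ?_⟩⟩
    · have := supConst_nonneg (n := n) (d := d) (mul_pos hg0 hLam0) (zero_le_one.trans hκ)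
      positivity
    obtain ⟨u, hu, hsup, hen⟩ := exists_corrector hn hlam hC0 hLam0 hκ hε hτ hcmp hE hp hA hv
    refine ⟨u.1, u.contDiff, hu, fun Z hZ => isWeakSolution_unique hτ hlam hE hA.1 hp hZ hu, ?_,
      fun l => ?_⟩
    · rw [normD_top]
      exact ENNReal.ofReal_le_ofReal (hsup.trans (le_add_of_nonneg_right zero_le_one))
    · rw [sum_normD_eq_energy _ hτ]
      exact ENNReal.ofReal_le_ofReal (energy_bound_mono hK.le (le_add_of_nonneg_left hg0.le)
        (by positivity) (mul_le_mul_of_nonneg_right (le_add_of_nonneg_right hK.le) hLam0.le) hen l)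
  · intro n hn Lam0 hLam0 κ hκ
    have hS := sobConst_pos n d hLam0
    obtain ⟨C1, hC1⟩ : ∃ C1, C1 = C0 * sobConst n d Lam0 := ⟨_, rfl⟩
    obtain ⟨Lam4, hLam4⟩ : ∃ Lam4, Lam4 = paramRadius d lam C1 Lam0 := ⟨_, rfl⟩
    obtain ⟨K, hK⟩ : ∃ K, K = 2 * energyConst d lam * C1 := ⟨_, rfl⟩
    have hC1' : 0 < C1 := by rw [hC1]; positivity
    have hK0 : 0 < K := by rw [hK]; positivity
    have hg0 : 0 < growthConst d lam C1 := growthConst_pos hlam hC1'.le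
    have hLam4' : 0 < Lam4 := by rw [hLam4, paramRadius]; positivity
    have hs := supConst_nonneg (n := n) (d := d) hLam4' (zero_le_one.trans hκ)
    set M := 4 * energyConst d lam * sobConst n d Lam0 * (d + K) with hM
    have hM0 : 0 < M := by positivity
    refine ⟨1 / (Real.exp 1 * Lam4), fun _ => 1, supConst n d Lam4 κ * (K + M) + 1,
      2 * growthConst d lam C1 + K, M, Lam4, by positivity, fun _ => one_pos, by positivity,
      by positivity, hM0, hLam4', fun ε hε _ τ hτ hcmp N L0 A hE hp hA v hv => ?_⟩
    obtain ⟨X, W, hd, hX, hmean, hXs, hWs, hXe, hWe⟩ :=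
      exists_paramCorrector hn hlam hC0 hLam0 hκ hε hτ hC1 hLam4 hK hcmp hE hp hA hv
    have hL0 := hA.nonneg
    have hle : ∀ l (u : TorusFun n d), ∑ a, DN nrm2 l (dir (hatVec (ratio ε) a) u)
        ≤ energy (dirGrad (hatVec (ratio ε))) τ l u := fun l u => sum_DN_le_energy _ hτ l u
    refine ⟨fun x => (X x).1, fun x => (X x).contDiff, fun y x => (hd x y).differentiableAt,
      fun x k => ?_, hX, hmean,
      fun x Z hZ => isWeakSolution_unique hτ hlam (hE x) (hA.1 x) (hp x) hZ (hX x),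
      fun x => ?_, fun x => ?_, fun l x => ?_, fun l x => ?_⟩
    · rw [paramD_eq hd]
      exact (W k x).contDiff
    · rw [normD_top]
      refine ENNReal.ofReal_le_ofReal ((hXs x).trans ?_)
      have : 0 ≤ supConst n d Lam4 κ * M := by positivity
      linarith
    · simp only [paramD_eq hd, normD_top]
      rw [← ENNReal.ofReal_sum_of_nonneg fun _ _ => DN_nonneg _ _ _]
      refine ENNReal.ofReal_le_ofReal ((hWs x).trans (mul_le_mul_of_nonneg_right ?_ hL0))
      have : 0 ≤ supConst n d Lam4 κ * K := by positivity
      linarith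
    · rw [sum_normD_hatGrad]
      refine ENNReal.ofReal_le_ofReal ((hle l _).trans (energy_bound_mono hK0.le
        (le_add_of_nonneg_left (by positivity)) (by positivity) ?_ (fun l => hXe l x) l))
      have : 0 ≤ K * Lam0 := by positivity
      linarith
    · simp only [paramD_eq hd, sum_normD_hatGrad]
      rw [← ENNReal.ofReal_sum_of_nonneg fun _ _ => Finset.sum_nonneg fun _ _ => DN_nonneg _ _ _]
      exact ENNReal.ofReal_le_ofReal ((Finset.sum_le_sum fun k _ => hle l _).trans (hWe l x))
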